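/- **Setting.** Let $n\ge 0$, $0=x_0<x_1<\dots<x_{n+1}$, $\kappa_j>0$ and $\sigma_j=\sqrt{\kappa_j}$ for $1\le j\le n+1$, let $H_j\in\mathbb R\setminus\{0\}$ for $1\le j\le n$, and let $\beta_1,\dots,\beta_4\in\mathbb R$ with $(\beta_1,\beta_2)\ne(0,0)\ne(\beta_3,\beta_4)$. Consider the problem $$u^{(j)}_t=\kappa_j u^{(j)}_{xx}\quad(x_{j-1}<x<x_j,\ t>0),\qquad u^{(j)}(x,0)=u^{(j)}_0(x)\quad (x_{j-1}<x<x_j),\qquad 1\le j\le n+1,$$ $$\beta_1u^{(1)}(x_0,t)+\beta_2u^{(1)}_x(x_0,t)=f_1(t),\qquad \beta_3u^{(n+1)}(x_{n+1},t)+\beta_4u^{(n+1)}_x(x_{n+1},t)=f_2(t)\qquad(t>0),$$ $$\sigma_j^2u^{(j)}_x(x_j,t)=\sigma_{j+1}^2u^{(j+1)}_x(x_j,t)=H_j\bigl(u^{(j+1)}(x_j,t)-u^{(j)}(x_j,t)\bigr)\qquad(t>0,\ 1\le j\le n).$$ A solution is a family of real functions $u^{(j)}$ such that $u^{(j)},u^{(j)}_x$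 exist and are continuous on $[x_{j-1},x_j]\times(0,\infty)$ (one-sided $x$-derivatives at the end points), $u^{(j)}_t,u^{(j)}_{xx}$ exist and are continuous on $(x_{j-1},x_j)\times(0,\infty)$, the functions $u^{(j)}$ and $u_x^{(j)}$ at $x_{j-1}$ and at $x_j$ are integrable on $(0,T)$ for every $T>0$, the datum $u^{(j)}_0$ is integrable and is attained in the sense that $\int_{x_{j-1}}^{x_j}|u^{(j)}(x,t)-u_0^{(j)}(x)|\,dx\to0$ as $t\downarrow0$, and the equations above hold. **Notation.** Put $\hat u^{(j)}(k,t)=\int_{x_{j-1}}^{x_j}e^{-ikx}u^{(j)}(x,t)\,dx$, $\hat u_0^{(j)}(k)=\int_{x_{j-1}}^{x_j}e^{-ikx}u_0^{(j)}(x)\,dx$, $\tilde f_m(\omega,T)=\int_0^Te^{\omega s}f_m(s)\,ds$, $$g_0^{(j)}(\omega,T)=\int_0^Te^{\omega s}u^{(j)}(x_{j-1},s)\,ds,\quad g_1^{(j)}(\omega,T)=\int_0^Te^{\omega s}u_x^{(j)}(x_{j-1},s)\,ds,$$ $$h_0^{(j)}(\omega,T)=\int_0^Te^{\omega s}u^{(j)}(x_{j},s)\,ds,\quad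 h_1^{(j)}(\omega,T)=\int_0^Te^{\omega s}u_x^{(j)}(x_{j},s)\,ds .$$ Let $D_R^\pm=\{\nu\in\mathbb C:\pm\operatorname{Im}\nu>0,\ \operatorname{Re}\nu^2<0,\ |\nu|>R\}$, with $\partial D_R^\pm$ oriented so that $D_R^\pm$ lies to the left. For a vector-valued function $$Z=(G_1^{(1)},G_0^{(1)},\dots,G_0^{(n+1)},H_0^{(1)},\dots,H_0^{(n+1)},H_1^{(n+1)})^\top$$ of $\nu$ with $2n+4$ components, and for $x_{j-1}<x<x_j$, $t>0$, set $$I_j^-[Z]=\int_{\partial D_R^-}e^{\frac{i\nu(x-x_j)}{\sigma_j}-\nu^2t}M_j(\nu)\,d\nu,\qquad I_j^+[Z]=\int_{\partial D_R^+}e^{\frac{i\nu(x-x_{j-1})}{\sigma_j}-\nu^2t}P_j(\nu)\,d\nu,$$ $$M_j=\tfrac1{\sigma_j}\bigl(H_jG_0^{(j+1)}+(i\sigma_j\nu-H_j)H_0^{(j)}\bigr)\ (j\le n),\qquad M_{n+1}=\sigma_{n+1}H_1^{(n+1)}+i\nu H_0^{(n+1)},$$ $$P_1=\sigma_1G_1^{(1)}+i\nu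 G_0^{(1)},\qquad P_j=\tfrac1{\sigma_j}\bigl((H_{j-1}+i\sigma_j\nu)G_0^{(j)}-H_{j-1}H_0^{(j-1)}\bigr)\ (j\ge2),$$ and $$\mathcal S_j[Z](x,t)=\frac1{2\pi}\int_{-\infty}^\infty e^{ikx-\sigma_j^2k^2t}\,\hat u_0^{(j)}(k)\,dk-\frac1{2\pi}I_j^-[Z]-\frac1{2\pi}I_j^+[Z].$$ Let $\mathcal A(\nu)$ be the $(2n+4)\times(2n+4)$ matrix for which the entries of $\mathcal A(\nu)Z$ are, in this order: $\beta_2G_1^{(1)}+\beta_1G_0^{(1)}$; then $\mathcal R_1(\nu),\dots,\mathcal R_{n+1}(\nu)$; then $\mathcal R_1(-\nu),\dots,\mathcal R_{n+1}(-\nu)$; then $\beta_3H_0^{(n+1)}+\beta_4H_1^{(n+1)}$. Here, with the components of $Z$ regarded as independent unknowns (not changed when $\nu$ is replaced by $-\nu$), $$\mathcal R_j(\nu)=\sigma_je^{-\frac{i\nu x_j}{\sigma_j}}M_j(\nu)-\sigma_je^{-\frac{i\nu x_{j-1}}{\sigma_j}}P_j(\nu).$$ Let $$Y(\nu,T)=\Bigl(\tilde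 f_1(\nu^2,T),-\hat u_0^{(1)}\bigl(\tfrac{\nu}{\sigma_1}\bigr),\dots,-\hat u_0^{(n+1)}\bigl(\tfrac{\nu}{\sigma_{n+1}}\bigr),-\hat u_0^{(1)}\bigl(\tfrac{-\nu}{\sigma_1}\bigr),\dots,-\hat u_0^{(n+1)}\bigl(\tfrac{-\nu}{\sigma_{n+1}}\bigr),\tilde f_2(\nu^2,T)\Bigr)^\top,$$ which involves only the data, and $$\mathcal Y(\nu,T)=e^{\nu^2T}\Bigl(0,\hat u^{(1)}\bigl(\tfrac{\nu}{\sigma_1},T\bigr),\dots,\hat u^{(n+1)}\bigl(\tfrac{\nu}{\sigma_{n+1}},T\bigr),\hat u^{(1)}\bigl(\tfrac{-\nu}{\sigma_1},T\bigr),\dots,\hat u^{(n+1)}\bigl(\tfrac{-\nu}{\sigma_{n+1}},T\bigr),0\Bigr)^\top,$$ and let $X(\nu^2,T)$ be the vector of the true transforms, i.e. $Z$ with $G_\ell^{(j)}=g_\ell^{(j)}(\nu^2,T)$ and $H_\ell^{(j)}=h_\ell^{(j)}(\nu^2,T)$. **Theorem.** There is $R_0>0$, depending only on $n$, the $x_j,\kappa_j,H_j$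 and $\beta_1,\dots,\beta_4$, such that $\det\mathcal A(\nu)\ne0$ for all $\nu\in\overline{D_R^+}\cup\overline{D_R^-}$ and all $R\ge R_0$, and such that for every solution $(u^{(j)})$ of the problem, with any data $u_0^{(j)},f_1,f_2$, and every $T>0$ the following holds. 1. $\mathcal A(\nu)X(\nu^2,T)=\mathcal Y(\nu,T)+Y(\nu,T)$ for all $\nu\in\mathbb C$. 2. For all $0<t\le T$, $1\le j\le n+1$, $x_{j-1}<x<x_j$ and all $R>0$: $u^{(j)}(x,t)=\mathcal S_j[X(\nu^2,T)](x,t)$. 3. For all $0<t\le T$, $1\le j\le n+1$, $x_{j-1}<x<x_j$ and all $R\ge R_0$: the terms with the unknown final-time transforms contribute nothing, $I_j^-[\mathcal A^{-1}\mathcal Y]=0=I_j^+[\mathcal A^{-1}\mathcal Y]$; and hence the transforms may be replaced by the solution of the linear system $\mathcal A(\nu)Z(\nu)=Y(\nu,T)$, which involves only known data: $$u^{(j)}(x,t)=\mathcal S_j[\mathcal A^{-1}Y](x,t).$$ All integrals that occur in 2 and 3 converge absolutely. -/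

import Mathlib

noncomputable section

namespace MultilayerHeat

/-- A composite medium `[0, x (n+1)]` made of the layers `[x (j-1), x j]`, `1 ≤ j ≤ n + 1`, with
conductivities `κ j`, contact transfer coefficients `H j` at the interfaces `x j`, `1 ≤ j ≤ n`, and
(nondegenerate) boundary coefficients. Values at other indices are irrelevant. -/
structure Medium (n : ℕ) where
  x : ℕ → ℝ
  κ : ℕ → ℝ
  H : ℕ → ℝ
  β₁ : ℝ
  β₂ : ℝ
  β₃ : ℝ
  β₄ : ℝ
  x_zero : x 0 = 0
  x_lt : ∀ j, j ≤ n → x j < x (j + 1)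
  κ_pos : ∀ j, 1 ≤ j → j ≤ n + 1 → 0 < κ j
  H_ne : ∀ j, 1 ≤ j → j ≤ n → H j ≠ 0
  left_ne : β₁ ≠ 0 ∨ β₂ ≠ 0
  right_ne : β₃ ≠ 0 ∨ β₄ ≠ 0

variable {n : ℕ}

namespace Medium

/-- `σ j = √(κ j)`. -/
def σ (P : Medium n) (j : ℕ) : ℝ := Real.sqrt (P.κ j)

/-- The closed `j`-th layer. -/
def layer (P : Medium n) (j : ℕ) : Set ℝ := Set.Icc (P.x (j - 1)) (P.x j)

/-- The open `j`-th layer. -/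
def openLayer (P : Medium n) (j : ℕ) : Set ℝ := Set.Ioo (P.x (j - 1)) (P.x j)

/-- `u_x^{(j)}(y,t)` on the closed layer (one-sided at the two end points). -/
def ux (P : Medium n) (u : ℕ → ℝ → ℝ → ℝ) (j : ℕ) (y t : ℝ) : ℝ :=
  derivWithin (fun z => u j z t) (P.layer j) y

end Medium

/-- `u j` is the temperature in the `j`-th layer: a classical solution for `t > 0`, `C¹` in space up
to the interfaces, with integrable boundary traces, which takes its initial datum in the mean and
satisfies Robin boundary conditions and imperfect-contact interface conditions. -/
structure IsSolution (P : Medium n) (u₀ : ℕ → ℝ → ℝ) (f₁ f₂ : ℝ → ℝ)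
    (u : ℕ → ℝ → ℝ → ℝ) : Prop where
  continuousOn : ∀ j, 1 ≤ j → j ≤ n + 1 →
    ContinuousOn (fun p : ℝ × ℝ => u j p.1 p.2) (P.layer j ×ˢ Set.Ioi 0)
  differentiableOn : ∀ j, 1 ≤ j → j ≤ n + 1 → ∀ t, 0 < t →
    DifferentiableOn ℝ (fun y => u j y t) (P.layer j)
  continuousOn_ux : ∀ j, 1 ≤ j → j ≤ n + 1 →
    ContinuousOn (fun p : ℝ × ℝ => P.ux u j p.1 p.2) (P.layer j ×ˢ Set.Ioi 0)
  differentiableAt_time : ∀ j, 1 ≤ j → j ≤ n + 1 → ∀ y ∈ P.openLayer j, ∀ t, 0 < t →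
    DifferentiableAt ℝ (fun s => u j y s) t
  differentiableAt_ux : ∀ j, 1 ≤ j → j ≤ n + 1 → ∀ y ∈ P.openLayer j, ∀ t, 0 < t →
    DifferentiableAt ℝ (fun z => P.ux u j z t) y
  continuousOn_ut : ∀ j, 1 ≤ j → j ≤ n + 1 →
    ContinuousOn (fun p : ℝ × ℝ => deriv (fun s => u j p.1 s) p.2) (P.openLayer j ×ˢ Set.Ioi 0)
  heat : ∀ j, 1 ≤ j → j ≤ n + 1 → ∀ y ∈ P.openLayer j, ∀ t, 0 < t →
    deriv (fun s => u j y s) t = P.κ j * deriv (fun z => P.ux u j z t) y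
  integrable_initial : ∀ j, 1 ≤ j → j ≤ n + 1 →
    MeasureTheory.IntegrableOn (u₀ j) (P.openLayer j)
  initial : ∀ j, 1 ≤ j → j ≤ n + 1 →
    Filter.Tendsto (fun t => ∫ y in P.openLayer j, |u j y t - u₀ j y|)
      (nhdsWithin 0 (Set.Ioi 0)) (nhds 0)
  integrable_left : ∀ j, 1 ≤ j → j ≤ n + 1 → ∀ T, 0 < T →
    MeasureTheory.IntegrableOn (fun s => u j (P.x (j - 1)) s) (Set.Ioc 0 T)
  integrable_right : ∀ j, 1 ≤ j → j ≤ n + 1 → ∀ T, 0 < T →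
    MeasureTheory.IntegrableOn (fun s => u j (P.x j) s) (Set.Ioc 0 T)
  integrable_ux_left : ∀ j, 1 ≤ j → j ≤ n + 1 → ∀ T, 0 < T →
    MeasureTheory.IntegrableOn (fun s => P.ux u j (P.x (j - 1)) s) (Set.Ioc 0 T)
  integrable_ux_right : ∀ j, 1 ≤ j → j ≤ n + 1 → ∀ T, 0 < T →
    MeasureTheory.IntegrableOn (fun s => P.ux u j (P.x j) s) (Set.Ioc 0 T)
  left_bc : ∀ t, 0 < t → P.β₁ * u 1 (P.x 0) t + P.β₂ * P.ux u 1 (P.x 0) t = f₁ t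
  right_bc : ∀ t, 0 < t →
    P.β₃ * u (n + 1) (P.x (n + 1)) t + P.β₄ * P.ux u (n + 1) (P.x (n + 1)) t = f₂ t
  interface_left : ∀ j, 1 ≤ j → j ≤ n → ∀ t, 0 < t →
    P.κ j * P.ux u j (P.x j) t = P.H j * (u (j + 1) (P.x j) t - u j (P.x j) t)
  interface_right : ∀ j, 1 ≤ j → j ≤ n → ∀ t, 0 < t →
    P.κ (j + 1) * P.ux u (j + 1) (P.x j) t = P.H j * (u (j + 1) (P.x j) t - u j (P.x j) t)

/-- `∫_{x (j-1)}^{x j} e^{-iky} φ(y) dy`. -/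
def spaceTransform (P : Medium n) (j : ℕ) (φ : ℝ → ℝ) (k : ℂ) : ℂ :=
  ∫ y in (P.x (j - 1))..(P.x j), Complex.exp (-(Complex.I * k * y)) * (φ y : ℂ)

/-- `∫_0^T e^{ω s} φ(s) ds`. -/
def timeTransform (φ : ℝ → ℝ) (ω : ℂ) (T : ℝ) : ℂ :=
  ∫ s in (0 : ℝ)..T, Complex.exp (ω * s) * (φ s : ℂ)

/-- The time transforms `g_0^{(j)}`, `g_1^{(j)}` at the left end and `h_0^{(j)}`, `h_1^{(j)}` at the
right end of the `j`-th layer. -/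
def g₀ (P : Medium n) (u : ℕ → ℝ → ℝ → ℝ) (j : ℕ) (ω : ℂ) (T : ℝ) : ℂ :=
  timeTransform (fun s => u j (P.x (j - 1)) s) ω T

def g₁ (P : Medium n) (u : ℕ → ℝ → ℝ → ℝ) (j : ℕ) (ω : ℂ) (T : ℝ) : ℂ :=
  timeTransform (fun s => P.ux u j (P.x (j - 1)) s) ω T

def h₀ (P : Medium n) (u : ℕ → ℝ → ℝ → ℝ) (j : ℕ) (ω : ℂ) (T : ℝ) : ℂ :=
  timeTransform (fun s => u j (P.x j) s) ω T

def h₁ (P : Medium n) (u : ℕ → ℝ → ℝ → ℝ) (j : ℕ) (ω : ℂ) (T : ℝ) : ℂ :=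
  timeTransform (fun s => P.ux u j (P.x j) s) ω T

/-- Indices of the `2n+4` rows and columns, as two blocks of size `n+2`. -/
abbrev Idx (n : ℕ) : Type := Fin (n + 2) ⊕ Fin (n + 2)

/-- `e^{iνy/σ_j}`. -/
def E (P : Medium n) (j : ℕ) (y : ℝ) (ν : ℂ) : ℂ :=
  Complex.exp (Complex.I * ν * y / P.σ j)

/-! Columns of the first block belong to `g_1^{(1)}, g_0^{(1)}, …, g_0^{(n+1)}`, those of the second
to `h_0^{(1)}, …, h_0^{(n+1)}, h_1^{(n+1)}`. Rows of the first block are the left boundary condition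
and the global relations of the layers `1, …, n+1` at `ν`; rows of the second are the global
relations of the layers `1, …, n+1` at `-ν` and the right boundary condition. -/

def A₁₁ (P : Medium n) (ν : ℂ) : Matrix (Fin (n + 2)) (Fin (n + 2)) ℂ :=
  Matrix.of fun row col =>
    let r : ℕ := row
    let c : ℕ := col
    if r = 0 then
      if c = 0 then (P.β₂ : ℂ) else if c = 1 then (P.β₁ : ℂ) else 0
    else if r = 1 ∧ c = 0 then -(P.σ 1 : ℂ) ^ 2
    else if c = r then
      if r = 1 then -(Complex.I * P.σ 1 * ν)
      else -(P.H (r - 1) + Complex.I * P.σ r * ν) * E P r (P.x (r - 1)) (-ν)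
    else if c = r + 1 then P.H r * E P r (P.x r) (-ν)
    else 0

def A₁₂ (P : Medium n) (ν : ℂ) : Matrix (Fin (n + 2)) (Fin (n + 2)) ℂ :=
  Matrix.of fun row col =>
    let r : ℕ := row
    let c : ℕ := col
    if r = 0 then 0
    else if c + 1 = r then
      if r = n + 1 then Complex.I * P.σ r * ν * E P r (P.x r) (-ν)
      else (Complex.I * P.σ r * ν - P.H r) * E P r (P.x r) (-ν)
    else if c + 2 = r then P.H (r - 1) * E P r (P.x (r - 1)) (-ν)
    else if r = n + 1 ∧ c = n + 1 then (P.σ r : ℂ) ^ 2 * E P r (P.x r) (-ν)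
    else 0

def A₂₁ (P : Medium n) (ν : ℂ) : Matrix (Fin (n + 2)) (Fin (n + 2)) ℂ :=
  Matrix.of fun row col =>
    let r : ℕ := row
    let c : ℕ := col
    if r = n + 1 then 0
    else if r = 0 ∧ c = 0 then -(P.σ 1 : ℂ) ^ 2
    else if c = r + 1 then
      if r = 0 then Complex.I * P.σ 1 * ν
      else (Complex.I * P.σ (r + 1) * ν - P.H r) * E P (r + 1) (P.x r) ν
    else if c = r + 2 then P.H (r + 1) * E P (r + 1) (P.x (r + 1)) ν
    else 0

def A₂₂ (P : Medium n) (ν : ℂ) : Matrix (Fin (n + 2)) (Fin (n + 2)) ℂ :=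
  Matrix.of fun row col =>
    let r : ℕ := row
    let c : ℕ := col
    if r = n + 1 then
      if c = n then (P.β₃ : ℂ) else if c = n + 1 then (P.β₄ : ℂ) else 0
    else if c = r then
      if r = n then -(Complex.I * P.σ (r + 1) * ν) * E P (r + 1) (P.x (r + 1)) ν
      else -(Complex.I * P.σ (r + 1) * ν + P.H (r + 1)) * E P (r + 1) (P.x (r + 1)) ν
    else if c + 1 = r then P.H r * E P (r + 1) (P.x r) ν
    else if r = n ∧ c = n + 1 then (P.σ (r + 1) : ℂ) ^ 2 * E P (r + 1) (P.x (r + 1)) ν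
    else 0

/-- The coefficient matrix `𝒜(ν)`. -/
def A (P : Medium n) (ν : ℂ) : Matrix (Idx n) (Idx n) ℂ :=
  Matrix.fromBlocks (A₁₁ P ν) (A₁₂ P ν) (A₂₁ P ν) (A₂₂ P ν)

/-- The vector `X(ν²,T)` of boundary transforms of `u`. -/
def X (P : Medium n) (u : ℕ → ℝ → ℝ → ℝ) (T : ℝ) (ν : ℂ) : Idx n → ℂ :=
  Sum.elim
    (fun i => if (i : ℕ) = 0 then g₁ P u 1 (ν ^ 2) T else g₀ P u i (ν ^ 2) T)
    (fun i => if (i : ℕ) = n + 1 then h₁ P u (n + 1) (ν ^ 2) T else h₀ P u (i + 1) (ν ^ 2) T)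

/-- The known right-hand side `Y(ν,T)`; it only involves the data `u₀, f₁, f₂`. -/
def Y (P : Medium n) (u₀ : ℕ → ℝ → ℝ) (f₁ f₂ : ℝ → ℝ) (T : ℝ) (ν : ℂ) : Idx n → ℂ :=
  Sum.elim
    (fun i => if (i : ℕ) = 0 then timeTransform f₁ (ν ^ 2) T
      else -spaceTransform P i (u₀ i) (ν / P.σ i))
    (fun i => if (i : ℕ) = n + 1 then timeTransform f₂ (ν ^ 2) T
      else -spaceTransform P (i + 1) (u₀ (i + 1)) (-ν / P.σ (i + 1)))

/-- The right-hand side `𝒴(ν,T)` made of the unknown transforms of `u` at the final time `T`. -/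
def Yfinal (P : Medium n) (u : ℕ → ℝ → ℝ → ℝ) (T : ℝ) (ν : ℂ) : Idx n → ℂ :=
  Sum.elim
    (fun i => if (i : ℕ) = 0 then 0
      else Complex.exp (ν ^ 2 * T) * spaceTransform P i (fun y => u i y T) (ν / P.σ i))
    (fun i => if (i : ℕ) = n + 1 then 0
      else Complex.exp (ν ^ 2 * T) *
        spaceTransform P (i + 1) (fun y => u (i + 1) y T) (-ν / P.σ (i + 1)))

/-! The entries of a vector of unknowns. The index `j` always satisfies `1 ≤ j ≤ n + 1`, so that
`Fin.ofNat` is just the inclusion. -/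

def entryG₁ (Z : Idx n → ℂ) : ℂ := Z (Sum.inl 0)

def entryG₀ (Z : Idx n → ℂ) (j : ℕ) : ℂ := Z (Sum.inl (Fin.ofNat (n + 2) j))

def entryH₀ (Z : Idx n → ℂ) (j : ℕ) : ℂ := Z (Sum.inr (Fin.ofNat (n + 2) (j - 1)))

def entryH₁ (Z : Idx n → ℂ) : ℂ := Z (Sum.inr (Fin.last (n + 1)))

/-- `D_R^+ = {ν : Im ν > 0, Re ν² < 0, |ν| > R}`. -/
def Dplus (R : ℝ) : Set ℂ := {ν | 0 < ν.im ∧ (ν ^ 2).re < 0 ∧ R < ‖ν‖}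

/-- `D_R^- = {ν : Im ν < 0, Re ν² < 0, |ν| > R}`. -/
def Dminus (R : ℝ) : Set ℂ := {ν | ν.im < 0 ∧ (ν ^ 2).re < 0 ∧ R < ‖ν‖}

/-- The point `r e^{iθ}`. -/
def polar (r θ : ℝ) : ℂ := r * Complex.exp (Complex.I * θ)

/-- Integral along the curve that comes in from infinity on the ray of angle `a`, follows the circle
of radius `R` from angle `a` to angle `b`, and leaves to infinity on the ray of angle `b`. -/
def contourIntegral (R a b : ℝ) (F : ℂ → ℂ) : ℂ :=
  -(∫ r in Set.Ioi R, F (polar r a) * Complex.exp (Complex.I * a))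
    + (∫ θ in a..b, F (polar R θ) * (Complex.I * polar R θ))
    + ∫ r in Set.Ioi R, F (polar r b) * Complex.exp (Complex.I * b)

/-- All three pieces of `contourIntegral R a b F` converge absolutely. -/
def ContourIntegrable (R a b : ℝ) (F : ℂ → ℂ) : Prop :=
  MeasureTheory.IntegrableOn (fun r => F (polar r a)) (Set.Ioi R)
    ∧ IntervalIntegrable (fun θ => F (polar R θ)) MeasureTheory.volume a b
    ∧ MeasureTheory.IntegrableOn (fun r => F (polar r b)) (Set.Ioi R)

/-- The integral over `∂D_R^+`, oriented with `D_R^+` on the left. -/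
def intPlus (R : ℝ) (F : ℂ → ℂ) : ℂ :=
  contourIntegral R (3 * Real.pi / 4) (Real.pi / 4) F

/-- The integral over `∂D_R^-`, oriented with `D_R^-` on the left. -/
def intMinus (R : ℝ) (F : ℂ → ℂ) : ℂ :=
  contourIntegral R (-(Real.pi / 4)) (-(3 * Real.pi / 4)) F

def IntegrablePlus (R : ℝ) (F : ℂ → ℂ) : Prop :=
  ContourIntegrable R (3 * Real.pi / 4) (Real.pi / 4) F

def IntegrableMinus (R : ℝ) (F : ℂ → ℂ) : Prop :=
  ContourIntegrable R (-(Real.pi / 4)) (-(3 * Real.pi / 4)) F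

/-- The integrand of the `∂D_R^-` integral for the `j`-th layer, with the unknowns `Z(ν)` in place of
the boundary transforms. -/
def minusIntegrand (P : Medium n) (j : ℕ) (y t : ℝ) (Z : ℂ → Idx n → ℂ) (ν : ℂ) : ℂ :=
  Complex.exp (Complex.I * ν * (y - P.x j) / P.σ j - ν ^ 2 * t) *
    if j = n + 1 then P.σ j * entryH₁ (Z ν) + Complex.I * ν * entryH₀ (Z ν) j
    else (P.σ j : ℂ)⁻¹ *
      (P.H j * entryG₀ (Z ν) (j + 1) + (Complex.I * P.σ j * ν - P.H j) * entryH₀ (Z ν) j)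

/-- The integrand of the `∂D_R^+` integral for the `j`-th layer. -/
def plusIntegrand (P : Medium n) (j : ℕ) (y t : ℝ) (Z : ℂ → Idx n → ℂ) (ν : ℂ) : ℂ :=
  Complex.exp (Complex.I * ν * (y - P.x (j - 1)) / P.σ j - ν ^ 2 * t) *
    if j = 1 then P.σ j * entryG₁ (Z ν) + Complex.I * ν * entryG₀ (Z ν) j
    else (P.σ j : ℂ)⁻¹ *
      ((P.H (j - 1) + Complex.I * P.σ j * ν) * entryG₀ (Z ν) j
        - P.H (j - 1) * entryH₀ (Z ν) (j - 1))

/-- The integrand `e^{iky - (σ_j k)² t} û_0^{(j)}(k)`, `k` real. -/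
def initialIntegrand (P : Medium n) (u₀ : ℕ → ℝ → ℝ) (j : ℕ) (y t k : ℝ) : ℂ :=
  Complex.exp (Complex.I * k * y - ((P.σ j : ℂ) * k) ^ 2 * t) * spaceTransform P j (u₀ j) k

/-- The right-hand side of the solution formula in the `j`-th layer. -/
def solutionFormula (P : Medium n) (u₀ : ℕ → ℝ → ℝ) (R : ℝ) (j : ℕ) (y t : ℝ)
    (Z : ℂ → Idx n → ℂ) : ℂ :=
  (2 * Real.pi : ℂ)⁻¹ * (∫ k : ℝ, initialIntegrand P u₀ j y t k)
    - (2 * Real.pi : ℂ)⁻¹ * intMinus R (minusIntegrand P j y t Z)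
    - (2 * Real.pi : ℂ)⁻¹ * intPlus R (plusIntegrand P j y t Z)

/-- All integrals in the solution formula converge absolutely and the formula gives `u j y t`. -/
def FormulaHolds (P : Medium n) (u₀ : ℕ → ℝ → ℝ) (u : ℕ → ℝ → ℝ → ℝ) (R : ℝ) (j : ℕ) (y t : ℝ)
    (Z : ℂ → Idx n → ℂ) : Prop :=
  MeasureTheory.Integrable (initialIntegrand P u₀ j y t)
    ∧ IntegrableMinus R (minusIntegrand P j y t Z)
    ∧ IntegrablePlus R (plusIntegrand P j y t Z)
    ∧ (u j y t : ℂ) = solutionFormula P u₀ R j y t Z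

/-- The two contour integrals of the solution formula converge absolutely and both vanish. -/
def ContributesZero (P : Medium n) (R : ℝ) (j : ℕ) (y t : ℝ) (Z : ℂ → Idx n → ℂ) : Prop :=
  IntegrableMinus R (minusIntegrand P j y t Z)
    ∧ IntegrablePlus R (plusIntegrand P j y t Z)
    ∧ intMinus R (minusIntegrand P j y t Z) = 0
    ∧ intPlus R (plusIntegrand P j y t Z) = 0

end MultilayerHeat

end

/-!
The proof rests on one integral identity and one linear-algebra estimate.

**Green's identity.** Testing the heat equation of one layer with a solution of the adjoint equation
expresses the value at a later time by the initial datum and by the boundary flux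
(`green_initial`). The layer is exhausted by smaller rectangles, since the derivatives are only
continuous in its interior, and the initial datum is only attained in the mean.

* Testing with `e^{-iky + κk²s}` gives the global relation of the layer (`global_relation`). The
  contact conditions eliminate the fluxes at the interfaces, so that the global relations at `ν` and
  `-ν` together with the boundary conditions are the linear system (`A_mulVec_eq_iff`,
  `A_mulVec_X`).
* Testing with the backward heat kernel gives the representation of the solution by heat potentials
  (`heat_representation`). On the other side, the integral of `e^{iνd - ν²τ}`, `d > 0`, over the
  boundary of the sector vanishes for `τ ≤ 0`, by closing the contour inside the sector, and is the
  heat kernel for `τ > 0`, by opening it to the real line. Along the boundary rays `ν²` is purely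
  imaginary and `e^{iνd}` decays exponentially, so Fubini's theorem turns the contour integrals of
  the boundary transforms into heat potentials (`intPlus_timeIntegral`), whence the solution formula
  for the true transforms (`layer_formula`, `formulaHolds_X`). The lower contour is reduced to the
  upper one by `ν ↦ -ν`.

**A priori estimate.** In the upper sector, the global relation at `ν` is dominated by its term at
the right end of the layer, the one at `-ν` by its term at the left end; the other term is smaller
by a factor `e^{-c|ν|}`. Each of these brackets is dominated for large `|ν|` by its own boundary
value, with the factor `σν`; at the outer boundary the Robin condition supplies the remaining unknown. This
bounds the solution of the linear system by its right-hand side, relative to those leading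
exponentials (`exists_apriori_bound`). Hence the determinant has no zeros for large `|ν|` in either
sector (`det_ne_zero_of_bound`). The final-time transforms grow like the leading exponentials
times `e^{ν²T}`, so their contribution to the integrand is `O(|e^{iνd - ν²(t - T)}|)` and, being
holomorphic, integrates to zero by Cauchy's theorem when `t ≤ T` (`contributesZero_Zfinal`).
Finally `𝒜⁻¹Y = X - 𝒜⁻¹𝒴` on the contours, so `X` may be replaced by `𝒜⁻¹Y` in the solution formula
(`FormulaHolds.sub`).
-/

noncomputable section

namespace MultilayerHeat

open MeasureTheory Set Filter Topology

/-! ### Contour integrals over boundaries of sectors -/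

lemma norm_polar {r : ℝ} (hr : 0 ≤ r) (θ : ℝ) : ‖polar r θ‖ = r := by
  rw [polar, norm_mul, mul_comm Complex.I, Complex.norm_exp_ofReal_mul_I, mul_one,
    Complex.norm_real, Real.norm_of_nonneg hr]

lemma polar_im (r θ : ℝ) : (polar r θ).im = r * Real.sin θ := by
  simp [polar, mul_comm Complex.I, Complex.exp_ofReal_mul_I_im]

lemma polar_re (r θ : ℝ) : (polar r θ).re = r * Real.cos θ := by
  simp [polar, mul_comm Complex.I, Complex.exp_ofReal_mul_I_re]

lemma polar_sq_re (r θ : ℝ) : ((polar r θ) ^ 2).re = r ^ 2 * Real.cos (2 * θ) := by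
  rw [sq, Complex.mul_re, polar_re, polar_im, Real.cos_two_mul]
  linear_combination (-r ^ 2) * Real.sin_sq_add_cos_sq θ

lemma continuous_polar : Continuous fun p : ℝ × ℝ => polar p.1 p.2 := by
  unfold polar; fun_prop

/-- Integrability of the three pieces of a contour integral, from continuity along the contour and
exponential decay along the rays. -/
lemma contourIntegrable_of_bound {R a b C c : ℝ} (hc : 0 < c) {F : ℂ → ℂ}
    (hF : ∀ r, R ≤ r → ∀ θ ∈ uIcc a b, ContinuousAt F (polar r θ))
    (hb : ∀ r, R ≤ r → ∀ θ ∈ uIcc a b, ‖F (polar r θ)‖ ≤ C * Real.exp (-c * r)) :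
    ContourIntegrable R a b F := by
  have ray : ∀ θ ∈ uIcc a b, IntegrableOn (fun r => F (polar r θ)) (Ioi R) := by
    intro θ hθ
    refine Integrable.mono' ((integrableOn_exp_mul_Ioi (neg_neg_of_pos hc) R).const_mul C) ?_ ?_
    · refine ContinuousOn.aestronglyMeasurable ?_ measurableSet_Ioi
      intro r hr
      refine ContinuousAt.continuousWithinAt ?_
      exact ContinuousAt.comp (f := fun r => polar r θ) (hF r (le_of_lt hr) θ hθ)
        (continuous_polar.comp (Continuous.prodMk_left θ)).continuousAt
    · exact (ae_restrict_iff' measurableSet_Ioi).2 (.of_forall fun r hr => hb r (le_of_lt hr) θ hθ)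
  refine ⟨ray a left_mem_uIcc, ?_, ray b right_mem_uIcc⟩
  refine ContinuousOn.intervalIntegrable fun θ hθ => ContinuousAt.continuousWithinAt ?_
  exact ContinuousAt.comp (f := fun θ => polar R θ) (hF R le_rfl θ hθ)
    (continuous_polar.comp (Continuous.prodMk_right R)).continuousAt

lemma polar_exp (x θ : ℝ) : Complex.exp (x + θ * Complex.I) = polar (Real.exp x) θ := by
  rw [polar, Complex.exp_add, Complex.ofReal_exp, mul_comm Complex.I]

/-- Cauchy's theorem for a truncated sector, from the one for rectangles in logarithmic
coordinates. -/
lemma truncated_sector_integral_eq_zero {R R' a b : ℝ} (hR : 0 < R) (hRR' : R ≤ R') {F : ℂ → ℂ}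
    (hF : ∀ r, R ≤ r → ∀ θ ∈ uIcc a b, DifferentiableAt ℂ F (polar r θ)) :
    ((∫ r in R..R', F (polar r a) * Complex.exp (Complex.I * a))
      - ∫ r in R..R', F (polar r b) * Complex.exp (Complex.I * b))
      + (∫ θ in a..b, F (polar R' θ) * (Complex.I * polar R' θ))
      - (∫ θ in a..b, F (polar R θ) * (Complex.I * polar R θ)) = 0 := by
  have hR' : 0 < R' := hR.trans_le hRR'
  have hlog : Real.log R ≤ Real.log R' := Real.log_le_log hR hRR'
  have key := Complex.integral_boundary_rect_eq_zero_of_differentiableOn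
    (fun z => F (Complex.exp z) * Complex.exp z)
    (Real.log R + a * Complex.I) (Real.log R' + b * Complex.I) (by
      intro z hz
      simp only [Complex.add_re, Complex.ofReal_re, Complex.mul_re, Complex.I_re, mul_zero,
        Complex.ofReal_im, Complex.I_im, mul_one, sub_self, add_zero, Complex.add_im,
        Complex.mul_im, zero_add] at hz
      have hz1 : z.re ∈ uIcc (Real.log R) (Real.log R') := hz.1
      have hz2 : z.im ∈ uIcc a b := hz.2
      rw [uIcc_of_le hlog] at hz1
      have hp : Complex.exp z = polar (Real.exp z.re) z.im := by
        rw [← polar_exp, Complex.re_add_im]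
      have hd : DifferentiableAt ℂ F (Complex.exp z) := by
        rw [hp]
        refine hF _ ?_ _ hz2
        rw [← Real.exp_log hR]; exact Real.exp_le_exp.2 hz1.1
      exact ((hd.comp z Complex.differentiableAt_exp).mul
        Complex.differentiableAt_exp).differentiableWithinAt)
  simp only [Complex.add_re, Complex.ofReal_re, Complex.mul_re, Complex.I_re, mul_zero,
        Complex.ofReal_im, Complex.I_im, mul_one, sub_self, add_zero, Complex.add_im,
        Complex.mul_im, zero_add, polar_exp, Real.exp_log hR, Real.exp_log hR'] at key
  have ray : ∀ θ ∈ uIcc a b,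
      (∫ x in Real.log R..Real.log R', F (polar (Real.exp x) θ) * polar (Real.exp x) θ)
        = ∫ r in R..R', F (polar r θ) * Complex.exp (Complex.I * θ) := by
    intro θ hθ
    have := intervalIntegral.integral_deriv_smul_comp'' (a := Real.log R) (b := Real.log R')
      (f := Real.exp) (f' := Real.exp)
      (g := fun r => F (polar r θ) * Complex.exp (Complex.I * θ))
      Real.continuous_exp.continuousOn
      (fun x _ => (Real.hasDerivAt_exp x).hasDerivWithinAt) Real.continuous_exp.continuousOn (by
        rintro _ ⟨x, hx, rfl⟩
        rw [uIcc_of_le hlog] at hx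
        have hx' : R ≤ Real.exp x := by
          rw [← Real.exp_log hR]; exact Real.exp_le_exp.2 hx.1
        refine ContinuousAt.continuousWithinAt (ContinuousAt.mul ?_ continuousAt_const)
        exact ContinuousAt.comp (f := fun r => polar r θ) (hF _ hx' θ hθ).continuousAt
          (continuous_polar.comp (Continuous.prodMk_left θ)).continuousAt)
    rw [Real.exp_log hR, Real.exp_log hR'] at this
    rw [← this]
    refine intervalIntegral.integral_congr fun x _ => ?_
    simp only [Function.comp, Complex.real_smul, polar]
    ring
  rw [ray a left_mem_uIcc, ray b right_mem_uIcc] at key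
  simp only [smul_eq_mul, ← intervalIntegral.integral_const_mul] at key
  rw [← key]
  simp only [mul_left_comm Complex.I]

/-- Cauchy's theorem for an unbounded sector. -/
lemma contourIntegral_eq_zero {R a b C c : ℝ} (hR : 0 < R) (hc : 0 < c) {F : ℂ → ℂ}
    (hF : ∀ r, R ≤ r → ∀ θ ∈ uIcc a b, DifferentiableAt ℂ F (polar r θ))
    (hb : ∀ r, R ≤ r → ∀ θ ∈ uIcc a b, ‖F (polar r θ)‖ ≤ C * Real.exp (-c * r)) :
    contourIntegral R a b F = 0 := by
  obtain ⟨ha, -, hb'⟩ := contourIntegrable_of_bound hc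
    (fun r hr θ hθ => (hF r hr θ hθ).continuousAt) hb
  have t1 := intervalIntegral_tendsto_integral_Ioi R
    (ha.mul_const (Complex.exp (Complex.I * a))) tendsto_id
  have t2 := intervalIntegral_tendsto_integral_Ioi R
    (hb'.mul_const (Complex.exp (Complex.I * b))) tendsto_id
  have t3 : Tendsto (fun R' => ∫ θ in a..b, F (polar R' θ) * (Complex.I * polar R' θ)) atTop
      (𝓝 0) := by
    have hlim : Tendsto (fun r : ℝ => C * (r * Real.exp (-c * r)) * |b - a|) atTop (𝓝 0) := by
      have h := Real.tendsto_pow_mul_exp_neg_atTop_nhds_zero 1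
      have h2 := (h.comp (tendsto_id.const_mul_atTop hc)).const_mul c⁻¹
      have h3 := (h2.const_mul C).mul_const |b - a|
      simp only [mul_zero, zero_mul] at h3
      refine h3.congr fun r => ?_
      simp only [Function.comp, id, pow_one, neg_mul]
      field_simp
    refine squeeze_zero_norm' ?_ hlim
    filter_upwards [eventually_ge_atTop R] with r hr
    refine intervalIntegral.norm_integral_le_of_norm_le_const fun θ hθ => ?_
    have h0 : 0 ≤ r := hR.le.trans hr
    rw [norm_mul, norm_mul, Complex.norm_I, one_mul, norm_polar h0]
    have := mul_le_mul_of_nonneg_right (hb r hr θ (uIoc_subset_uIcc hθ)) h0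
    linarith
  have t4 := ((t1.sub t2).add t3).sub_const (∫ θ in a..b, F (polar R θ) * (Complex.I * polar R θ))
  have t5 := tendsto_nhds_unique (t4.congr' (by
    filter_upwards [eventually_ge_atTop R] with r hr
    exact truncated_sector_integral_eq_zero hR hr hF)) tendsto_const_nhds
  rw [contourIntegral]
  linear_combination -t5

lemma contourIntegral_add_adjacent {R a b c : ℝ} {F : ℂ → ℂ}
    (h₁ : IntervalIntegrable (fun θ => F (polar R θ)) volume a b)
    (h₂ : IntervalIntegrable (fun θ => F (polar R θ)) volume b c) :
    contourIntegral R a b F + contourIntegral R b c F = contourIntegral R a c F := by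
  have hc : Continuous fun θ => Complex.I * polar R θ :=
    continuous_const.mul (continuous_polar.comp (Continuous.prodMk_right R))
  have := intervalIntegral.integral_add_adjacent_intervals
    (h₁.mul_continuousOn hc.continuousOn) (h₂.mul_continuousOn hc.continuousOn)
  simp only [contourIntegral]
  linear_combination this

lemma hasDerivAt_polar (R θ : ℝ) :
    HasDerivAt (fun θ : ℝ => polar R θ) (Complex.I * polar R θ) θ := by
  have h : HasDerivAt (fun θ : ℝ => Complex.I * (θ : ℂ)) Complex.I θ := by
    simpa using (Complex.ofRealCLM.hasDerivAt (x := θ)).const_mul Complex.I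
  have := h.cexp.const_mul (R : ℂ)
  refine this.congr_deriv ?_
  rw [polar]; ring

/-- For an entire function, an integral over a circular arc through the end points `±R` of a
diameter is an integral over the diameter. -/
lemma arc_integral_eq {R a b : ℝ} (hR : 0 < R) {F : ℂ → ℂ} (hF : Differentiable ℂ F)
    {p q : ℝ} (hp : polar R a = p) (hq : polar R b = q) :
    ∫ θ in a..b, F (polar R θ) * (Complex.I * polar R θ) = ∫ x in p..q, F x := by
  have hpR : |p| = R := by
    rw [← Real.norm_eq_abs, ← Complex.norm_real, ← hp, norm_polar hR.le]
  have hqR : |q| = R := by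
    rw [← Real.norm_eq_abs, ← Complex.norm_real, ← hq, norm_polar hR.le]
  obtain ⟨G, hG⟩ := hF.differentiableOn.isExactOn_ball (c := (0 : ℂ)) (r := 2 * R)
  have hpol : Continuous fun θ => polar R θ := continuous_polar.comp (Continuous.prodMk_right R)
  have e1 := intervalIntegral.integral_eq_sub_of_hasDerivAt (a := a) (b := b)
    (f := fun θ => G (polar R θ)) (f' := fun θ => F (polar R θ) * (Complex.I * polar R θ))
    (fun θ _ => (hG (polar R θ) (by
        rw [mem_ball_zero_iff, norm_polar hR.le]; linarith)).comp_of_eq θ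
        (hasDerivAt_polar R θ) rfl)
    (((hF.continuous.comp hpol).mul (continuous_const.mul hpol)).intervalIntegrable _ _)
  have e2 := intervalIntegral.integral_eq_sub_of_hasDerivAt (a := p) (b := q)
    (f := fun x : ℝ => G x) (f' := fun x : ℝ => F x)
    (fun x hx => (hG x (by
        rw [mem_ball_zero_iff, Complex.norm_real, Real.norm_eq_abs]
        have h1 : x ∈ uIcc p q := hx
        have h2 : |x| ≤ R := by
          rw [abs_le]
          have hp' := abs_le.1 hpR.le
          have hq' := abs_le.1 hqR.le
          exact ⟨(le_min hp'.1 hq'.1).trans h1.1, h1.2.trans (max_le hp'.2 hq'.2)⟩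
        linarith)).comp_ofReal)
    ((hF.continuous.comp Complex.continuous_ofReal).intervalIntegrable _ _)
  rw [e1, e2, hp, hq]

lemma polar_zero (r : ℝ) : polar r 0 = (r : ℂ) := by simp [polar]

lemma polar_pi (r : ℝ) : polar r Real.pi = ((-r : ℝ) : ℂ) := by
  simp [polar, mul_comm Complex.I, Complex.exp_pi_mul_I]

lemma integral_eq_Ioi_add_interval_add_Ioi {R : ℝ} {F : ℝ → ℂ} (hF : Integrable F) :
    ∫ x, F x = (∫ r in Ioi R, F (-r)) + (∫ x in -R..R, F x) + ∫ r in Ioi R, F r := by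
  rw [integral_comp_neg_Ioi, add_assoc,
    intervalIntegral.integral_interval_add_Ioi hF.integrableOn hF.integrableOn,
    intervalIntegral.integral_Iic_add_Ioi hF.integrableOn hF.integrableOn]

lemma contourIntegral_pi_zero {R : ℝ} (hR : 0 < R) {F : ℂ → ℂ} (hF : Differentiable ℂ F)
    (hi : Integrable fun x : ℝ => F x) :
    contourIntegral R Real.pi 0 F = ∫ x : ℝ, F x := by
  have e : Complex.exp (Complex.I * (Real.pi : ℂ)) = -1 := by
    simp [mul_comm Complex.I, Complex.exp_pi_mul_I]
  rw [integral_eq_Ioi_add_interval_add_Ioi (R := R) hi, contourIntegral,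
    arc_integral_eq hR hF (polar_pi R) (polar_zero R), e]
  simp only [polar_zero, polar_pi, mul_neg, mul_one, integral_neg, Complex.ofReal_zero,
    mul_zero, Complex.exp_zero, neg_neg]

lemma integrable_kernel_mul {S U : Set ℝ} (hS : MeasurableSet S) (hU : MeasurableSet U)
    {K : ℝ → ℝ → ℂ} (hK : Continuous fun p : ℝ × ℝ => K p.1 p.2) {g : ℝ → ℝ}
    (hg : IntegrableOn g S) (hb : ∀ r ∈ S, ∀ s ∈ U, ‖K r s‖ ≤ g r) {φ : ℝ → ℂ}
    (hφ : IntegrableOn φ U) :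
    Integrable (Function.uncurry fun r s => K r s * φ s)
      ((volume.restrict S).prod (volume.restrict U)) := by
  refine Integrable.mono' (Integrable.mul_prod hg hφ.norm) ?_ ?_
  · exact hK.aestronglyMeasurable.mul hφ.aestronglyMeasurable.comp_snd
  · rw [Measure.prod_restrict]
    refine (ae_restrict_iff' (hS.prod hU)).2 (.of_forall fun p hp => ?_)
    simp only [Function.uncurry, norm_mul]
    exact mul_le_mul_of_nonneg_right (hb _ hp.1 _ hp.2) (norm_nonneg _)

/-- Fubini's theorem for a contour integral and a time transform: the absolute convergence comes
from the exponential decay of the kernel along the two rays. -/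
lemma contourIntegral_timeIntegral {R a b C c T : ℝ} (hT : 0 ≤ T) (hc : 0 < c)
    {K : ℂ → ℝ → ℂ} (hK : Continuous fun p : ℂ × ℝ => K p.1 p.2)
    (ha : ∀ r, R ≤ r → ∀ s ∈ Ioc 0 T, ‖K (polar r a) s‖ ≤ C * Real.exp (-c * r))
    (hb : ∀ r, R ≤ r → ∀ s ∈ Ioc 0 T, ‖K (polar r b) s‖ ≤ C * Real.exp (-c * r))
    (hab : ∃ B, ∀ θ ∈ uIcc a b, ∀ s ∈ Ioc 0 T, ‖K (polar R θ) s‖ ≤ B)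
    {φ : ℝ → ℂ} (hφ : IntegrableOn φ (Ioc 0 T)) :
    ContourIntegrable R a b (fun ν => ∫ s in (0 : ℝ)..T, K ν s * φ s) ∧
      IntervalIntegrable (fun s => contourIntegral R a b (fun ν => K ν s) * φ s) volume 0 T ∧
      contourIntegral R a b (fun ν => ∫ s in (0 : ℝ)..T, K ν s * φ s)
        = ∫ s in (0 : ℝ)..T, contourIntegral R a b (fun ν => K ν s) * φ s := by
  obtain ⟨B, hB⟩ := hab
  have ray' : ∀ θ, (∀ r, R ≤ r → ∀ s ∈ Ioc 0 T, ‖K (polar r θ) s‖ ≤ C * Real.exp (-c * r)) →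
      Integrable (Function.uncurry fun r s => K (polar r θ) s * φ s)
      ((volume.restrict (Ioi R)).prod (volume.restrict (Ioc 0 T))) := fun θ hθ =>
    integrable_kernel_mul measurableSet_Ioi measurableSet_Ioc
      (hK.comp ((continuous_polar.comp (continuous_fst.prodMk continuous_const)).prodMk
        continuous_snd))
      ((integrableOn_exp_mul_Ioi (neg_neg_of_pos hc) R).const_mul C)
      (fun r hr s hs => hθ r (le_of_lt hr) s hs) hφ
  have ray_a := ray' a ha
  have ray_b := ray' b hb
  have arc : Integrable (Function.uncurry fun θ s => K (polar R θ) s * φ s)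
      ((volume.restrict (uIoc a b)).prod (volume.restrict (Ioc 0 T))) :=
    integrable_kernel_mul measurableSet_uIoc measurableSet_Ioc
      (hK.comp ((continuous_polar.comp (continuous_const.prodMk continuous_fst)).prodMk
        continuous_snd))
      (g := fun _ => B)
      (integrableOn_const (by simp [uIoc]))
      (fun θ hθ s hs => hB θ (uIoc_subset_uIcc hθ) s hs) hφ
  have arc' : Integrable (Function.uncurry fun θ s =>
      K (polar R θ) s * φ s * (Complex.I * polar R θ))
      ((volume.restrict (uIoc a b)).prod (volume.restrict (Ioc 0 T))) := by
    have hp : Continuous fun p : ℝ × ℝ => Complex.I * polar R p.1 :=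
      continuous_const.mul (continuous_polar.comp (continuous_const.prodMk continuous_fst))
    refine arc.mul_bdd (c := |R|) hp.aestronglyMeasurable (.of_forall fun p => ?_)
    rw [norm_mul, Complex.norm_I, one_mul, polar, norm_mul, mul_comm Complex.I,
      Complex.norm_exp_ofReal_mul_I, mul_one, Complex.norm_real, Real.norm_eq_abs]
  have eray : ∀ θ, Integrable (Function.uncurry fun r s => K (polar r θ) s * φ s)
      ((volume.restrict (Ioi R)).prod (volume.restrict (Ioc 0 T))) →
      (∫ r in Ioi R, (∫ s in (0 : ℝ)..T, K (polar r θ) s * φ s) * Complex.exp (Complex.I * θ))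
        = ∫ s in Ioc 0 T, (∫ r in Ioi R, K (polar r θ) s * Complex.exp (Complex.I * θ)) * φ s := by
    intro θ hθ
    rw [integral_mul_const]
    simp_rw [intervalIntegral.integral_of_le hT]
    rw [integral_integral_swap hθ, ← integral_mul_const]
    refine integral_congr_ae (.of_forall fun s => ?_)
    simp only [integral_mul_const]
    ring
  have earc : (∫ θ in a..b, (∫ s in (0 : ℝ)..T, K (polar R θ) s * φ s) * (Complex.I * polar R θ))
      = ∫ s in Ioc 0 T, (∫ θ in a..b, K (polar R θ) s * (Complex.I * polar R θ)) * φ s := by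
    simp_rw [intervalIntegral.integral_of_le hT, intervalIntegral.intervalIntegral_eq_integral_uIoc,
      smul_mul_assoc]
    rw [integral_smul]
    congr 1
    simp_rw [← integral_mul_const]
    rw [integral_integral_swap arc']
    refine integral_congr_ae (.of_forall fun s => ?_)
    refine integral_congr_ae (.of_forall fun θ => ?_)
    simp only
    ring
  have iray : ∀ θ, Integrable (Function.uncurry fun r s => K (polar r θ) s * φ s)
      ((volume.restrict (Ioi R)).prod (volume.restrict (Ioc 0 T))) → IntegrableOn
      (fun s => (∫ r in Ioi R, K (polar r θ) s * Complex.exp (Complex.I * θ)) * φ s)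
      (Ioc 0 T) := by
    intro θ hθ
    refine (hθ.integral_prod_right.mul_const (Complex.exp (Complex.I * θ))).congr
      (.of_forall fun s => ?_)
    simp only [integral_mul_const, Function.uncurry]
    ring
  have iarc : IntegrableOn
      (fun s => (∫ θ in a..b, K (polar R θ) s * (Complex.I * polar R θ)) * φ s) (Ioc 0 T) := by
    refine (arc'.integral_prod_right.const_mul ((if a ≤ b then 1 else -1 : ℝ) : ℂ)).congr
      (.of_forall fun s => ?_)
    simp only [intervalIntegral.intervalIntegral_eq_integral_uIoc, Function.uncurry]
    rw [Complex.real_smul, mul_assoc, ← integral_mul_const]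
    congr 1
    refine integral_congr_ae (.of_forall fun θ => ?_)
    simp only
    ring
  have hsplit : ∀ s, contourIntegral R a b (fun ν => K ν s) * φ s
      = -((∫ r in Ioi R, K (polar r a) s * Complex.exp (Complex.I * a)) * φ s)
        + (∫ θ in a..b, K (polar R θ) s * (Complex.I * polar R θ)) * φ s
        + (∫ r in Ioi R, K (polar r b) s * Complex.exp (Complex.I * b)) * φ s := by
    intro s; rw [contourIntegral]; ring
  refine ⟨⟨?_, ?_, ?_⟩, ?_, ?_⟩
  · simpa only [IntegrableOn, intervalIntegral.integral_of_le hT, Function.uncurry] using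
      ray_a.integral_prod_left
  · rw [intervalIntegrable_iff]
    simpa only [IntegrableOn, intervalIntegral.integral_of_le hT, Function.uncurry] using
      arc.integral_prod_left
  · simpa only [IntegrableOn, intervalIntegral.integral_of_le hT, Function.uncurry] using
      ray_b.integral_prod_left
  · rw [intervalIntegrable_iff_integrableOn_Ioc_of_le hT]
    simp only [hsplit]
    exact ((iray a ray_a).neg.add iarc).add (iray b ray_b)
  · rw [intervalIntegral.integral_of_le hT]
    simp only [hsplit]
    rw [integral_add, integral_add, integral_neg, ← eray a ray_a, ← earc,
      ← eray b ray_b, contourIntegral]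
    exacts [(iray a ray_a).neg, iarc, (iray a ray_a).neg.add iarc,
      iray b ray_b]

lemma polar_sub_pi (r θ : ℝ) : polar r (θ - Real.pi) = -polar r θ := by
  simp only [polar, Complex.ofReal_sub, mul_sub, Complex.exp_sub, mul_comm Complex.I (Real.pi : ℂ),
    Complex.exp_pi_mul_I]
  ring

/-- The reflection `ν ↦ -ν` exchanges the two contours. -/
lemma intMinus_eq (R : ℝ) (F : ℂ → ℂ) : intMinus R F = -intPlus R (fun ν => F (-ν)) := by
  have h (θ : ℝ) : Complex.exp (Complex.I * ((θ - Real.pi : ℝ) : ℂ))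
      = -Complex.exp (Complex.I * θ) := by
    simpa [polar] using polar_sub_pi 1 θ
  have e1 : -(Real.pi / 4) = 3 * Real.pi / 4 - Real.pi := by ring
  have e2 : -(3 * Real.pi / 4) = Real.pi / 4 - Real.pi := by ring
  rw [intMinus, intPlus, contourIntegral, contourIntegral, e1, e2, h, h,
    ← intervalIntegral.integral_comp_sub_right]
  simp only [polar_sub_pi, mul_neg, integral_neg, intervalIntegral.integral_neg]
  ring

lemma integrableMinus_iff (R : ℝ) (F : ℂ → ℂ) :
    IntegrableMinus R F ↔ IntegrablePlus R (fun ν => F (-ν)) := by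
  have e1 : -(Real.pi / 4) = 3 * Real.pi / 4 - Real.pi := by ring
  have e2 : -(3 * Real.pi / 4) = Real.pi / 4 - Real.pi := by ring
  rw [IntegrableMinus, IntegrablePlus, ContourIntegrable, ContourIntegrable, e1, e2]
  simp only [polar_sub_pi]
  refine and_congr_right fun _ => and_congr_left fun _ => ?_
  constructor
  · intro h
    simpa [polar_sub_pi] using h.comp_sub_right Real.pi
  · intro h
    refine (h.comp_add_right Real.pi).congr fun θ _ => ?_
    have := polar_sub_pi R (θ + Real.pi)
    rw [add_sub_cancel_right] at this
    simp [this]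

lemma ContourIntegrable.add {R a b : ℝ} {F G : ℂ → ℂ} (hF : ContourIntegrable R a b F)
    (hG : ContourIntegrable R a b G) : ContourIntegrable R a b (fun ν => F ν + G ν) :=
  ⟨hF.1.add hG.1, hF.2.1.add hG.2.1, hF.2.2.add hG.2.2⟩

lemma ContourIntegrable.const_mul {R a b : ℝ} {F : ℂ → ℂ} (hF : ContourIntegrable R a b F) (z : ℂ) :
    ContourIntegrable R a b (fun ν => z * F ν) :=
  ⟨Integrable.const_mul hF.1 z, hF.2.1.const_mul z, Integrable.const_mul hF.2.2 z⟩

lemma contourIntegral_const_mul (R a b : ℝ) (F : ℂ → ℂ) (z : ℂ) :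
    contourIntegral R a b (fun ν => z * F ν) = z * contourIntegral R a b F := by
  simp only [contourIntegral, mul_assoc, integral_const_mul, intervalIntegral.integral_const_mul]
  ring

lemma ContourIntegrable.integral_add {R a b : ℝ} {F G : ℂ → ℂ} (hF : ContourIntegrable R a b F)
    (hG : ContourIntegrable R a b G) :
    contourIntegral R a b (fun ν => F ν + G ν)
      = contourIntegral R a b F + contourIntegral R a b G := by
  have hp : Continuous fun θ => Complex.I * polar R θ :=
    continuous_const.mul (continuous_polar.comp (Continuous.prodMk_right R))
  simp only [contourIntegral, add_mul]
  rw [MeasureTheory.integral_add (hF.1.mul_const _) (hG.1.mul_const _),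
    MeasureTheory.integral_add (hF.2.2.mul_const _) (hG.2.2.mul_const _),
    intervalIntegral.integral_add (hF.2.1.mul_continuousOn hp.continuousOn)
      (hG.2.1.mul_continuousOn hp.continuousOn)]
  ring

lemma ContourIntegrable.congr {R a b : ℝ} {F G : ℂ → ℂ} (hF : ContourIntegrable R a b F)
    (h : ∀ r, R ≤ r → ∀ θ ∈ uIcc a b, F (polar r θ) = G (polar r θ)) :
    ContourIntegrable R a b G :=
  ⟨hF.1.congr_fun (fun r hr => h r (le_of_lt hr) a left_mem_uIcc) measurableSet_Ioi,
    hF.2.1.congr fun θ hθ => h R le_rfl θ (uIoc_subset_uIcc hθ),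
    hF.2.2.congr_fun (fun r hr => h r (le_of_lt hr) b right_mem_uIcc) measurableSet_Ioi⟩

lemma contourIntegral_congr {R a b : ℝ} {F G : ℂ → ℂ}
    (h : ∀ r, R ≤ r → ∀ θ ∈ uIcc a b, F (polar r θ) = G (polar r θ)) :
    contourIntegral R a b F = contourIntegral R a b G := by
  rw [contourIntegral, contourIntegral]
  congr 1
  · congr 1
    · congr 1
      exact setIntegral_congr_fun measurableSet_Ioi fun r hr => by
        simp only [h r (le_of_lt hr) a left_mem_uIcc]
    · exact intervalIntegral.integral_congr fun θ hθ => by simp only [h R le_rfl θ hθ]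
  · exact setIntegral_congr_fun measurableSet_Ioi fun r hr => by
      simp only [h r (le_of_lt hr) b right_mem_uIcc]

/-! ### The heat kernel and contour integrals of exponentials -/

/-- The exponential `e^{iνd - ν²τ}`. -/
def heatExp (d τ : ℝ) (ν : ℂ) : ℂ := Complex.exp (Complex.I * ν * d - ν ^ 2 * τ)

/-- `2π` times the heat kernel of `w_τ = w_dd`. -/
def heatKernel (d τ : ℝ) : ℝ := √(Real.pi / τ) * Real.exp (-d ^ 2 / (4 * τ))

/-- The `d`-derivative of `heatKernel`. -/
def heatKernel' (d τ : ℝ) : ℝ := -(d / (2 * τ)) * heatKernel d τ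

lemma norm_heatExp (d τ : ℝ) (ν : ℂ) :
    ‖heatExp d τ ν‖ = Real.exp (-(d * ν.im) - τ * (ν ^ 2).re) := by
  rw [heatExp, Complex.norm_exp]
  congr 1
  simp [Complex.mul_re, Complex.mul_im]
  ring

lemma differentiable_heatExp (d τ : ℝ) : Differentiable ℂ (heatExp d τ) := by
  unfold heatExp; fun_prop

lemma continuous_heatExp (d t : ℝ) :
    Continuous fun p : ℂ × ℝ => heatExp d (t - p.2) p.1 := by
  unfold heatExp; fun_prop

lemma heatExp_eq_quadratic (d τ : ℝ) (x : ℂ) :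
    heatExp d τ x = Complex.exp (-(τ : ℂ) * x ^ 2 + Complex.I * d * x + 0) := by
  rw [heatExp]; congr 1; ring

lemma integrable_heatExp (d : ℝ) {τ : ℝ} (hτ : 0 < τ) :
    Integrable fun x : ℝ => heatExp d τ x := by
  simp only [heatExp_eq_quadratic]
  exact integrable_cexp_quadratic (by simpa using hτ) _ _

lemma integral_heatExp (d : ℝ) {τ : ℝ} (hτ : 0 < τ) :
    ∫ x : ℝ, heatExp d τ x = heatKernel d τ := by
  have h := fourierIntegral_gaussian (b := (τ : ℂ)) (by simpa using hτ) d
  have e : ∀ x : ℝ, heatExp d τ x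
      = Complex.exp (Complex.I * d * x) * Complex.exp (-(τ : ℂ) * x ^ 2) := by
    intro x; rw [heatExp, ← Complex.exp_add]; congr 1; ring
  simp only [e, h, heatKernel]
  rw [Real.sqrt_eq_rpow, Complex.ofReal_mul, Complex.ofReal_cpow (by positivity)]
  push_cast
  rfl

lemma integrable_mul_heatExp (d : ℝ) {τ : ℝ} (hτ : 0 < τ) :
    Integrable fun x : ℝ => (x : ℂ) * heatExp d τ x := by
  refine Integrable.mono' (integrable_mul_exp_neg_mul_sq hτ).norm ?_ (.of_forall fun x => ?_)
  · exact (Complex.continuous_ofReal.mul ((differentiable_heatExp d τ).continuous.comp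
      Complex.continuous_ofReal)).aestronglyMeasurable
  · rw [norm_mul, norm_heatExp, norm_mul, Complex.norm_real, Real.norm_eq_abs (Real.exp _),
      Real.abs_exp]
    apply le_of_eq
    congr 2
    simp [← Complex.ofReal_pow]

lemma integral_I_mul_heatExp (d : ℝ) {τ : ℝ} (hτ : 0 < τ) :
    ∫ x : ℝ, Complex.I * x * heatExp d τ x = heatKernel' d τ := by
  have hi := integrable_heatExp d hτ
  have hi' := integrable_mul_heatExp d hτ
  have h : ∫ x : ℝ, (Complex.I * d * heatExp d τ x + -(2 * τ) * (x * heatExp d τ x)) = 0 := by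
    refine integral_eq_zero_of_hasDerivAt_of_integrable (f := fun x : ℝ => heatExp d τ x)
      (fun x => ?_) ((hi.const_mul _).add (hi'.const_mul _)) hi
    have h1 : HasDerivAt (fun z : ℂ => Complex.I * z * d - z ^ 2 * τ)
        (Complex.I * d - 2 * x * τ) (x : ℂ) := by
      have := ((hasDerivAt_id (x : ℂ)).const_mul Complex.I).mul_const (d : ℂ)
      have h2 := (hasDerivAt_pow 2 (x : ℂ)).mul_const (τ : ℂ)
      refine (this.sub h2).congr_deriv ?_
      push_cast; ring
    refine (h1.cexp.comp_ofReal).congr_deriv ?_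
    rw [heatExp]; ring
  rw [integral_add (hi.const_mul _) (hi'.const_mul _), integral_const_mul, integral_const_mul,
    integral_heatExp d hτ] at h
  have hτ' : (τ : ℂ) ≠ 0 := by exact_mod_cast hτ.ne'
  have e : ∫ x : ℝ, Complex.I * x * heatExp d τ x = Complex.I * ∫ x : ℝ, x * heatExp d τ x := by
    rw [← integral_const_mul]; simp only [mul_assoc]
  have e2 : ∫ x : ℝ, (x : ℂ) * heatExp d τ x = Complex.I * d * heatKernel d τ / (2 * τ) := by
    field_simp; linear_combination -h
  rw [e, e2, heatKernel']
  push_cast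
  linear_combination (d * heatKernel d τ / (2 * τ) : ℂ) * Complex.I_sq

lemma half_le_sin {θ : ℝ} (h : θ ∈ uIcc (3 * Real.pi / 4) (Real.pi / 4)) : 1 / 2 ≤ Real.sin θ := by
  have hπ := Real.pi_pos
  rw [uIcc_of_ge (by linarith)] at h
  have key : ∀ x, Real.pi / 4 ≤ x → x ≤ Real.pi / 2 → 1 / 2 ≤ Real.sin x := fun x h1 h2 => by
    rw [← Real.sin_pi_div_six]
    exact Real.sin_le_sin_of_le_of_le_pi_div_two (by linarith) h2 (by linarith)
  rcases le_total θ (Real.pi / 2) with h' | h'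
  · exact key θ h.1 h'
  · rw [← Real.sin_pi_sub]; exact key _ (by linarith [h.2]) (by linarith)

lemma cos_two_mul_nonpos {θ : ℝ} (h : θ ∈ uIcc (3 * Real.pi / 4) (Real.pi / 4)) :
    Real.cos (2 * θ) ≤ 0 := by
  have hπ := Real.pi_pos
  rw [uIcc_of_ge (by linarith)] at h
  exact Real.cos_nonpos_of_pi_div_two_le_of_le (by linarith [h.1]) (by linarith [h.2])

lemma cos_two_mul_ray :
    Real.cos (2 * (3 * Real.pi / 4)) = 0 ∧ Real.cos (2 * (Real.pi / 4)) = 0 := by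
  constructor
  · rw [show 2 * (3 * Real.pi / 4) = Real.pi / 2 + Real.pi by ring, Real.cos_add_pi,
      Real.cos_pi_div_two, neg_zero]
  · rw [show 2 * (Real.pi / 4) = Real.pi / 2 by ring, Real.cos_pi_div_two]

/-- A factor `ν` is absorbed by the exponential decay. -/
lemma mul_exp_neg_le {c : ℝ} (hc : 0 < c) (r : ℝ) :
    r * Real.exp (-c * r) ≤ 2 / c * Real.exp (-(c / 2) * r) := by
  have h1 : c / 2 * r ≤ Real.exp (c / 2 * r) := by linarith [Real.add_one_le_exp (c / 2 * r)]
  have h2 : Real.exp (-c * r) = Real.exp (-(c / 2) * r) * Real.exp (-(c / 2 * r)) := by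
    rw [← Real.exp_add]; congr 1; ring
  have h3 : c / 2 * r * Real.exp (-(c / 2 * r)) ≤ 1 := by
    rw [Real.exp_neg, ← div_eq_mul_inv]
    exact (div_le_one (Real.exp_pos _)).2 h1
  have h4 := mul_le_mul_of_nonneg_right h3 (Real.exp_pos (-(c / 2) * r)).le
  rw [h2]
  calc r * (Real.exp (-(c / 2) * r) * Real.exp (-(c / 2 * r)))
      = 2 / c * (c / 2 * r * Real.exp (-(c / 2 * r)) * Real.exp (-(c / 2) * r)) := by
        field_simp
    _ ≤ _ := by
        refine mul_le_mul_of_nonneg_left ?_ (by positivity)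
        linarith

lemma norm_I_mul_heatExp_le {d τ c r θ : ℝ} (hc : 0 < c) (hr : 0 ≤ r)
    (h : ‖heatExp d τ (polar r θ)‖ ≤ Real.exp (-c * r)) :
    ‖Complex.I * polar r θ * heatExp d τ (polar r θ)‖ ≤ 2 / c * Real.exp (-(c / 2) * r) := by
  rw [norm_mul, norm_mul, Complex.norm_I, one_mul, norm_polar hr]
  exact (mul_le_mul_of_nonneg_left h hr).trans (mul_exp_neg_le hc r)

/-- Decay in the sector between the contour and infinity, for nonpositive times. -/
lemma norm_heatExp_le_of_nonpos {d τ r θ : ℝ} (hd : 0 < d) (hτ : τ ≤ 0) (hr : 0 ≤ r)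
    (h : θ ∈ uIcc (3 * Real.pi / 4) (Real.pi / 4)) :
    ‖heatExp d τ (polar r θ)‖ ≤ Real.exp (-(d / 2) * r) := by
  rw [norm_heatExp, polar_im, polar_sq_re, Real.exp_le_exp]
  have h1 := mul_le_mul_of_nonneg_left (half_le_sin h) (mul_nonneg hd.le hr)
  have h2 := mul_nonneg_of_nonpos_of_nonpos hτ
    (mul_nonpos_of_nonneg_of_nonpos (sq_nonneg r) (cos_two_mul_nonpos h))
  linarith

lemma norm_heatExp_ray_le {d r θ : ℝ} (hd : 0 < d) (τ : ℝ) (hr : 0 ≤ r)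
    (h : θ ∈ uIcc (3 * Real.pi / 4) (Real.pi / 4)) (h' : Real.cos (2 * θ) = 0) :
    ‖heatExp d τ (polar r θ)‖ ≤ Real.exp (-(d / 2) * r) := by
  rw [norm_heatExp, polar_im, polar_sq_re, Real.exp_le_exp, h']
  have h1 := mul_le_mul_of_nonneg_left (half_le_sin h) (mul_nonneg hd.le hr)
  linarith

/-- Decay in the sectors between the contour and the real line, for positive times. -/
lemma norm_heatExp_le_of_pos {d τ R r θ : ℝ} (hd : 0 < d) (hτ : 0 < τ) (hR : 0 < R) (hr : R ≤ r)
    (h : 0 ≤ Real.sin θ) (h' : 0 ≤ Real.cos (2 * θ)) :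
    ‖heatExp d τ (polar r θ)‖ ≤ Real.exp (-(min d (τ * R) / 2) * r) := by
  have hr0 : 0 < r := hR.trans_le hr
  rw [norm_heatExp, polar_im, polar_sq_re, Real.exp_le_exp]
  have a1 : 0 ≤ d * (r * Real.sin θ) := by positivity
  have a2 : 0 ≤ τ * (r ^ 2 * Real.cos (2 * θ)) := by positivity
  rcases le_total (1 / 2) (Real.sin θ) with hs | hs
  · have h1 := mul_le_mul_of_nonneg_left hs (mul_nonneg hd.le hr0.le)
    have h2 := mul_le_mul_of_nonneg_right (min_le_left d (τ * R)) hr0.le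
    linarith
  · have hc : 1 / 2 ≤ Real.cos (2 * θ) := by
      rw [Real.cos_two_mul, Real.cos_sq']
      nlinarith
    have h1 := mul_le_mul_of_nonneg_left hc (show 0 ≤ τ * r ^ 2 by positivity)
    have h2 := mul_le_mul_of_nonneg_right (min_le_right d (τ * R)) hr0.le
    have h3 : τ * R * r ≤ τ * r ^ 2 := by
      rw [sq, mul_assoc]
      exact mul_le_mul_of_nonneg_left (mul_le_mul_of_nonneg_right hr hr0.le) hτ.le
    linarith

lemma sector_right {θ : ℝ} (h : θ ∈ uIcc 0 (Real.pi / 4)) :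
    0 ≤ Real.sin θ ∧ 0 ≤ Real.cos (2 * θ) := by
  have hπ := Real.pi_pos
  rw [uIcc_of_le (by linarith)] at h
  exact ⟨Real.sin_nonneg_of_nonneg_of_le_pi h.1 (by linarith [h.2]),
    Real.cos_nonneg_of_neg_pi_div_two_le_of_le (by linarith [h.1]) (by linarith [h.2])⟩

lemma sector_left {θ : ℝ} (h : θ ∈ uIcc (3 * Real.pi / 4) Real.pi) :
    0 ≤ Real.sin θ ∧ 0 ≤ Real.cos (2 * θ) := by
  have hπ := Real.pi_pos
  rw [uIcc_of_le (by linarith)] at h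
  refine ⟨Real.sin_nonneg_of_nonneg_of_le_pi (by linarith [h.1]) h.2, ?_⟩
  rw [← Real.cos_sub_two_pi]
  exact Real.cos_nonneg_of_neg_pi_div_two_le_of_le (by linarith [h.1]) (by linarith [h.2])

/-- An entire function that decays in the two sectors between `∂D_R^+` and the real line has the
same integral over both. -/
lemma intPlus_eq_integral {R C c : ℝ} (hR : 0 < R) (hc : 0 < c) {F : ℂ → ℂ}
    (hF : Differentiable ℂ F) (hi : Integrable fun x : ℝ => F x)
    (hb : ∀ r, R ≤ r → ∀ θ, 0 ≤ Real.sin θ → 0 ≤ Real.cos (2 * θ) →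
      ‖F (polar r θ)‖ ≤ C * Real.exp (-c * r)) :
    intPlus R F = ∫ x : ℝ, F x := by
  have hcont : Continuous fun θ => F (polar R θ) :=
    hF.continuous.comp (continuous_polar.comp (Continuous.prodMk_right R))
  rw [intPlus, ← contourIntegral_add_adjacent (b := 0) (hcont.intervalIntegrable _ _)
    (hcont.intervalIntegrable _ _), ← contourIntegral_add_adjacent (b := Real.pi)
    (hcont.intervalIntegrable _ _) (hcont.intervalIntegrable _ _),
    contourIntegral_pi_zero hR hF hi,
    contourIntegral_eq_zero hR hc (fun r _ θ _ => hF _)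
      (fun r hr θ hθ => hb r hr θ (sector_left hθ).1 (sector_left hθ).2),
    contourIntegral_eq_zero hR hc (fun r _ θ _ => hF _)
      (fun r hr θ hθ => hb r hr θ (sector_right hθ).1 (sector_right hθ).2)]
  ring

lemma intPlus_heatExp_of_pos {d τ R : ℝ} (hd : 0 < d) (hτ : 0 < τ) (hR : 0 < R) :
    intPlus R (heatExp d τ) = heatKernel d τ ∧
      intPlus R (fun ν => Complex.I * ν * heatExp d τ ν) = heatKernel' d τ := by
  have hm : 0 < min d (τ * R) / 2 := half_pos (lt_min hd (mul_pos hτ hR))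
  constructor
  · rw [← integral_heatExp d hτ]
    exact intPlus_eq_integral (C := 1) hR hm (differentiable_heatExp d τ)
      (integrable_heatExp d hτ)
      fun r hr θ h h' => by rw [one_mul]; exact norm_heatExp_le_of_pos hd hτ hR hr h h'
  · rw [← integral_I_mul_heatExp d hτ]
    refine intPlus_eq_integral hR (half_pos hm) ?_ ?_
      fun r hr θ h h' => norm_I_mul_heatExp_le hm (hR.le.trans hr)
        (norm_heatExp_le_of_pos hd hτ hR hr h h')
    · exact (differentiable_id.const_mul _).mul (differentiable_heatExp d τ)
    · simpa only [mul_assoc] using (integrable_mul_heatExp d hτ).const_mul Complex.I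

lemma intPlus_heatExp_of_nonpos {d τ R : ℝ} (hd : 0 < d) (hτ : τ ≤ 0) (hR : 0 < R) :
    intPlus R (heatExp d τ) = 0 ∧
      intPlus R (fun ν => Complex.I * ν * heatExp d τ ν) = 0 := by
  have hm : 0 < d / 2 := half_pos hd
  constructor
  · exact contourIntegral_eq_zero (C := 1) hR hm (fun r _ θ _ => differentiable_heatExp d τ _)
      fun r hr θ h => by
        rw [one_mul]; exact norm_heatExp_le_of_nonpos hd hτ (hR.le.trans hr) h
  · exact contourIntegral_eq_zero hR (half_pos hm)
      (fun r _ θ _ => ((differentiable_id.const_mul _).mul (differentiable_heatExp d τ)) _)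
      fun r hr θ h => norm_I_mul_heatExp_le hm (hR.le.trans hr)
        (norm_heatExp_le_of_nonpos hd hτ (hR.le.trans hr) h)

/-- A contour integral of boundary transforms is a single-layer or double-layer heat potential:
the contour integral of the kernel vanishes at the times after `t`, and is a heat kernel before. -/
lemma intPlus_timeIntegral {d t T R : ℝ} (hd : 0 < d) (ht : 0 < t) (htT : t ≤ T) (hR : 0 < R)
    {φ ψ : ℝ → ℂ} (hφ : IntegrableOn φ (Ioc 0 T)) (hψ : IntegrableOn ψ (Ioc 0 T)) :
    IntegrablePlus R (fun ν => (∫ s in (0 : ℝ)..T, heatExp d (t - s) ν * φ s)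
        + ∫ s in (0 : ℝ)..T, Complex.I * ν * heatExp d (t - s) ν * ψ s) ∧
      IntervalIntegrable (fun s => heatKernel d (t - s) * φ s + heatKernel' d (t - s) * ψ s)
        volume 0 t ∧
      intPlus R (fun ν => (∫ s in (0 : ℝ)..T, heatExp d (t - s) ν * φ s)
        + ∫ s in (0 : ℝ)..T, Complex.I * ν * heatExp d (t - s) ν * ψ s)
      = ∫ s in (0 : ℝ)..t, (heatKernel d (t - s) * φ s + heatKernel' d (t - s) * ψ s) := by
  have hT : 0 < T := ht.trans_le htT
  have hm : 0 < d / 2 := half_pos hd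
  have hK := continuous_heatExp d t
  have hK' : Continuous fun p : ℂ × ℝ => Complex.I * p.1 * heatExp d (t - p.2) p.1 :=
    (continuous_const.mul continuous_fst).mul hK
  have bdd : ∀ K : ℂ → ℝ → ℂ, (Continuous fun p : ℂ × ℝ => K p.1 p.2) →
      ∃ B, ∀ θ ∈ uIcc (3 * Real.pi / 4) (Real.pi / 4), ∀ s ∈ Ioc 0 T,
        ‖K (polar R θ) s‖ ≤ B := by
    intro K hK
    obtain ⟨B, hB⟩ := (isCompact_uIcc.prod isCompact_Icc :
      IsCompact (uIcc (3 * Real.pi / 4) (Real.pi / 4) ×ˢ Icc 0 T)).exists_bound_of_continuousOn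
      (f := fun p : ℝ × ℝ => K (polar R p.1) p.2)
      (hK.comp ((continuous_polar.comp (continuous_const.prodMk continuous_fst)).prodMk
        continuous_snd)).continuousOn
    exact ⟨B, fun θ hθ s hs => hB (θ, s) ⟨hθ, Ioc_subset_Icc_self hs⟩⟩
  obtain ⟨i1, j1, e1⟩ := contourIntegral_timeIntegral (a := 3 * Real.pi / 4) (b := Real.pi / 4)
    (R := R) (C := 1) (K := fun ν s => heatExp d (t - s) ν) hT.le hm hK
    (fun r hr s _ => by
      rw [one_mul]
      exact norm_heatExp_ray_le hd _ (hR.le.trans hr) left_mem_uIcc cos_two_mul_ray.1)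
    (fun r hr s _ => by
      rw [one_mul]
      exact norm_heatExp_ray_le hd _ (hR.le.trans hr) right_mem_uIcc cos_two_mul_ray.2)
    (bdd (fun ν s => heatExp d (t - s) ν) hK) hφ
  obtain ⟨i2, j2, e2⟩ := contourIntegral_timeIntegral (a := 3 * Real.pi / 4) (b := Real.pi / 4)
    (R := R) (K := fun ν s => Complex.I * ν * heatExp d (t - s) ν) hT.le (half_pos hm) hK'
    (fun r hr s _ => norm_I_mul_heatExp_le hm (hR.le.trans hr)
      (norm_heatExp_ray_le hd _ (hR.le.trans hr) left_mem_uIcc cos_two_mul_ray.1))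
    (fun r hr s _ => norm_I_mul_heatExp_le hm (hR.le.trans hr)
      (norm_heatExp_ray_le hd _ (hR.le.trans hr) right_mem_uIcc cos_two_mul_ray.2))
    (bdd (fun ν s => Complex.I * ν * heatExp d (t - s) ν) hK') hψ
  have hsum := ContourIntegrable.add i1 i2
  set k : ℝ → ℂ := fun s => intPlus R (fun ν => heatExp d (t - s) ν) * φ s
    + intPlus R (fun ν => Complex.I * ν * heatExp d (t - s) ν) * ψ s with hk
  have jk : IntervalIntegrable k volume 0 T := j1.add j2
  have k0 : ∀ s, t ≤ s → k s = 0 := fun s hs => by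
    obtain ⟨h1, h2⟩ := intPlus_heatExp_of_nonpos hd (sub_nonpos.2 hs) hR
    simp only [hk, h1, h2, zero_mul, add_zero]
  have k1 : ∀ s, s < t → k s = heatKernel d (t - s) * φ s + heatKernel' d (t - s) * ψ s :=
    fun s hs => by
      obtain ⟨h1, h2⟩ := intPlus_heatExp_of_pos hd (sub_pos.2 hs) hR
      simp only [hk, h1, h2]
  have ae1 : ∀ᵐ s ∂volume, s ∈ uIoc 0 t →
      k s = heatKernel d (t - s) * φ s + heatKernel' d (t - s) * ψ s := by
    have : ∀ᵐ s : ℝ ∂volume, s ≠ t := by simp [ae_iff]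
    filter_upwards [this] with s hs hs'
    rw [uIoc_of_le ht.le] at hs'
    exact k1 s (lt_of_le_of_ne hs'.2 hs)
  have jk1 : IntervalIntegrable k volume 0 t :=
    jk.mono_set (by rw [uIcc_of_le ht.le, uIcc_of_le hT.le]; exact Icc_subset_Icc_right htT)
  refine ⟨hsum, ?_, ?_⟩
  · exact jk1.congr_ae ((ae_restrict_iff' measurableSet_uIoc).2 ae1)
  · rw [← intervalIntegral.integral_congr_ae ae1]
    have z : ∫ s in t..T, k s = 0 := by
      rw [intervalIntegral.integral_congr (g := fun _ => 0), intervalIntegral.integral_zero]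
      intro s hs
      rw [uIcc_of_le htT] at hs
      exact k0 s hs.1
    have := intervalIntegral.integral_add_adjacent_intervals jk1 (c := T)
      (jk.mono_set (by rw [uIcc_of_le htT, uIcc_of_le hT.le]; exact Icc_subset_Icc_left ht.le))
    rw [z, add_zero] at this
    rw [this, intPlus, ContourIntegrable.integral_add i1 i2, e1, e2,
      ← intervalIntegral.integral_add j1 j2]
    rfl

section Green

/-! ### Green's identity in one layer -/

/-- A classical solution `v` of `v_t = κ v_xx` in one layer `[a, b]`, with `x`-derivative `vx`,
time derivative `vt`, integrable traces and initial datum `v₀` attained in the mean. -/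
structure LayerSolution (a b κ : ℝ) (v vx vt : ℝ → ℝ → ℝ) (v₀ : ℝ → ℝ) : Prop where
  lt : a < b
  κ_pos : 0 < κ
  cont : ContinuousOn (fun p : ℝ × ℝ => v p.1 p.2) (Icc a b ×ˢ Ioi 0)
  cont_vx : ContinuousOn (fun p : ℝ × ℝ => vx p.1 p.2) (Icc a b ×ˢ Ioi 0)
  cont_vt : ContinuousOn (fun p : ℝ × ℝ => vt p.1 p.2) (Ioo a b ×ˢ Ioi 0)
  deriv_x : ∀ y ∈ Ioo a b, ∀ s, 0 < s → HasDerivAt (fun z => v z s) (vx y s) y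
  deriv_xx : ∀ y ∈ Ioo a b, ∀ s, 0 < s → HasDerivAt (fun z => vx z s) (vt y s / κ) y
  deriv_t : ∀ y ∈ Ioo a b, ∀ s, 0 < s → HasDerivAt (fun r => v y r) (vt y s) s
  int_initial : IntegrableOn v₀ (Ioo a b)
  initial : Tendsto (fun s => ∫ y in Ioo a b, |v y s - v₀ y|) (𝓝[>] 0) (𝓝 0)
  int_left : ∀ T, 0 < T → IntegrableOn (fun s => v a s) (Ioc 0 T)
  int_right : ∀ T, 0 < T → IntegrableOn (fun s => v b s) (Ioc 0 T)
  int_vx_left : ∀ T, 0 < T → IntegrableOn (fun s => vx a s) (Ioc 0 T)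
  int_vx_right : ∀ T, 0 < T → IntegrableOn (fun s => vx b s) (Ioc 0 T)

/-- A test function `φ` for times before `S`: a solution of the adjoint equation `φ_s = -κ φ_yy`. -/
structure AdjointSolution (κ S : ℝ) (φ φy φyy : ℝ → ℝ → ℂ) : Prop where
  cont : ContinuousOn (fun p : ℝ × ℝ => φ p.1 p.2) (univ ×ˢ Iio S)
  cont_y : ContinuousOn (fun p : ℝ × ℝ => φy p.1 p.2) (univ ×ˢ Iio S)
  cont_yy : ContinuousOn (fun p : ℝ × ℝ => φyy p.1 p.2) (univ ×ˢ Iio S)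
  deriv_y : ∀ y s, s < S → HasDerivAt (fun z => φ z s) (φy y s) y
  deriv_yy : ∀ y s, s < S → HasDerivAt (fun z => φy z s) (φyy y s) y
  deriv_s : ∀ y s, s < S → HasDerivAt (fun r => φ y r) (-κ * φyy y s) s

/-- The boundary flux `φ v_x - φ_y v` of Green's identity. -/
def greenFlux (v vx : ℝ → ℝ → ℝ) (φ φy : ℝ → ℝ → ℂ) (y s : ℝ) : ℂ :=
  φ y s * vx y s - φy y s * v y s

variable {a b κ S : ℝ} {v vx vt : ℝ → ℝ → ℝ} {v₀ : ℝ → ℝ} {φ φy φyy : ℝ → ℝ → ℂ}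

lemma continuousOn_slice_left {f : ℝ → ℝ → ℂ} {s t : Set ℝ}
    (h : ContinuousOn (fun p : ℝ × ℝ => f p.1 p.2) (s ×ˢ t)) {τ : ℝ} (hτ : τ ∈ t) :
    ContinuousOn (fun y => f y τ) s :=
  h.comp (f := fun y => (y, τ)) (by fun_prop) fun _ hy => ⟨hy, hτ⟩

lemma continuousOn_slice_right {f : ℝ → ℝ → ℂ} {s t : Set ℝ}
    (h : ContinuousOn (fun p : ℝ × ℝ => f p.1 p.2) (s ×ˢ t)) {y : ℝ} (hy : y ∈ s) :
    ContinuousOn (fun τ => f y τ) t :=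
  h.comp (f := fun τ => (y, τ)) (by fun_prop) fun _ hτ => ⟨hy, hτ⟩

lemma continuousOn_ofReal {f : ℝ → ℝ → ℝ} {s : Set (ℝ × ℝ)}
    (h : ContinuousOn (fun p : ℝ × ℝ => f p.1 p.2) s) :
    ContinuousOn (fun p : ℝ × ℝ => (f p.1 p.2 : ℂ)) s :=
  Complex.continuous_ofReal.comp_continuousOn h

lemma continuousOn_greenFlux (hv : LayerSolution a b κ v vx vt v₀)
    (hφ : AdjointSolution κ S φ φy φyy) :
    ContinuousOn (fun p : ℝ × ℝ => greenFlux v vx φ φy p.1 p.2) (Icc a b ×ˢ Ioo 0 S) := by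
  have h1 : Icc a b ×ˢ Ioo 0 S ⊆ Icc a b ×ˢ Ioi 0 := prod_mono le_rfl fun x hx => hx.1
  have h2 : Icc a b ×ˢ Ioo 0 S ⊆ univ ×ˢ Iio S := prod_mono (subset_univ _) fun x hx => hx.2
  exact ((hφ.cont.mono h2).mul (continuousOn_ofReal (hv.cont_vx.mono h1))).sub
    ((hφ.cont_y.mono h2).mul (continuousOn_ofReal (hv.cont.mono h1)))

lemma continuousOn_mul_solution (hv : LayerSolution a b κ v vx vt v₀)
    (hφ : AdjointSolution κ S φ φy φyy) :
    ContinuousOn (fun p : ℝ × ℝ => φ p.1 p.2 * (v p.1 p.2 : ℂ)) (Icc a b ×ˢ Ioo 0 S) := by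
  have h1 : Icc a b ×ˢ Ioo 0 S ⊆ Icc a b ×ˢ Ioi 0 := prod_mono le_rfl fun x hx => hx.1
  have h2 : Icc a b ×ˢ Ioo 0 S ⊆ univ ×ˢ Iio S := prod_mono (subset_univ _) fun x hx => hx.2
  exact (hφ.cont.mono h2).mul (continuousOn_ofReal (hv.cont.mono h1))

/-- Green's identity on a rectangle inside the layer: both sides are iterated integrals of
`κ (φ v_xx - φ_yy v)`. -/
lemma green_interior (hv : LayerSolution a b κ v vx vt v₀) (hφ : AdjointSolution κ S φ φy φyy)
    {a' b' τ T : ℝ} (ha : a < a') (hab : a' ≤ b') (hb : b' < b) (hτ : 0 < τ) (hτT : τ ≤ T)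
    (hT : T < S) :
    (∫ y in a'..b', φ y T * (v y T : ℂ)) - ∫ y in a'..b', φ y τ * (v y τ : ℂ)
      = κ * ∫ s in τ..T, (greenFlux v vx φ φy b' s - greenFlux v vx φ φy a' s) := by
  have hκ : (κ : ℂ) ≠ 0 := by exact_mod_cast hv.κ_pos.ne'
  set D : ℝ → ℝ → ℂ := fun y s => φ y s * (vt y s / κ : ℝ) - φyy y s * v y s with hD
  have hsub : Icc a' b' ⊆ Ioo a b := fun y hy => ⟨ha.trans_le hy.1, hy.2.trans_lt hb⟩
  have hsub' : Icc τ T ⊆ Ioo 0 S := fun s hs => ⟨hτ.trans_le hs.1, hs.2.trans_lt hT⟩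
  have h1 : Icc a' b' ×ˢ Icc τ T ⊆ Ioo a b ×ˢ Ioi 0 :=
    prod_mono hsub fun s hs => (hsub' hs).1
  have h1' : Icc a' b' ×ˢ Icc τ T ⊆ Icc a b ×ˢ Ioi 0 :=
    h1.trans (prod_mono Ioo_subset_Icc_self le_rfl)
  have h2 : Icc a' b' ×ˢ Icc τ T ⊆ univ ×ˢ Iio S :=
    prod_mono (subset_univ _) fun s hs => (hsub' hs).2
  have hDc : ContinuousOn (fun p : ℝ × ℝ => D p.1 p.2) (Icc a' b' ×ˢ Icc τ T) :=
    ((hφ.cont.mono h2).mul (continuousOn_ofReal (f := fun y s => vt y s / κ)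
      ((hv.cont_vt.mono h1).div_const κ))).sub
      ((hφ.cont_yy.mono h2).mul (continuousOn_ofReal (hv.cont.mono h1')))
  have et : ∀ y ∈ Icc a' b', φ y T * (v y T : ℂ) - φ y τ * (v y τ : ℂ)
      = ∫ s in τ..T, κ * D y s := by
    intro y hy
    refine (intervalIntegral.integral_eq_sub_of_hasDerivAt (f := fun s => φ y s * (v y s : ℂ))
      (fun s hs => ?_) ?_).symm
    · rw [uIcc_of_le hτT] at hs
      have := (hφ.deriv_s y s (hsub' hs).2).mul (hv.deriv_t y (hsub hy) s (hsub' hs).1).ofReal_comp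
      refine this.congr_deriv ?_
      simp only [hD]
      push_cast
      field_simp
      ring
    · refine ContinuousOn.intervalIntegrable ?_
      rw [uIcc_of_le hτT]
      exact continuousOn_const.mul (continuousOn_slice_right hDc hy)
  have ey : ∀ s ∈ Icc τ T, greenFlux v vx φ φy b' s - greenFlux v vx φ φy a' s
      = ∫ y in a'..b', D y s := by
    intro s hs
    refine (intervalIntegral.integral_eq_sub_of_hasDerivAt (f := fun y => greenFlux v vx φ φy y s)
      (fun y hy => ?_) ?_).symm
    · rw [uIcc_of_le hab] at hy
      have := ((hφ.deriv_y y s (hsub' hs).2).mul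
        (hv.deriv_xx y (hsub hy) s (hsub' hs).1).ofReal_comp).sub
        ((hφ.deriv_yy y s (hsub' hs).2).mul (hv.deriv_x y (hsub hy) s (hsub' hs).1).ofReal_comp)
      refine this.congr_deriv ?_
      simp only [hD]
      ring
    · refine ContinuousOn.intervalIntegrable ?_
      rw [uIcc_of_le hab]
      exact continuousOn_slice_left hDc hs
  have ic : ∀ s ∈ Icc τ T, IntervalIntegrable (fun y => φ y s * (v y s : ℂ)) volume a' b' := by
    intro s hs
    refine ContinuousOn.intervalIntegrable ?_
    rw [uIcc_of_le hab]
    exact (continuousOn_slice_left (f := fun y s => φ y s * (v y s : ℂ))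
      (continuousOn_mul_solution hv hφ) (hsub' hs)).mono (hsub.trans Ioo_subset_Icc_self)
  rw [← intervalIntegral.integral_sub (ic T (right_mem_Icc.2 hτT)) (ic τ (left_mem_Icc.2 hτT)),
    intervalIntegral.integral_congr (g := fun y => ∫ s in τ..T, κ * D y s)
      (fun y hy => et y (by rwa [uIcc_of_le hab] at hy)),
    intervalIntegral.integral_congr (a := τ) (b := T) (g := fun s => ∫ y in a'..b', D y s)
      (fun s hs => ey s (by rwa [uIcc_of_le hτT] at hs)),
    intervalIntegral_intervalIntegral_swap, ← intervalIntegral.integral_const_mul]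
  · simp only [intervalIntegral.integral_const_mul]
  · rw [uIoc_of_le hab, uIoc_of_le hτT]
    refine IntegrableOn.mono_set ?_ (prod_mono Ioc_subset_Icc_self Ioc_subset_Icc_self)
    exact (continuousOn_const.mul hDc).integrableOn_compact (isCompact_Icc.prod isCompact_Icc)

/-- Green's identity on the whole layer, away from the initial time. -/
lemma green_layer (hv : LayerSolution a b κ v vx vt v₀) (hφ : AdjointSolution κ S φ φy φyy)
    {τ T : ℝ} (hτ : 0 < τ) (hτT : τ ≤ T) (hT : T < S) :
    (∫ y in a..b, φ y T * (v y T : ℂ)) - ∫ y in a..b, φ y τ * (v y τ : ℂ)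
      = κ * ∫ s in τ..T, (greenFlux v vx φ φy b s - greenFlux v vx φ φy a s) := by
  have hab := hv.lt
  have hsub' : Icc τ T ⊆ Ioo 0 S := fun s hs => ⟨hτ.trans_le hs.1, hs.2.trans_lt hT⟩
  have hprod : Icc a b ×ˢ Icc τ T ⊆ Icc a b ×ˢ Ioo 0 S := prod_mono le_rfl hsub'
  -- the rectangles `[a + ε, b - ε]` exhaust the layer as `ε ↓ 0`
  have ta : Tendsto (fun ε : ℝ => a + ε) (𝓝[>] 0) (𝓝[Icc a b] a) := by
    refine tendsto_nhdsWithin_iff.2 ⟨?_, ?_⟩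
    · have : Tendsto (fun ε : ℝ => a + ε) (𝓝 0) (𝓝 (a + 0)) := tendsto_id.const_add a
      rw [add_zero] at this; exact this.mono_left nhdsWithin_le_nhds
    · filter_upwards [Ioo_mem_nhdsGT (sub_pos.2 hab)] with ε hε
      exact ⟨by linarith [hε.1], by linarith [hε.2]⟩
  have tb : Tendsto (fun ε : ℝ => b - ε) (𝓝[>] 0) (𝓝[Icc a b] b) := by
    refine tendsto_nhdsWithin_iff.2 ⟨?_, ?_⟩
    · have : Tendsto (fun ε : ℝ => b - ε) (𝓝 0) (𝓝 (b - 0)) := tendsto_id.const_sub b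
      rw [sub_zero] at this; exact this.mono_left nhdsWithin_le_nhds
    · filter_upwards [Ioo_mem_nhdsGT (sub_pos.2 hab)] with ε hε
      exact ⟨by linarith [hε.2], by linarith [hε.1]⟩
  have tspace : ∀ s ∈ Icc τ T, Tendsto (fun ε => ∫ y in (a + ε)..(b - ε), φ y s * (v y s : ℂ))
      (𝓝[>] 0) (𝓝 (∫ y in a..b, φ y s * (v y s : ℂ))) := by
    intro s hs
    have hc := continuousOn_slice_left (f := fun y s => φ y s * (v y s : ℂ))
      (continuousOn_mul_solution hv hφ) (hsub' hs)
    have hi : IntervalIntegrable (fun y => φ y s * (v y s : ℂ)) volume a b :=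
      ContinuousOn.intervalIntegrable (by rwa [uIcc_of_le hab.le])
    have hp := intervalIntegral.continuousOn_primitive_interval' hi left_mem_uIcc
    rw [uIcc_of_le hab.le] at hp
    have l1 := (hp b (right_mem_Icc.2 hab.le)).tendsto.comp tb
    have l2 := (hp a (left_mem_Icc.2 hab.le)).tendsto.comp ta
    have l3 := l1.sub l2
    rw [intervalIntegral.integral_same, sub_zero] at l3
    refine l3.congr' ?_
    filter_upwards [Ioo_mem_nhdsGT (sub_pos.2 hab)] with ε hε
    simp only [Function.comp]
    refine intervalIntegral.integral_interval_sub_left ?_ ?_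
    · refine hi.mono_set ?_
      rw [uIcc_of_le hab.le, uIcc_of_le (by linarith [hε.2])]
      exact Icc_subset_Icc_right (by linarith [hε.1])
    · refine hi.mono_set ?_
      rw [uIcc_of_le hab.le, uIcc_of_le (by linarith [hε.1])]
      exact Icc_subset_Icc_right (by linarith [hε.2])
  have hB := (continuousOn_greenFlux hv hφ).mono hprod
  obtain ⟨M, hM⟩ := (isCompact_Icc.prod isCompact_Icc :
    IsCompact (Icc a b ×ˢ Icc τ T)).exists_bound_of_continuousOn hB
  have ttime : Tendsto (fun ε => ∫ s in τ..T,
      (greenFlux v vx φ φy (b - ε) s - greenFlux v vx φ φy (a + ε) s)) (𝓝[>] 0)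
      (𝓝 (∫ s in τ..T, (greenFlux v vx φ φy b s - greenFlux v vx φ φy a s))) := by
    refine intervalIntegral.tendsto_integral_filter_of_dominated_convergence (fun _ => M + M)
      ?_ ?_ intervalIntegrable_const ?_
    · filter_upwards [Ioo_mem_nhdsGT (sub_pos.2 hab)] with ε hε
      rw [uIoc_of_le hτT]
      refine ContinuousOn.aestronglyMeasurable ?_ measurableSet_Ioc
      exact ((continuousOn_slice_right hB ⟨by linarith [hε.2], by linarith [hε.1]⟩).sub
        (continuousOn_slice_right hB ⟨by linarith [hε.1], by linarith [hε.2]⟩)).mono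
        Ioc_subset_Icc_self
    · filter_upwards [Ioo_mem_nhdsGT (sub_pos.2 hab)] with ε hε
      refine .of_forall fun s hs => ?_
      rw [uIoc_of_le hτT] at hs
      have hs' := Ioc_subset_Icc_self hs
      exact (norm_sub_le _ _).trans (add_le_add
        (hM (b - ε, s) ⟨⟨by linarith [hε.2], by linarith [hε.1]⟩, hs'⟩)
        (hM (a + ε, s) ⟨⟨by linarith [hε.1], by linarith [hε.2]⟩, hs'⟩))
    · refine .of_forall fun s hs => ?_
      rw [uIoc_of_le hτT] at hs
      have hc := continuousOn_slice_left hB (Ioc_subset_Icc_self hs)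
      exact ((hc b (right_mem_Icc.2 hab.le)).tendsto.comp tb).sub
        ((hc a (left_mem_Icc.2 hab.le)).tendsto.comp ta)
  refine tendsto_nhds_unique (((tspace T (right_mem_Icc.2 hτT)).sub
    (tspace τ (left_mem_Icc.2 hτT))).congr' ?_) (ttime.const_mul (κ : ℂ))
  filter_upwards [Ioo_mem_nhdsGT (half_pos (sub_pos.2 hab))] with ε hε
  exact green_interior hv hφ (by linarith [hε.1]) (by linarith [hε.2]) (by linarith [hε.1])
    hτ hτT hT

/-- The initial datum is attained in the mean, hence also when tested against `φ`. -/
lemma tendsto_integral_initial (hv : LayerSolution a b κ v vx vt v₀)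
    (hφ : AdjointSolution κ S φ φy φyy) (hS : 0 < S) :
    Tendsto (fun τ => ∫ y in a..b, φ y τ * (v y τ : ℂ)) (𝓝[>] 0)
      (𝓝 (∫ y in a..b, φ y 0 * (v₀ y : ℂ))) := by
  have hab := hv.lt
  obtain ⟨M, hM⟩ := (isCompact_Icc.prod isCompact_Icc :
    IsCompact (Icc a b ×ˢ Icc 0 (S / 2))).exists_bound_of_continuousOn
    (hφ.cont.mono (prod_mono (subset_univ _) fun s hs => hs.2.trans_lt (half_lt_self hS)))
  have hev : ∀ᶠ τ in 𝓝[>] (0 : ℝ), τ ∈ Ioo 0 (S / 2) := Ioo_mem_nhdsGT (half_pos hS)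
  have hc : ∀ τ ∈ Icc 0 (S / 2), ContinuousOn (fun y => φ y τ) (Icc a b) := fun τ hτ =>
    (continuousOn_slice_left hφ.cont (hτ.2.trans_lt (half_lt_self hS))).mono (subset_univ _)
  have hm : ∀ τ ∈ Icc 0 (S / 2), AEStronglyMeasurable (fun y => φ y τ)
      (volume.restrict (Ioo a b)) := fun τ hτ =>
    ((hc τ hτ).mono Ioo_subset_Icc_self).aestronglyMeasurable measurableSet_Ioo
  have hvi : ∀ τ, 0 < τ → IntegrableOn (fun y => v y τ) (Ioo a b) := fun τ hτ =>
    ((hv.cont.comp (f := fun y => (y, τ)) (by fun_prop) fun _ hy => ⟨hy, hτ⟩ :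
      ContinuousOn (fun y => v y τ) (Icc a b)).integrableOn_Icc).mono_set Ioo_subset_Icc_self
  simp only [intervalIntegral.integral_of_le hab.le, integral_Ioc_eq_integral_Ioo]
  have t1 : Tendsto (fun τ => ∫ y in Ioo a b, φ y τ * ((v y τ - v₀ y : ℝ) : ℂ)) (𝓝[>] 0)
      (𝓝 0) := by
    have hlim := hv.initial.const_mul M
    rw [mul_zero] at hlim
    refine squeeze_zero_norm' ?_ hlim
    filter_upwards [hev] with τ hτ
    rw [← integral_const_mul]
    refine norm_integral_le_of_norm_le (((hvi τ hτ.1).sub hv.int_initial).abs.const_mul M) ?_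
    refine (ae_restrict_iff' measurableSet_Ioo).2 (.of_forall fun y hy => ?_)
    rw [norm_mul, Complex.norm_real, Real.norm_eq_abs]
    exact mul_le_mul_of_nonneg_right
      (hM (y, τ) ⟨Ioo_subset_Icc_self hy, Ioo_subset_Icc_self hτ⟩) (abs_nonneg _)
  have t2 : Tendsto (fun τ => ∫ y in Ioo a b, φ y τ * (v₀ y : ℂ)) (𝓝[>] 0)
      (𝓝 (∫ y in Ioo a b, φ y 0 * (v₀ y : ℂ))) := by
    refine tendsto_integral_filter_of_dominated_convergence (fun y => M * |v₀ y|) ?_ ?_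
      (hv.int_initial.abs.const_mul M) ?_
    · filter_upwards [hev] with τ hτ
      exact (hm τ (Ioo_subset_Icc_self hτ)).mul
        (Complex.continuous_ofReal.comp_aestronglyMeasurable hv.int_initial.aestronglyMeasurable)
    · filter_upwards [hev] with τ hτ
      refine (ae_restrict_iff' measurableSet_Ioo).2 (.of_forall fun y hy => ?_)
      rw [norm_mul, Complex.norm_real, Real.norm_eq_abs]
      exact mul_le_mul_of_nonneg_right
        (hM (y, τ) ⟨Ioo_subset_Icc_self hy, Ioo_subset_Icc_self hτ⟩) (abs_nonneg _)
    · refine .of_forall fun y => Tendsto.mul_const _ ?_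
      have := (hφ.deriv_s y 0 hS).continuousAt.tendsto
      exact this.mono_left nhdsWithin_le_nhds
  have t3 := t1.add t2
  rw [zero_add] at t3
  refine t3.congr' ?_
  filter_upwards [hev] with τ hτ
  have i1 : Integrable (fun y => φ y τ * ((v y τ - v₀ y : ℝ) : ℂ)) (volume.restrict (Ioo a b)) := by
    refine ((hvi τ hτ.1).sub hv.int_initial).ofReal.bdd_mul (c := M)
      (hm τ (Ioo_subset_Icc_self hτ)) ?_
    exact (ae_restrict_iff' measurableSet_Ioo).2 (.of_forall fun y hy =>
      hM (y, τ) ⟨Ioo_subset_Icc_self hy, Ioo_subset_Icc_self hτ⟩)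
  have i2 : Integrable (fun y => φ y τ * (v₀ y : ℂ)) (volume.restrict (Ioo a b)) := by
    refine hv.int_initial.ofReal.bdd_mul (c := M) (hm τ (Ioo_subset_Icc_self hτ)) ?_
    exact (ae_restrict_iff' measurableSet_Ioo).2 (.of_forall fun y hy =>
      hM (y, τ) ⟨Ioo_subset_Icc_self hy, Ioo_subset_Icc_self hτ⟩)
  rw [← integral_add i1 i2]
  refine integral_congr_ae (.of_forall fun y => ?_)
  push_cast
  ring

/-- Green's identity on the layer from the initial time on. -/
lemma green_initial (hv : LayerSolution a b κ v vx vt v₀) (hφ : AdjointSolution κ S φ φy φyy)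
    {T : ℝ} (hT0 : 0 < T) (hT : T < S) :
    (∫ y in a..b, φ y T * (v y T : ℂ)) - ∫ y in a..b, φ y 0 * (v₀ y : ℂ)
      = κ * ∫ s in (0 : ℝ)..T, (greenFlux v vx φ φy b s - greenFlux v vx φ φy a s) := by
  have hS : 0 < S := hT0.trans hT
  have hflux : ∀ y, IntegrableOn (fun s => v y s) (Ioc 0 T) →
      IntegrableOn (fun s => vx y s) (Ioc 0 T) →
      IntervalIntegrable (fun s => greenFlux v vx φ φy y s) volume 0 T := by
    intro y h1 h2
    have hs : uIcc 0 T ⊆ Iio S := by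
      rw [uIcc_of_le hT0.le]; exact fun s hs => hs.2.trans_lt hT
    have h1' : IntervalIntegrable (fun s => (v y s : ℂ)) volume 0 T :=
      (intervalIntegrable_iff_integrableOn_Ioc_of_le hT0.le).2 h1.ofReal
    have h2' : IntervalIntegrable (fun s => (vx y s : ℂ)) volume 0 T :=
      (intervalIntegrable_iff_integrableOn_Ioc_of_le hT0.le).2 h2.ofReal
    exact (h2'.continuousOn_mul ((continuousOn_slice_right hφ.cont (mem_univ y)).mono hs)).sub
      (h1'.continuousOn_mul ((continuousOn_slice_right hφ.cont_y (mem_univ y)).mono hs))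
  have hi := (hflux b (hv.int_right T hT0) (hv.int_vx_right T hT0)).sub
    (hflux a (hv.int_left T hT0) (hv.int_vx_left T hT0))
  have hp := intervalIntegral.continuousOn_primitive_interval_left ((intervalIntegrable_iff').1 hi)
  rw [uIcc_of_le hT0.le] at hp
  have l1 := (hp 0 (left_mem_Icc.2 hT0.le)).tendsto
  rw [nhdsWithin_Icc_eq_nhdsGE hT0] at l1
  replace l1 := l1.mono_left (nhdsWithin_mono 0 Ioi_subset_Ici_self)
  refine tendsto_nhds_unique ((tendsto_const_nhds.sub
    (tendsto_integral_initial hv hφ hS)).congr' ?_) (l1.const_mul (κ : ℂ))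
  filter_upwards [Ioo_mem_nhdsGT hT0] with τ hτ
  exact green_layer hv hφ hτ.1 hτ.2.le hT

end Green

section HeatPotential

variable {a b κ : ℝ} {v vx vt : ℝ → ℝ → ℝ} {v₀ : ℝ → ℝ}

/-! ### The global relation and the heat kernel representation -/

lemma adjointSolution_exp (κ S : ℝ) (k : ℂ) :
    AdjointSolution κ S (fun y s => Complex.exp (-(Complex.I * k * y) + κ * k ^ 2 * s))
      (fun y s => -(Complex.I * k) * Complex.exp (-(Complex.I * k * y) + κ * k ^ 2 * s))
      (fun y s => -k ^ 2 * Complex.exp (-(Complex.I * k * y) + κ * k ^ 2 * s)) := by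
  have hy (y s : ℝ) : HasDerivAt
      (fun z : ℝ => Complex.exp (-(Complex.I * k * z) + κ * k ^ 2 * s))
      (-(Complex.I * k) * Complex.exp (-(Complex.I * k * y) + κ * k ^ 2 * s)) y := by
    have h := (((hasDerivAt_id (y : ℂ)).const_mul (Complex.I * k)).neg.add_const
      (κ * k ^ 2 * s : ℂ)).cexp.comp_ofReal
    refine h.congr_deriv ?_
    simp only [id, Pi.neg_apply, mul_one]
    ring
  refine ⟨?_, ?_, ?_, fun y s _ => hy y s, fun y s _ => ?_, fun y s _ => ?_⟩
  · exact Continuous.continuousOn (by fun_prop)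
  · exact Continuous.continuousOn (by fun_prop)
  · exact Continuous.continuousOn (by fun_prop)
  · refine ((hy y s).const_mul (-(Complex.I * k))).congr_deriv ?_
    linear_combination (k ^ 2 * Complex.exp (-(Complex.I * k * y) + κ * k ^ 2 * s)) * Complex.I_sq
  · have h := (((hasDerivAt_id (s : ℂ)).const_mul (κ * k ^ 2 : ℂ)).const_add
      (-(Complex.I * k * y))).cexp.comp_ofReal
    refine h.congr_deriv ?_
    simp only [id, mul_one]
    ring

/-- The global relation of one layer. -/
lemma global_relation (hv : LayerSolution a b κ v vx vt v₀) {T : ℝ} (hT : 0 < T) (k : ℂ) :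
    Complex.exp (κ * k ^ 2 * T) * (∫ y in a..b, Complex.exp (-(Complex.I * k * y)) * (v y T : ℂ))
      - ∫ y in a..b, Complex.exp (-(Complex.I * k * y)) * (v₀ y : ℂ)
    = Complex.exp (-(Complex.I * k * b)) *
        (κ * (timeTransform (vx b) (κ * k ^ 2) T
          + Complex.I * k * timeTransform (v b) (κ * k ^ 2) T))
      - Complex.exp (-(Complex.I * k * a)) *
        (κ * (timeTransform (vx a) (κ * k ^ 2) T
          + Complex.I * k * timeTransform (v a) (κ * k ^ 2) T)) := by
  have h := green_initial hv (adjointSolution_exp κ (T + 1) k) hT (by linarith)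
  have i0 : ∀ f : ℝ → ℝ, IntegrableOn f (Ioc 0 T) → IntervalIntegrable
      (fun s : ℝ => Complex.exp (κ * k ^ 2 * s) * (f s : ℂ)) volume 0 T := by
    intro f hf
    have h1 : IntervalIntegrable (fun s => (f s : ℂ)) volume 0 T :=
      (intervalIntegrable_iff_integrableOn_Ioc_of_le hT.le).2 hf.ofReal
    exact h1.continuousOn_mul (Continuous.continuousOn (by fun_prop))
  have flux : ∀ y, greenFlux v vx (fun y s => Complex.exp (-(Complex.I * k * y) + κ * k ^ 2 * s))
      (fun y s => -(Complex.I * k) * Complex.exp (-(Complex.I * k * y) + κ * k ^ 2 * s)) y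
      = fun s : ℝ => Complex.exp (-(Complex.I * k * y)) *
        (Complex.exp (κ * k ^ 2 * s) * (vx y s : ℂ)
          + Complex.I * k * (Complex.exp (κ * k ^ 2 * s) * (v y s : ℂ))) := by
    intro y; funext s
    rw [greenFlux, Complex.exp_add]; ring
  have ib := ((i0 _ (hv.int_vx_right T hT)).add
    ((i0 _ (hv.int_right T hT)).const_mul (Complex.I * k)))
  have ia := ((i0 _ (hv.int_vx_left T hT)).add
    ((i0 _ (hv.int_left T hT)).const_mul (Complex.I * k)))
  rw [flux, flux, intervalIntegral.integral_sub (ib.const_mul _) (ia.const_mul _),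
    intervalIntegral.integral_const_mul, intervalIntegral.integral_const_mul,
    intervalIntegral.integral_add (i0 _ (hv.int_vx_right T hT))
      ((i0 _ (hv.int_right T hT)).const_mul _),
    intervalIntegral.integral_add (i0 _ (hv.int_vx_left T hT))
      ((i0 _ (hv.int_left T hT)).const_mul _),
    intervalIntegral.integral_const_mul, intervalIntegral.integral_const_mul] at h
  simp only [timeTransform]
  have e1 : ∀ y : ℝ, Complex.exp (-(Complex.I * k * y) + κ * k ^ 2 * T) * (v y T : ℂ)
      = Complex.exp (κ * k ^ 2 * T) * (Complex.exp (-(Complex.I * k * y)) * (v y T : ℂ)) := by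
    intro y; rw [Complex.exp_add]; ring
  simp only [e1, intervalIntegral.integral_const_mul, Complex.ofReal_zero, mul_zero, add_zero] at h
  rw [h]
  ring

/-- The second `d`-derivative of `heatKernel`. -/
def heatKernel'' (d τ : ℝ) : ℝ := (d ^ 2 / (4 * τ ^ 2) - 1 / (2 * τ)) * heatKernel d τ

lemma heatKernel_neg (d τ : ℝ) : heatKernel (-d) τ = heatKernel d τ := by simp [heatKernel]

lemma heatKernel'_neg (d τ : ℝ) : heatKernel' (-d) τ = -heatKernel' d τ := by
  rw [heatKernel', heatKernel', heatKernel_neg]; ring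

lemma hasDerivAt_heatKernel (d τ : ℝ) :
    HasDerivAt (fun d => heatKernel d τ) (heatKernel' d τ) d := by
  have h := ((((hasDerivAt_pow 2 d).neg).div_const (4 * τ)).exp).const_mul (√(Real.pi / τ))
  refine h.congr_deriv ?_
  simp only [heatKernel', heatKernel, Pi.neg_apply]
  push_cast
  rcases eq_or_ne τ 0 with rfl | hτ
  · simp
  · field_simp; ring

lemma hasDerivAt_heatKernel' (d τ : ℝ) :
    HasDerivAt (fun d => heatKernel' d τ) (heatKernel'' d τ) d := by
  have h := (((hasDerivAt_id d).div_const (2 * τ)).neg).mul (hasDerivAt_heatKernel d τ)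
  refine h.congr_deriv ?_
  simp only [heatKernel', heatKernel'', Pi.neg_apply, id]
  rcases eq_or_ne τ 0 with rfl | hτ
  · simp
  · field_simp; ring

lemma hasDerivAt_heatKernel_time (d : ℝ) {τ : ℝ} (hτ : 0 < τ) :
    HasDerivAt (fun τ => heatKernel d τ) (heatKernel'' d τ) τ := by
  have hpos : 0 < Real.pi / τ := by positivity
  have h1 : HasDerivAt (fun τ => √(Real.pi / τ)) (-(1 / (2 * τ)) * √(Real.pi / τ)) τ := by
    have h := ((hasDerivAt_inv hτ.ne').const_mul Real.pi).sqrt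
      (by rw [← div_eq_mul_inv]; exact hpos.ne')
    refine (h.congr_deriv ?_)
    rw [← div_eq_mul_inv]
    have hs : √(Real.pi / τ) ≠ 0 := (Real.sqrt_pos.2 hpos).ne'
    have hsq : √(Real.pi / τ) ^ 2 = Real.pi / τ := Real.sq_sqrt hpos.le
    field_simp
    rw [hsq]; field_simp
  have h2 : HasDerivAt (fun τ => Real.exp (-d ^ 2 / (4 * τ)))
      (Real.exp (-d ^ 2 / (4 * τ)) * (d ^ 2 / (4 * τ ^ 2))) τ := by
    have h := (hasDerivAt_inv hτ.ne').const_mul (-d ^ 2 / 4)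
    have h' : HasDerivAt (fun τ => -d ^ 2 / (4 * τ)) (d ^ 2 / (4 * τ ^ 2)) τ := by
      refine (h.congr_deriv ?_).congr_of_eventuallyEq (.of_forall fun z => ?_)
      · field_simp
      · simp only [div_eq_mul_inv, mul_inv]; ring
    exact h'.exp
  refine (h1.mul h2).congr_deriv ?_
  simp only [heatKernel'', heatKernel]
  ring

lemma continuousOn_heatKernel (x σ t : ℝ) : ContinuousOn
    (fun p : ℝ × ℝ => heatKernel ((x - p.1) / σ) (t - p.2)) (univ ×ˢ Iio t) := by
  have hne : ∀ p ∈ (univ ×ˢ Iio t : Set (ℝ × ℝ)), t - p.2 ≠ 0 := fun p hp =>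
    (sub_pos.2 (show p.2 < t from hp.2)).ne'
  unfold heatKernel
  refine ContinuousOn.mul ?_ ?_
  · exact (ContinuousOn.div continuousOn_const (by fun_prop) hne).sqrt
  · refine ContinuousOn.rexp (ContinuousOn.div (by fun_prop) (by fun_prop) fun p hp => ?_)
    exact mul_ne_zero four_ne_zero (hne p hp)

/-- The backward heat kernel with pole `(x, t)` solves the adjoint equation before `t`. -/
lemma adjointSolution_heatKernel (x t : ℝ) {σ : ℝ} (hσ : σ ≠ 0) :
    AdjointSolution (σ ^ 2) t (fun y s => heatKernel ((x - y) / σ) (t - s))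
      (fun y s => -(heatKernel' ((x - y) / σ) (t - s) / σ : ℝ))
      (fun y s => (heatKernel'' ((x - y) / σ) (t - s) / σ ^ 2 : ℝ)) := by
  have hne : ∀ p ∈ (univ ×ˢ Iio t : Set (ℝ × ℝ)), t - p.2 ≠ 0 := fun p hp =>
    (sub_pos.2 (show p.2 < t from hp.2)).ne'
  have hd (y : ℝ) : HasDerivAt (fun y => (x - y) / σ) (-1 / σ) y :=
    ((hasDerivAt_id y).const_sub x).div_const σ
  refine ⟨?_, ?_, ?_, fun y s _ => ?_, fun y s _ => ?_, fun y s hs => ?_⟩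
  · exact Complex.continuous_ofReal.comp_continuousOn (continuousOn_heatKernel x σ t)
  · refine (Complex.continuous_ofReal.comp_continuousOn ?_).neg
    unfold heatKernel'
    refine ContinuousOn.div_const (ContinuousOn.mul ?_ (continuousOn_heatKernel x σ t)) σ
    exact (ContinuousOn.div (by fun_prop) (by fun_prop)
      fun p hp => mul_ne_zero two_ne_zero (hne p hp)).neg
  · refine Complex.continuous_ofReal.comp_continuousOn ?_
    unfold heatKernel''
    refine ContinuousOn.div_const (ContinuousOn.mul ?_ (continuousOn_heatKernel x σ t)) (σ ^ 2)
    refine ContinuousOn.sub (ContinuousOn.div (by fun_prop) (by fun_prop)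
      fun p hp => mul_ne_zero four_ne_zero (pow_ne_zero 2 (hne p hp))) ?_
    exact ContinuousOn.div (by fun_prop) (by fun_prop)
      fun p hp => mul_ne_zero two_ne_zero (hne p hp)
  · have h := ((hasDerivAt_heatKernel ((x - y) / σ) (t - s)).comp y (hd y)).ofReal_comp
    refine h.congr_deriv ?_
    push_cast; ring
  · have h := (((hasDerivAt_heatKernel' ((x - y) / σ) (t - s)).comp y (hd y)).div_const
      σ).ofReal_comp.neg
    refine h.congr_deriv ?_
    push_cast; field_simp
  · have h := ((hasDerivAt_heatKernel_time ((x - y) / σ) (sub_pos.2 hs)).comp s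
      ((hasDerivAt_id s).const_sub t)).ofReal_comp
    refine h.congr_deriv ?_
    have : (σ : ℂ) ≠ 0 := by exact_mod_cast hσ
    push_cast; field_simp

end HeatPotential

section LayerFormula

variable {a b σ : ℝ} {v vx vt : ℝ → ℝ → ℝ} {v₀ : ℝ → ℝ}

lemma integral_exp_neg_sq_div_four : ∫ z : ℝ, Real.exp (-z ^ 2 / 4) = 2 * √Real.pi := by
  have h := integral_gaussian (1 / 4)
  have e : ∀ z : ℝ, -z ^ 2 / 4 = -(1 / 4) * z ^ 2 := fun z => by ring
  simp only [e, h]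
  rw [show Real.pi / (1 / 4) = 2 ^ 2 * Real.pi by ring, Real.sqrt_mul (by positivity),
    Real.sqrt_sq (by norm_num)]

/-- The backward heat kernel is an approximate identity as time approaches the pole. The scaling
`y = x + σ √(t - s) z` turns it into a fixed Gaussian. -/
lemma tendsto_integral_heatKernel (hσ : 0 < σ) {x t : ℝ} (hx : x ∈ Ioo a b) (ht : 0 < t)
    (hv : ContinuousOn (fun p : ℝ × ℝ => v p.1 p.2) (Icc a b ×ˢ Ioi 0)) :
    Tendsto (fun s => ∫ y in a..b, (heatKernel ((x - y) / σ) (t - s) : ℂ) * (v y s : ℂ)) (𝓝[<] t)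
      (𝓝 (2 * Real.pi * σ * v x t)) := by
  have hab : a < b := hx.1.trans hx.2
  have hC := (hv.mono (prod_mono le_rfl fun s hs => (half_pos ht).trans_le hs.1) :
    ContinuousOn (fun p : ℝ × ℝ => v p.1 p.2) (Icc a b ×ˢ Icc (t / 2) t))
  obtain ⟨M, hM⟩ := (isCompact_Icc.prod isCompact_Icc).exists_bound_of_continuousOn hC
  have hev : ∀ᶠ s in 𝓝[<] t, s ∈ Ioo (t / 2) t := Ioo_mem_nhdsLT (half_lt_self ht)
  set ρ : ℝ → ℝ := fun s => σ * √(t - s) with hρ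
  have hρ0 : ∀ s, s < t → 0 < ρ s := fun s hs =>
    mul_pos hσ (Real.sqrt_pos.2 (sub_pos.2 hs))
  set G : ℝ → ℝ → ℝ := fun s z => (Ioc a b).indicator (fun y => v y s) (x + ρ s * z)
    * (σ * √Real.pi * Real.exp (-z ^ 2 / 4)) with hG
  have hscale : ∀ s, s < t → ∫ y in a..b, heatKernel ((x - y) / σ) (t - s) * v y s
      = ∫ z, G s z := by
    intro s hs
    have hδ : 0 < t - s := sub_pos.2 hs
    rw [intervalIntegral.integral_of_le hab.le, ← integral_indicator measurableSet_Ioc,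
      ← integral_add_left_eq_self _ x]
    have h := Measure.integral_comp_mul_left (fun y => (Ioc a b).indicator
      (fun y => heatKernel ((x - y) / σ) (t - s) * v y s) (x + y)) (ρ s)
    rw [abs_of_pos (inv_pos.2 (hρ0 s hs)), smul_eq_mul, eq_inv_mul_iff_mul_eq₀ (hρ0 s hs).ne',
      ← integral_const_mul] at h
    rw [← h]
    refine integral_congr_ae (.of_forall fun z => ?_)
    simp only [hG]
    by_cases hz : x + ρ s * z ∈ Ioc a b
    · rw [indicator_of_mem hz, indicator_of_mem hz]
      have e1 : -((x - (x + ρ s * z)) / σ) ^ 2 / (4 * (t - s)) = -z ^ 2 / 4 := by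
        simp only [hρ]
        have hsq : √(t - s) ^ 2 = t - s := Real.sq_sqrt hδ.le
        field_simp
        linear_combination (-(σ ^ 2 * z ^ 2)) * hsq
      have e2 : √(t - s) * √(Real.pi / (t - s)) = √Real.pi := by
        rw [← Real.sqrt_mul hδ.le, mul_div_cancel₀ _ hδ.ne']
      rw [heatKernel, e1, ← e2]
      simp only [hρ]
      ring
    · rw [indicator_of_notMem hz, indicator_of_notMem hz]; ring
  have hlim : Tendsto (fun s => ∫ z, G s z) (𝓝[<] t)
      (𝓝 (∫ z : ℝ, v x t * (σ * √Real.pi * Real.exp (-z ^ 2 / 4)))) := by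
    have hint : Integrable fun z : ℝ => Real.exp (-z ^ 2 / 4) := by
      have := integrable_exp_neg_mul_sq (b := 1 / 4) (by norm_num)
      refine this.congr (.of_forall fun z => ?_)
      simp only; congr 1; ring
    refine tendsto_integral_filter_of_dominated_convergence
      (fun z => M * (σ * √Real.pi * Real.exp (-z ^ 2 / 4))) ?_ ?_
      ((hint.const_mul _).const_mul M) ?_
    · filter_upwards [hev] with s hs
      have hm : Measurable ((Ioc a b).indicator fun y => v y s) := by
        have hc : ContinuousOn (fun y => v y s) (Ioc a b) :=
          hv.comp (f := fun y => (y, s)) (by fun_prop)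
            fun y hy => ⟨Ioc_subset_Icc_self hy, (half_pos ht).trans hs.1⟩
        classical
        rw [← piecewise_eq_indicator]
        exact hc.measurable_piecewise continuousOn_const measurableSet_Ioc
      refine ((hm.comp (by fun_prop)).mul ?_).aestronglyMeasurable
      exact Continuous.measurable (by fun_prop)
    · filter_upwards [hev] with s hs
      refine .of_forall fun z => ?_
      have hpos : 0 ≤ σ * √Real.pi * Real.exp (-z ^ 2 / 4) := by positivity
      rw [norm_mul, Real.norm_of_nonneg hpos]
      refine mul_le_mul_of_nonneg_right ?_ hpos
      have hM0 : 0 ≤ M := (norm_nonneg _).trans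
        (hM (x, t) ⟨Ioo_subset_Icc_self hx, ⟨(half_lt_self ht).le, le_rfl⟩⟩)
      by_cases hz : x + ρ s * z ∈ Ioc a b
      · rw [indicator_of_mem hz]
        exact hM (x + ρ s * z, s) ⟨Ioc_subset_Icc_self hz, Ioo_subset_Icc_self hs⟩
      · rw [indicator_of_notMem hz, norm_zero]; exact hM0
    · refine .of_forall fun z => Tendsto.mul_const _ ?_
      have tρ : Tendsto (fun s => x + ρ s * z) (𝓝[<] t) (𝓝 x) := by
        have hc : Continuous fun s => x + ρ s * z := by simp only [hρ]; fun_prop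
        have := (hc.tendsto t).mono_left (nhdsWithin_le_nhds (s := Iio t))
        simpa [hρ] using this
      have tv : ContinuousAt (fun p : ℝ × ℝ => v p.1 p.2) (x, t) :=
        hv.continuousAt (prod_mem_nhds (Icc_mem_nhds hx.1 hx.2) (Ioi_mem_nhds ht))
      have tp := tv.tendsto.comp (tρ.prodMk_nhds (tendsto_id.mono_left nhdsWithin_le_nhds))
      refine tp.congr' ?_
      filter_upwards [tρ.eventually (Ioo_mem_nhds hx.1 hx.2)] with s hs
      rw [indicator_of_mem (Ioo_subset_Ioc_self hs)]
      rfl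
  have hval : ∫ z : ℝ, v x t * (σ * √Real.pi * Real.exp (-z ^ 2 / 4))
      = 2 * Real.pi * σ * v x t := by
    rw [integral_const_mul, integral_const_mul, integral_exp_neg_sq_div_four]
    have := Real.mul_self_sqrt Real.pi_pos.le
    linear_combination (2 * σ * v x t) * this
  rw [hval] at hlim
  have hC := (Complex.continuous_ofReal.tendsto _).comp hlim
  push_cast at hC
  refine hC.congr' ?_
  filter_upwards [hev] with s hs
  simp only [Function.comp]
  rw [← hscale s hs.2, ← intervalIntegral.integral_ofReal]
  push_cast
  rfl

/-- The classical representation of a solution by heat potentials. -/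
lemma heat_representation (hσ : 0 < σ) (hv : LayerSolution a b (σ ^ 2) v vx vt v₀) {x t : ℝ}
    (hx : x ∈ Ioo a b) (ht : 0 < t)
    (hi : IntervalIntegrable (fun s =>
      greenFlux v vx (fun y s => heatKernel ((x - y) / σ) (t - s))
        (fun y s => -(heatKernel' ((x - y) / σ) (t - s) / σ : ℝ)) b s
      - greenFlux v vx (fun y s => heatKernel ((x - y) / σ) (t - s))
        (fun y s => -(heatKernel' ((x - y) / σ) (t - s) / σ : ℝ)) a s) volume 0 t) :
    (2 * Real.pi * σ * v x t : ℂ)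
      - ∫ y in a..b, (heatKernel ((x - y) / σ) t : ℂ) * (v₀ y : ℂ)
    = (σ ^ 2 : ℝ) * ∫ s in (0 : ℝ)..t, (greenFlux v vx (fun y s => heatKernel ((x - y) / σ) (t - s))
        (fun y s => -(heatKernel' ((x - y) / σ) (t - s) / σ : ℝ)) b s
      - greenFlux v vx (fun y s => heatKernel ((x - y) / σ) (t - s))
        (fun y s => -(heatKernel' ((x - y) / σ) (t - s) / σ : ℝ)) a s) := by
  have hp := intervalIntegral.continuousOn_primitive_interval' hi left_mem_uIcc
  rw [uIcc_of_le ht.le] at hp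
  have l1 := (hp t (right_mem_Icc.2 ht.le)).tendsto
  rw [nhdsWithin_Icc_eq_nhdsLE ht] at l1
  replace l1 := l1.mono_left (nhdsWithin_mono t Iio_subset_Iic_self)
  refine tendsto_nhds_unique
    (((tendsto_integral_heatKernel hσ hx ht hv.cont).sub_const _).congr' ?_)
    (l1.const_mul ((σ ^ 2 : ℝ) : ℂ))
  filter_upwards [Ioo_mem_nhdsLT ht] with s hs
  have h := green_initial hv (adjointSolution_heatKernel x t hσ.ne') hs.1 hs.2
  rw [sub_zero] at h
  exact h

/-- The Fourier integral of the initial datum is its heat potential. -/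
lemma integral_initial (hσ : 0 < σ) (hab : a ≤ b) {x t : ℝ} (ht : 0 < t)
    (hv₀ : IntegrableOn v₀ (Ioo a b)) :
    Integrable (fun k : ℝ => Complex.exp (Complex.I * k * x - ((σ : ℂ) * k) ^ 2 * t)
        * ∫ y in a..b, Complex.exp (-(Complex.I * k * y)) * (v₀ y : ℂ)) ∧
      (∫ k : ℝ, Complex.exp (Complex.I * k * x - ((σ : ℂ) * k) ^ 2 * t)
        * ∫ y in a..b, Complex.exp (-(Complex.I * k * y)) * (v₀ y : ℂ))
      = (σ : ℂ)⁻¹ * ∫ y in a..b, (heatKernel ((x - y) / σ) t : ℂ) * (v₀ y : ℂ) := by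
  have hτ : 0 < σ ^ 2 * t := by positivity
  have hφ : IntegrableOn (fun y => (v₀ y : ℂ)) (Ioc a b) :=
    ((integrableOn_Ioc_iff_integrableOn_Ioo).2 hv₀).ofReal
  have hK : Continuous fun p : ℝ × ℝ => heatExp (x - p.2) (σ ^ 2 * t) p.1 := by
    unfold heatExp; fun_prop
  have hint := integrable_kernel_mul MeasurableSet.univ measurableSet_Ioc
    (K := fun k y => heatExp (x - y) (σ ^ 2 * t) k) hK
    (g := fun k => Real.exp (-(σ ^ 2 * t) * k ^ 2))
    (by rw [integrableOn_univ]; exact integrable_exp_neg_mul_sq hτ)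
    (fun k _ y _ => by
      rw [norm_heatExp]
      apply le_of_eq
      congr 1
      simp [← Complex.ofReal_pow]) hφ
  rw [Measure.restrict_univ] at hint
  have e : ∀ k : ℝ, Complex.exp (Complex.I * k * x - ((σ : ℂ) * k) ^ 2 * t)
        * (∫ y in a..b, Complex.exp (-(Complex.I * k * y)) * (v₀ y : ℂ))
      = ∫ y in Ioc a b, heatExp (x - y) (σ ^ 2 * t) k * (v₀ y : ℂ) := by
    intro k
    rw [intervalIntegral.integral_of_le hab, ← integral_const_mul]
    refine integral_congr_ae (.of_forall fun y => ?_)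
    simp only [heatExp]
    rw [← mul_assoc, ← Complex.exp_add]
    congr 2
    push_cast
    ring
  simp only [e]
  refine ⟨hint.integral_prod_left, ?_⟩
  rw [integral_integral_swap hint, intervalIntegral.integral_of_le hab, ← integral_const_mul]
  refine integral_congr_ae (.of_forall fun y => ?_)
  simp only
  rw [integral_mul_const, integral_heatExp _ hτ, ← mul_assoc]
  congr 1
  have h1 : √(Real.pi / (σ ^ 2 * t)) = σ⁻¹ * √(Real.pi / t) := by
    rw [show Real.pi / (σ ^ 2 * t) = (σ⁻¹) ^ 2 * (Real.pi / t) by field_simp,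
      Real.sqrt_mul (by positivity), Real.sqrt_sq (by positivity)]
  have h2 : -(x - y) ^ 2 / (4 * (σ ^ 2 * t)) = -((x - y) / σ) ^ 2 / (4 * t) := by
    field_simp
  rw [heatKernel, heatKernel, h1, h2]
  push_cast
  ring

/-- The solution formula of one layer in terms of its own boundary transforms. -/
lemma layer_formula (hσ : 0 < σ) (hv : LayerSolution a b (σ ^ 2) v vx vt v₀) {x t T R : ℝ}
    (hx : x ∈ Ioo a b) (ht : 0 < t) (htT : t ≤ T) (hR : 0 < R) :
    IntegrableMinus R (fun ν => Complex.exp (Complex.I * ν * (x - b) / σ - ν ^ 2 * t) *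
        (σ * timeTransform (vx b) (ν ^ 2) T + Complex.I * ν * timeTransform (v b) (ν ^ 2) T)) ∧
      IntegrablePlus R (fun ν => Complex.exp (Complex.I * ν * (x - a) / σ - ν ^ 2 * t) *
        (σ * timeTransform (vx a) (ν ^ 2) T + Complex.I * ν * timeTransform (v a) (ν ^ 2) T)) ∧
      (v x t : ℂ) = (2 * Real.pi : ℂ)⁻¹ *
          (∫ k : ℝ, Complex.exp (Complex.I * k * x - ((σ : ℂ) * k) ^ 2 * t)
            * ∫ y in a..b, Complex.exp (-(Complex.I * k * y)) * (v₀ y : ℂ))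
        - (2 * Real.pi : ℂ)⁻¹ * intMinus R (fun ν =>
          Complex.exp (Complex.I * ν * (x - b) / σ - ν ^ 2 * t) *
          (σ * timeTransform (vx b) (ν ^ 2) T + Complex.I * ν * timeTransform (v b) (ν ^ 2) T))
        - (2 * Real.pi : ℂ)⁻¹ * intPlus R (fun ν =>
          Complex.exp (Complex.I * ν * (x - a) / σ - ν ^ 2 * t) *
          (σ * timeTransform (vx a) (ν ^ 2) T
            + Complex.I * ν * timeTransform (v a) (ν ^ 2) T)) := by
  have hT : 0 < T := ht.trans_le htT
  have hπ : (Real.pi : ℂ) ≠ 0 := by exact_mod_cast Real.pi_ne_zero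
  have hσ' : (σ : ℂ) ≠ 0 := by exact_mod_cast hσ.ne'
  have combine : ∀ (d : ℝ) (ν : ℂ) (f : ℝ → ℝ) (z : ℂ),
      Complex.exp (Complex.I * ν * d - ν ^ 2 * t) * timeTransform f (ν ^ 2) T * z
      = ∫ s in (0 : ℝ)..T, heatExp d (t - s) ν * (z * f s) := by
    intro d ν f z
    rw [timeTransform, ← intervalIntegral.integral_const_mul, ← intervalIntegral.integral_mul_const]
    refine intervalIntegral.integral_congr fun s _ => ?_
    simp only [heatExp]
    rw [← mul_assoc, ← Complex.exp_add]
    rw [show Complex.I * ν * d - ν ^ 2 * t + ν ^ 2 * s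
      = Complex.I * ν * d - ν ^ 2 * ((t - s : ℝ) : ℂ) by push_cast; ring]
    ring
  have eP : (fun ν : ℂ => Complex.exp (Complex.I * ν * (x - a) / σ - ν ^ 2 * t) *
      (σ * timeTransform (vx a) (ν ^ 2) T + Complex.I * ν * timeTransform (v a) (ν ^ 2) T))
      = fun ν => (∫ s in (0 : ℝ)..T, heatExp ((x - a) / σ) (t - s) ν * (σ * (vx a s : ℂ)))
        + ∫ s in (0 : ℝ)..T, Complex.I * ν * heatExp ((x - a) / σ) (t - s) ν * (v a s : ℂ) := by
    funext ν
    have h2 := combine ((x - a) / σ) ν (v a) (Complex.I * ν)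
    rw [show (∫ s in (0 : ℝ)..T, Complex.I * ν * heatExp ((x - a) / σ) (t - s) ν * (v a s : ℂ))
      = ∫ s in (0 : ℝ)..T, heatExp ((x - a) / σ) (t - s) ν * (Complex.I * ν * (v a s : ℂ)) from
      intervalIntegral.integral_congr fun s _ => by ring, ← h2, ← combine,
      show Complex.I * ν * (x - a) / σ = Complex.I * ν * (((x - a) / σ : ℝ) : ℂ) by
        push_cast; ring]
    ring
  have eM : (fun ν : ℂ => Complex.exp (Complex.I * (-ν) * (x - b) / σ - (-ν) ^ 2 * t) *
      (σ * timeTransform (vx b) ((-ν) ^ 2) T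
        + Complex.I * (-ν) * timeTransform (v b) ((-ν) ^ 2) T))
      = fun ν => (∫ s in (0 : ℝ)..T, heatExp ((b - x) / σ) (t - s) ν * (σ * (vx b s : ℂ)))
        + ∫ s in (0 : ℝ)..T, Complex.I * ν * heatExp ((b - x) / σ) (t - s) ν * (-(v b s : ℂ)) := by
    funext ν
    have h2 := combine ((b - x) / σ) ν (v b) (-(Complex.I * ν))
    rw [show (∫ s in (0 : ℝ)..T, Complex.I * ν * heatExp ((b - x) / σ) (t - s) ν * (-(v b s : ℂ)))
      = ∫ s in (0 : ℝ)..T, heatExp ((b - x) / σ) (t - s) ν * (-(Complex.I * ν) * (v b s : ℂ)) from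
      intervalIntegral.integral_congr fun s _ => by ring, ← h2, ← combine, neg_sq,
      show Complex.I * (-ν) * (x - b) / σ = Complex.I * ν * (((b - x) / σ : ℝ) : ℂ) by
        push_cast; ring]
    ring
  obtain ⟨p1, p2, p3⟩ := intPlus_timeIntegral (d := (x - a) / σ)
    (div_pos (sub_pos.2 hx.1) hσ) ht htT hR (φ := fun s => σ * (vx a s : ℂ))
    (ψ := fun s => (v a s : ℂ)) ((hv.int_vx_left T hT).ofReal.const_mul _)
    (hv.int_left T hT).ofReal
  obtain ⟨m1, m2, m3⟩ := intPlus_timeIntegral (d := (b - x) / σ)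
    (div_pos (sub_pos.2 hx.2) hσ) ht htT hR (φ := fun s => σ * (vx b s : ℂ))
    (ψ := fun s => -(v b s : ℂ)) ((hv.int_vx_right T hT).ofReal.const_mul _)
    (hv.int_right T hT).ofReal.neg
  have fb : greenFlux v vx (fun y s => heatKernel ((x - y) / σ) (t - s))
        (fun y s => -(heatKernel' ((x - y) / σ) (t - s) / σ : ℝ)) b
      = fun s => (σ : ℂ)⁻¹ * (heatKernel ((b - x) / σ) (t - s) * (σ * (vx b s : ℂ))
        + heatKernel' ((b - x) / σ) (t - s) * (-(v b s : ℂ))) := by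
    funext s
    rw [greenFlux, show (x - b) / σ = -((b - x) / σ) by ring, heatKernel_neg, heatKernel'_neg]
    push_cast
    field_simp
    ring
  have fa : greenFlux v vx (fun y s => heatKernel ((x - y) / σ) (t - s))
        (fun y s => -(heatKernel' ((x - y) / σ) (t - s) / σ : ℝ)) a
      = fun s => (σ : ℂ)⁻¹ * (heatKernel ((x - a) / σ) (t - s) * (σ * (vx a s : ℂ))
        + heatKernel' ((x - a) / σ) (t - s) * (v a s : ℂ)) := by
    funext s
    rw [greenFlux]
    push_cast
    field_simp
    ring
  have rep := heat_representation hσ hv hx ht (by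
    rw [fa, fb]; exact (m2.const_mul _).sub (p2.const_mul _))
  rw [fa, fb, intervalIntegral.integral_sub (m2.const_mul _) (p2.const_mul _),
    intervalIntegral.integral_const_mul, intervalIntegral.integral_const_mul, ← m3, ← p3] at rep
  rw [integrableMinus_iff, intMinus_eq, eM, eP, (integral_initial hσ hv.lt.le ht hv.int_initial).2]
  refine ⟨m1, p1, ?_⟩
  rw [sub_eq_iff_eq_add] at rep
  have e : (v x t : ℂ) = (2 * Real.pi * σ : ℂ)⁻¹ * (2 * Real.pi * σ * v x t) := by field_simp
  rw [e, rep]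
  push_cast
  field_simp
  ring

end LayerFormula

section LinearSystem

/-! ### The linear system in terms of the global relations -/

variable {n : ℕ}

/-- `σ_j M_j(ν)`: the bracket of the global relation at the right end of the `j`-th layer. -/
def bracketM (P : Medium n) (j : ℕ) (ν : ℂ) (Z : Idx n → ℂ) : ℂ :=
  if j = n + 1 then (P.σ j : ℂ) ^ 2 * entryH₁ Z + Complex.I * P.σ j * ν * entryH₀ Z j
  else P.H j * entryG₀ Z (j + 1) + (Complex.I * P.σ j * ν - P.H j) * entryH₀ Z j

/-- `σ_j P_j(ν)`: the bracket of the global relation at the left end of the `j`-th layer. -/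
def bracketP (P : Medium n) (j : ℕ) (ν : ℂ) (Z : Idx n → ℂ) : ℂ :=
  if j = 1 then (P.σ j : ℂ) ^ 2 * entryG₁ Z + Complex.I * P.σ j * ν * entryG₀ Z j
  else (P.H (j - 1) + Complex.I * P.σ j * ν) * entryG₀ Z j - P.H (j - 1) * entryH₀ Z (j - 1)

/-- The left-hand side of the global relation of the `j`-th layer. -/
def relation (P : Medium n) (j : ℕ) (ν : ℂ) (Z : Idx n → ℂ) : ℂ :=
  E P j (P.x j) (-ν) * bracketM P j ν Z - E P j (P.x (j - 1)) (-ν) * bracketP P j ν Z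

/-- A vector indexed by `Fin N`, extended by zero to all natural numbers. -/
def extendZero {N : ℕ} (z : Fin N → ℂ) (k : ℕ) : ℂ := if h : k < N then z ⟨k, h⟩ else 0

lemma sum_ite_mul {N : ℕ} (z : Fin N → ℂ) (k : ℕ) (α : ℂ) :
    ∑ c : Fin N, (if (c : ℕ) = k then α else 0) * z c = α * extendZero z k := by
  rw [extendZero]
  split_ifs with h
  · rw [Finset.sum_eq_single ⟨k, h⟩]
    · simp
    · intro c _ hc
      rw [if_neg (fun h' => hc (Fin.ext h')), zero_mul]
    · simp
  · rw [mul_zero]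
    refine Finset.sum_eq_zero fun c _ => ?_
    rw [if_neg (fun h' : (c : ℕ) = k => h (h' ▸ c.2)), zero_mul]

lemma entryG₀_eq (Z : Idx n → ℂ) {j : ℕ} (h : j < n + 2) :
    entryG₀ Z j = extendZero (fun c => Z (Sum.inl c)) j := by
  rw [extendZero, dif_pos h, entryG₀]
  congr 2
  exact Fin.ext (Nat.mod_eq_of_lt h)

lemma entryH₀_eq (Z : Idx n → ℂ) {j : ℕ} (h : j - 1 < n + 2) :
    entryH₀ Z j = extendZero (fun c => Z (Sum.inr c)) (j - 1) := by
  rw [extendZero, dif_pos h, entryH₀]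
  congr 2
  exact Fin.ext (Nat.mod_eq_of_lt h)

lemma entryG₁_eq (Z : Idx n → ℂ) : entryG₁ Z = extendZero (fun c => Z (Sum.inl c)) 0 := by
  rw [extendZero, dif_pos (by omega), entryG₁]; rfl

lemma entryH₁_eq (Z : Idx n → ℂ) : entryH₁ Z = extendZero (fun c => Z (Sum.inr c)) (n + 1) := by
  rw [extendZero, dif_pos (by omega), entryH₁]; rfl

lemma extendZero_of_le {N : ℕ} (z : Fin N → ℂ) {k : ℕ} (h : N ≤ k) : extendZero z k = 0 := by
  rw [extendZero, dif_neg (by omega)]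

lemma A_mulVec_inl (P : Medium n) (ν : ℂ) (Z : Idx n → ℂ) (r : Fin (n + 2)) :
    (A P ν).mulVec Z (Sum.inl r) = (∑ c, A₁₁ P ν r c * Z (Sum.inl c))
      + ∑ c, A₁₂ P ν r c * Z (Sum.inr c) := by
  simp [A, Matrix.mulVec, dotProduct, Fintype.sum_sum_type]

lemma A_mulVec_inr (P : Medium n) (ν : ℂ) (Z : Idx n → ℂ) (r : Fin (n + 2)) :
    (A P ν).mulVec Z (Sum.inr r) = (∑ c, A₂₁ P ν r c * Z (Sum.inl c))
      + ∑ c, A₂₂ P ν r c * Z (Sum.inr c) := by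
  simp [A, Matrix.mulVec, dotProduct, Fintype.sum_sum_type]

lemma A_mulVec_left (P : Medium n) (ν : ℂ) (Z : Idx n → ℂ) :
    (A P ν).mulVec Z (Sum.inl 0) = P.β₂ * entryG₁ Z + P.β₁ * entryG₀ Z 1 := by
  rw [A_mulVec_inl]
  have e1 : ∀ c, A₁₁ P ν 0 c = (if (c : ℕ) = 0 then (P.β₂ : ℂ) else 0)
      + (if (c : ℕ) = 1 then (P.β₁ : ℂ) else 0) := by
    intro c; simp only [A₁₁, Matrix.of_apply]; split_ifs <;> simp_all
  have e2 : ∀ c, A₁₂ P ν 0 c = 0 := by intro c; simp [A₁₂]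
  simp only [e1, e2, add_mul, Finset.sum_add_distrib, sum_ite_mul, zero_mul, Finset.sum_const_zero,
    add_zero, entryG₁_eq, entryG₀_eq Z (show 1 < n + 2 by omega)]

lemma A_mulVec_right (P : Medium n) (ν : ℂ) (Z : Idx n → ℂ) :
    (A P ν).mulVec Z (Sum.inr (Fin.last (n + 1)))
      = P.β₃ * entryH₀ Z (n + 1) + P.β₄ * entryH₁ Z := by
  rw [A_mulVec_inr]
  have e1 : ∀ c, A₂₂ P ν (Fin.last (n + 1)) c = (if (c : ℕ) = n then (P.β₃ : ℂ) else 0)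
      + (if (c : ℕ) = n + 1 then (P.β₄ : ℂ) else 0) := by
    intro c; simp only [A₂₂, Matrix.of_apply]; split_ifs <;> simp_all
  have e2 : ∀ c, A₂₁ P ν (Fin.last (n + 1)) c = 0 := by intro c; simp [A₂₁]
  simp only [e1, e2, add_mul, Finset.sum_add_distrib, sum_ite_mul, zero_mul, Finset.sum_const_zero,
    zero_add, entryH₁_eq, entryH₀_eq Z (show n + 1 - 1 < n + 2 by omega), Nat.add_sub_cancel]

lemma E_zero (P : Medium n) (j : ℕ) (ν : ℂ) : E P j (P.x 0) ν = 1 := by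
  simp [E, P.x_zero]

/-- The entries of a row are rewritten as a sum of column indicators, so that the row picks out the
few unknowns of one global relation. The columns of neighbouring layers that do not exist carry zero
weight or fall outside the index range. -/
lemma A_mulVec_relation (P : Medium n) (ν : ℂ) (Z : Idx n → ℂ) {r : Fin (n + 2)}
    (hr : (r : ℕ) ≠ 0) :
    (A P ν).mulVec Z (Sum.inl r) = relation P r ν Z := by
  rw [A_mulVec_inl]
  obtain ⟨r, hrn⟩ := r
  simp only at hr
  have e1 : ∀ c, A₁₁ P ν ⟨r, hrn⟩ c = (if (c : ℕ) = 0 then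
        (if r = 1 then -(P.σ 1 : ℂ) ^ 2 else 0) else 0)
      + (if (c : ℕ) = r then (if r = 1 then -(Complex.I * P.σ 1 * ν)
          else -(P.H (r - 1) + Complex.I * P.σ r * ν) * E P r (P.x (r - 1)) (-ν)) else 0)
      + (if (c : ℕ) = r + 1 then P.H r * E P r (P.x r) (-ν) else 0) := by
    intro c
    simp only [A₁₁, Matrix.of_apply]
    split_ifs <;> first | omega | simp_all
  have e2 : ∀ c, A₁₂ P ν ⟨r, hrn⟩ c = (if (c : ℕ) = r - 1 then
        (if r = n + 1 then Complex.I * P.σ r * ν * E P r (P.x r) (-ν)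
          else (Complex.I * P.σ r * ν - P.H r) * E P r (P.x r) (-ν)) else 0)
      + (if (c : ℕ) = r - 2 then
        (if r = 1 then 0 else P.H (r - 1) * E P r (P.x (r - 1)) (-ν)) else 0)
      + (if (c : ℕ) = n + 1 then
        (if r = n + 1 then (P.σ r : ℂ) ^ 2 * E P r (P.x r) (-ν) else 0) else 0) := by
    intro c
    have hc := c.2
    simp only [A₁₂, Matrix.of_apply]
    split_ifs <;> first | omega | simp_all
  simp only [e1, e2, add_mul, Finset.sum_add_distrib, sum_ite_mul]
  rw [relation, bracketM, bracketP]
  rcases eq_or_ne r 1 with h1 | h1 <;> rcases eq_or_ne (n + 1) r with h2 | h2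
  · subst h1
    obtain rfl : n = 0 := by omega
    simp only [if_true, Nat.sub_self, E_zero, zero_add]
    rw [entryG₁_eq, entryH₁_eq, entryG₀_eq Z (by omega), entryH₀_eq Z (by omega),
      extendZero_of_le (fun c => Z (Sum.inl c)) (k := 1 + 1) (by omega)]
    simp only [Nat.sub_self, zero_add]
    ring
  · subst h1
    simp only [if_true, if_neg h2.symm, Nat.sub_self, E_zero]
    rw [entryG₁_eq, entryG₀_eq Z (by omega), entryG₀_eq Z (by omega), entryH₀_eq Z (by omega)]
    ring
  · simp only [if_neg h1, if_pos h2.symm]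
    rw [entryH₁_eq, entryG₀_eq Z (by omega), entryH₀_eq Z (by omega), entryH₀_eq Z (by omega),
      extendZero_of_le (fun c => Z (Sum.inl c)) (k := r + 1) (by omega), Nat.sub_sub]
    ring
  · simp only [if_neg h1, if_neg h2.symm]
    rw [entryG₀_eq Z (by omega), entryG₀_eq Z (by omega), entryH₀_eq Z (by omega),
      entryH₀_eq Z (by omega), Nat.sub_sub]
    ring

lemma A_mulVec_relation_neg (P : Medium n) (ν : ℂ) (Z : Idx n → ℂ) {r : Fin (n + 2)}
    (hr : (r : ℕ) ≠ n + 1) :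
    (A P ν).mulVec Z (Sum.inr r) = relation P (r + 1) (-ν) Z := by
  rw [A_mulVec_inr]
  obtain ⟨r, hrn⟩ := r
  simp only at hr
  have e1 : ∀ c, A₂₁ P ν ⟨r, hrn⟩ c = (if (c : ℕ) = 0 then
        (if r = 0 then -(P.σ 1 : ℂ) ^ 2 else 0) else 0)
      + (if (c : ℕ) = r + 1 then (if r = 0 then Complex.I * P.σ 1 * ν
          else (Complex.I * P.σ (r + 1) * ν - P.H r) * E P (r + 1) (P.x r) ν) else 0)
      + (if (c : ℕ) = r + 2 then P.H (r + 1) * E P (r + 1) (P.x (r + 1)) ν else 0) := by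
    intro c
    simp only [A₂₁, Matrix.of_apply]
    split_ifs <;> first | omega | simp_all
  have e2 : ∀ c, A₂₂ P ν ⟨r, hrn⟩ c = (if (c : ℕ) = r then
        (if r = n then -(Complex.I * P.σ (r + 1) * ν) * E P (r + 1) (P.x (r + 1)) ν
          else -(Complex.I * P.σ (r + 1) * ν + P.H (r + 1)) * E P (r + 1) (P.x (r + 1)) ν) else 0)
      + (if (c : ℕ) = r - 1 then
        (if r = 0 then 0 else P.H r * E P (r + 1) (P.x r) ν) else 0)
      + (if (c : ℕ) = n + 1 then
        (if r = n then (P.σ (r + 1) : ℂ) ^ 2 * E P (r + 1) (P.x (r + 1)) ν else 0) else 0) := by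
    intro c
    have hc := c.2
    simp only [A₂₂, Matrix.of_apply]
    split_ifs <;> first | omega | simp_all
  simp only [e1, e2, add_mul, Finset.sum_add_distrib, sum_ite_mul]
  rw [relation, bracketM, bracketP]
  simp only [neg_neg, Nat.add_sub_cancel, Nat.add_right_cancel_iff, Nat.add_eq_right]
  rcases eq_or_ne r 0 with h1 | h1 <;> rcases eq_or_ne r n with h2 | h2
  · subst h1 h2
    simp only [if_true, E_zero, zero_add]
    rw [entryG₁_eq, entryH₁_eq, entryG₀_eq Z (by omega), entryH₀_eq Z (by omega),
      extendZero_of_le (fun c => Z (Sum.inl c)) (k := 2) (by omega)]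
    simp only [Nat.sub_self, zero_add]
    ring
  · subst h1
    simp only [if_true, if_neg h2, E_zero]
    rw [entryG₁_eq, entryG₀_eq Z (by omega), entryG₀_eq Z (by omega), entryH₀_eq Z (by omega)]
    simp only [zero_add, Nat.sub_self]
    ring
  · simp only [if_neg h1, if_pos h2]
    rw [entryH₁_eq, entryG₀_eq Z (by omega), entryH₀_eq Z (by omega), entryH₀_eq Z (by omega),
      extendZero_of_le (fun c => Z (Sum.inl c)) (k := r + 2) (by omega), Nat.add_sub_cancel]
    ring
  · simp only [if_neg h1, if_neg h2]
    rw [entryG₀_eq Z (by omega), entryG₀_eq Z (by omega), entryH₀_eq Z (by omega),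
      entryH₀_eq Z (by omega), Nat.add_sub_cancel]
    ring

/-- The linear system `𝒜(ν) Z = W` consists of the two boundary conditions and the global relations
of all layers at `ν` and at `-ν`. -/
lemma A_mulVec_eq_iff (P : Medium n) (ν : ℂ) (Z W : Idx n → ℂ) :
    (A P ν).mulVec Z = W ↔
      P.β₂ * entryG₁ Z + P.β₁ * entryG₀ Z 1 = W (Sum.inl 0) ∧
      P.β₃ * entryH₀ Z (n + 1) + P.β₄ * entryH₁ Z = W (Sum.inr (Fin.last (n + 1))) ∧
      ∀ j, 1 ≤ j → j ≤ n + 1 → relation P j ν Z = entryG₀ W j ∧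
        relation P j (-ν) Z = entryH₀ W j := by
  have key : ∀ j, 1 ≤ j → j ≤ n + 1 → relation P j ν Z = entryG₀ ((A P ν).mulVec Z) j ∧
        relation P j (-ν) Z = entryH₀ ((A P ν).mulVec Z) j := by
    intro j h1 h2
    have m1 : j % (n + 2) = j := Nat.mod_eq_of_lt (by omega)
    have m2 : (j - 1) % (n + 2) = j - 1 := Nat.mod_eq_of_lt (by omega)
    rw [entryG₀, entryH₀, A_mulVec_relation, A_mulVec_relation_neg]
    · simp only [Fin.val_ofNat, m1, m2, Nat.sub_add_cancel h1, and_self]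
    · simp only [Fin.val_ofNat, m2]; omega
    · simp only [Fin.val_ofNat, m1]; omega
  constructor
  · rintro rfl
    exact ⟨(A_mulVec_left P ν Z).symm, (A_mulVec_right P ν Z).symm, key⟩
  · rintro ⟨h1, h2, h3⟩
    funext i
    rcases i with r | r
    · rcases eq_or_ne (r : ℕ) 0 with h | h
      · obtain rfl : r = 0 := Fin.ext h
        rw [A_mulVec_left, h1]
      · rw [A_mulVec_relation P ν Z h, (h3 r (by omega) (by omega)).1, entryG₀]
        congr 2
        exact Fin.ext (Nat.mod_eq_of_lt r.2)
    · rcases eq_or_ne (r : ℕ) (n + 1) with h | h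
      · obtain rfl : r = Fin.last (n + 1) := Fin.ext h
        rw [A_mulVec_right, h2]
      · have hr := r.2
        rw [A_mulVec_relation_neg P ν Z h, (h3 (r + 1) (by omega) (by omega)).2, entryH₀]
        congr 2
        exact Fin.ext (Nat.mod_eq_of_lt r.2)

end LinearSystem

section AprioriEstimate

/-! ### The a priori estimate for large spectral parameter -/

variable {n : ℕ}

/-- Weighted bounds for a vector of unknowns: the boundary values are bounded by `m`, the two
boundary derivatives by `r m`, where `r` stands for `|ν|`. -/
structure EntriesLe (Z : Idx n → ℂ) (r m : ℝ) : Prop where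
  left : ‖entryG₁ Z‖ ≤ r * m
  right : ‖entryH₁ Z‖ ≤ r * m
  G₀ : ∀ j, 1 ≤ j → j ≤ n + 1 → ‖entryG₀ Z j‖ ≤ m
  H₀ : ∀ j, 1 ≤ j → j ≤ n + 1 → ‖entryH₀ Z j‖ ≤ m

lemma entriesLe_iff (Z : Idx n → ℂ) (r m : ℝ) : EntriesLe Z r m ↔
    ∀ i, ‖Z i‖ ≤ (if i = Sum.inl 0 ∨ i = Sum.inr (Fin.last (n + 1)) then r else 1) * m := by
  constructor
  · rintro ⟨h1, h2, h3, h4⟩ (i | i)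
    · rcases eq_or_ne i 0 with rfl | hi
      · simpa [entryG₁] using h1
      · have h0 : (i : ℕ) ≠ 0 := fun h => hi (Fin.ext h)
        have := h3 i (by omega) (by omega)
        have e : Fin.ofNat (n + 2) (i : ℕ) = i := Fin.ext (Nat.mod_eq_of_lt i.2)
        rw [entryG₀, e] at this
        simpa [hi] using this
    · rcases eq_or_ne i (Fin.last (n + 1)) with rfl | hi
      · simpa [entryH₁] using h2
      · have h0 : (i : ℕ) ≠ n + 1 := fun h => hi (Fin.ext h)
        have := h4 (i + 1) (by omega) (by omega)
        have e : Fin.ofNat (n + 2) (i : ℕ) = i := Fin.ext (Nat.mod_eq_of_lt i.2)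
        rw [entryH₀, Nat.add_sub_cancel, e] at this
        simpa [hi] using this
  · intro h
    refine ⟨by simpa [entryG₁] using h (Sum.inl 0),
      by simpa [entryH₁] using h (Sum.inr (Fin.last (n + 1))), ?_, ?_⟩
    · intro j h1 h2
      have := h (Sum.inl (Fin.ofNat (n + 2) j))
      have hne : Fin.ofNat (n + 2) j ≠ 0 := fun h => by
        have := congrArg Fin.val h
        simp only [Fin.val_ofNat, Nat.mod_eq_of_lt (show j < n + 2 by omega)] at this
        simp at this
        omega
      rw [if_neg (by simpa using hne), one_mul] at this
      exact this
    · intro j h1 h2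
      have := h (Sum.inr (Fin.ofNat (n + 2) (j - 1)))
      have hne : Fin.ofNat (n + 2) (j - 1) ≠ Fin.last (n + 1) := fun h => by
        have := congrArg Fin.val h
        simp only [Fin.val_ofNat, Nat.mod_eq_of_lt (show j - 1 < n + 2 by omega),
          Fin.val_last] at this
        omega
      rw [if_neg (by simpa using hne), one_mul] at this
      exact this

/-- The least weighted bound. -/
lemma exists_least_entriesLe (Z : Idx n → ℂ) {r : ℝ} (hr : 0 < r) :
    ∃ m, 0 ≤ m ∧ EntriesLe Z r m ∧ ∀ q, 0 ≤ q → EntriesLe Z r q → m ≤ q := by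
  set w : Idx n → ℝ := fun i => if i = Sum.inl 0 ∨ i = Sum.inr (Fin.last (n + 1)) then r else 1
    with hw
  have hw0 : ∀ i, 0 < w i := fun i => by simp only [hw]; split_ifs <;> linarith
  set W : Idx n → ℝ := fun i => ‖Z i‖ / w i with hW
  have hWn : ∀ i, ‖W i‖ = ‖Z i‖ / w i := fun i =>
    Real.norm_of_nonneg (div_nonneg (norm_nonneg _) (hw0 i).le)
  refine ⟨‖W‖, norm_nonneg _, ?_, fun q hq h => ?_⟩
  · rw [entriesLe_iff]
    intro i
    have := norm_le_pi_norm W i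
    rw [hWn, div_le_iff₀ (hw0 i)] at this
    linarith
  · rw [entriesLe_iff] at h
    refine (pi_norm_le_iff_of_nonneg hq).2 fun i => ?_
    rw [hWn, div_le_iff₀ (hw0 i), mul_comm]
    exact h i

lemma exists_upper_bound (n : ℕ) (f : ℕ → ℝ) : ∃ C, 0 < C ∧ ∀ j, 1 ≤ j → j ≤ n + 1 → f j ≤ C := by
  obtain ⟨M, hM⟩ := ((Finset.Icc 1 (n + 1)).image f).exists_le
  refine ⟨max M 1, by positivity, fun j h1 h2 => le_max_of_le_left (hM _ ?_)⟩
  exact Finset.mem_image_of_mem f (Finset.mem_Icc.2 ⟨h1, h2⟩)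

lemma Medium.σ_pos (P : Medium n) {j : ℕ} (h1 : 1 ≤ j) (h2 : j ≤ n + 1) : 0 < P.σ j :=
  Real.sqrt_pos.2 (P.κ_pos j h1 h2)

lemma Medium.σ_sq (P : Medium n) {j : ℕ} (h1 : 1 ≤ j) (h2 : j ≤ n + 1) : P.σ j ^ 2 = P.κ j :=
  Real.sq_sqrt (P.κ_pos j h1 h2).le

lemma Medium.lt_layer (P : Medium n) {j : ℕ} (h1 : 1 ≤ j) (h2 : j ≤ n + 1) :
    P.x (j - 1) < P.x j := by
  have := P.x_lt (j - 1) (by omega)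
  rwa [Nat.sub_add_cancel h1] at this

/-- Uniform bounds for the parameters of the medium. -/
lemma exists_parameter_bounds (P : Medium n) : ∃ S h ρ L : ℝ, 0 < S ∧ 0 < h ∧ 0 < ρ ∧ 0 < L ∧
    ∀ j, 1 ≤ j → j ≤ n + 1 → P.σ j ≤ S ∧ |P.H j| ≤ h ∧ (P.σ j)⁻¹ ≤ ρ ∧
      L ≤ (P.x j - P.x (j - 1)) / P.σ j := by
  obtain ⟨S, hS, hS'⟩ := exists_upper_bound n P.σ
  obtain ⟨h, hh, hh'⟩ := exists_upper_bound n fun j => |P.H j|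
  obtain ⟨ρ, hρ, hρ'⟩ := exists_upper_bound n fun j => (P.σ j)⁻¹
  obtain ⟨L, hL, hL'⟩ := exists_upper_bound n fun j => ((P.x j - P.x (j - 1)) / P.σ j)⁻¹
  refine ⟨S, h, ρ, L⁻¹, hS, hh, hρ, inv_pos.2 hL, fun j h1 h2 => ⟨hS' j h1 h2, hh' j h1 h2,
    hρ' j h1 h2, ?_⟩⟩
  exact inv_le_of_inv_le₀ (div_pos (sub_pos.2 (P.lt_layer h1 h2)) (P.σ_pos h1 h2)) (hL' j h1 h2)

lemma norm_E_neg (P : Medium n) (j : ℕ) (y : ℝ) (ν : ℂ) :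
    ‖E P j y (-ν)‖ = Real.exp (ν.im * (y / P.σ j)) := by
  rw [E, Complex.norm_exp]
  congr 1
  rw [show Complex.I * -ν * y / P.σ j = -(Complex.I * ν * ((y / P.σ j : ℝ) : ℂ)) by
    push_cast; ring]
  simp [Complex.mul_re, Complex.mul_im]

section estimates

variable {P : Medium n} {S h : ℝ}

lemma norm_bracketM_le (hS : 0 ≤ S) (hh : 0 ≤ h) {j : ℕ} (h1 : 1 ≤ j) (h2 : j ≤ n + 1)
    (hσ : P.σ j ≤ S) (hH : |P.H j| ≤ h) {ν : ℂ} {r m : ℝ} (hr : ‖ν‖ = r) (hr1 : 1 ≤ r)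
    (hm : 0 ≤ m) {Z : Idx n → ℂ} (hZ : EntriesLe Z r m) :
    ‖bracketM P j ν Z‖ ≤ (2 * h + S + S ^ 2) * (r * m) := by
  have hσ0 := (P.σ_pos h1 h2).le
  have hH0 := hZ.H₀ j h1 h2
  have hmr : m ≤ r * m := le_mul_of_one_le_left hm hr1
  have hIσ : ‖Complex.I * P.σ j * ν * entryH₀ Z j‖ ≤ S * (r * m) := by
    rw [norm_mul, norm_mul, norm_mul, Complex.norm_I, one_mul, Complex.norm_real, hr,
      Real.norm_of_nonneg hσ0, mul_assoc]
    exact mul_le_mul hσ (mul_le_mul_of_nonneg_left hH0 (by linarith)) (by positivity) hS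
  have hH' : ‖(P.H j : ℂ)‖ ≤ h := by rwa [Complex.norm_real, Real.norm_eq_abs]
  rw [bracketM]
  split_ifs with hj
  · have : ‖(P.σ j : ℂ) ^ 2 * entryH₁ Z‖ ≤ S ^ 2 * (r * m) := by
      rw [norm_mul, norm_pow, Complex.norm_real, Real.norm_of_nonneg hσ0]
      exact mul_le_mul (pow_le_pow_left₀ hσ0 hσ 2) hZ.right (norm_nonneg _) (by positivity)
    have h3 : 0 ≤ 2 * h * (r * m) := by positivity
    linarith [norm_add_le ((P.σ j : ℂ) ^ 2 * entryH₁ Z) (Complex.I * P.σ j * ν * entryH₀ Z j)]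
  · have b1 : ‖(P.H j : ℂ) * entryG₀ Z (j + 1)‖ ≤ h * (r * m) := by
      rw [norm_mul]
      exact mul_le_mul hH' ((hZ.G₀ (j + 1) (by omega) (by omega)).trans hmr) (norm_nonneg _) hh
    have b2 : ‖(P.H j : ℂ) * entryH₀ Z j‖ ≤ h * (r * m) := by
      rw [norm_mul]
      exact mul_le_mul hH' (hH0.trans hmr) (norm_nonneg _) hh
    have b3 : 0 ≤ S ^ 2 * (r * m) := by positivity
    rw [sub_mul]
    linarith [norm_add_le ((P.H j : ℂ) * entryG₀ Z (j + 1))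
      (Complex.I * P.σ j * ν * entryH₀ Z j - P.H j * entryH₀ Z j),
      norm_sub_le (Complex.I * P.σ j * ν * entryH₀ Z j) (P.H j * entryH₀ Z j)]

lemma norm_bracketP_le (hS : 0 ≤ S) (hh : 0 ≤ h) {j : ℕ} (h1 : 1 ≤ j) (h2 : j ≤ n + 1)
    (hσ : P.σ j ≤ S) (hH : 1 < j → |P.H (j - 1)| ≤ h) {ν : ℂ} {r m : ℝ} (hr : ‖ν‖ = r)
    (hr1 : 1 ≤ r) (hm : 0 ≤ m) {Z : Idx n → ℂ} (hZ : EntriesLe Z r m) :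
    ‖bracketP P j ν Z‖ ≤ (2 * h + S + S ^ 2) * (r * m) := by
  have hσ0 := (P.σ_pos h1 h2).le
  have hG0 := hZ.G₀ j h1 h2
  have hmr : m ≤ r * m := le_mul_of_one_le_left hm hr1
  have hIσ : ‖Complex.I * P.σ j * ν * entryG₀ Z j‖ ≤ S * (r * m) := by
    rw [norm_mul, norm_mul, norm_mul, Complex.norm_I, one_mul, Complex.norm_real, hr,
      Real.norm_of_nonneg hσ0, mul_assoc]
    exact mul_le_mul hσ (mul_le_mul_of_nonneg_left hG0 (by linarith)) (by positivity) hS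
  rw [bracketP]
  split_ifs with hj
  · have : ‖(P.σ j : ℂ) ^ 2 * entryG₁ Z‖ ≤ S ^ 2 * (r * m) := by
      rw [norm_mul, norm_pow, Complex.norm_real, Real.norm_of_nonneg hσ0]
      exact mul_le_mul (pow_le_pow_left₀ hσ0 hσ 2) hZ.left (norm_nonneg _) (by positivity)
    have h3 : 0 ≤ 2 * h * (r * m) := by positivity
    linarith [norm_add_le ((P.σ j : ℂ) ^ 2 * entryG₁ Z) (Complex.I * P.σ j * ν * entryG₀ Z j)]
  · have hH' : ‖(P.H (j - 1) : ℂ)‖ ≤ h := by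
      rw [Complex.norm_real, Real.norm_eq_abs]; exact hH (by omega)
    have b1 : ‖(P.H (j - 1) : ℂ) * entryG₀ Z j‖ ≤ h * (r * m) := by
      rw [norm_mul]
      exact mul_le_mul hH' (hG0.trans hmr) (norm_nonneg _) hh
    have b2 : ‖(P.H (j - 1) : ℂ) * entryH₀ Z (j - 1)‖ ≤ h * (r * m) := by
      rw [norm_mul]
      exact mul_le_mul hH' ((hZ.H₀ (j - 1) (by omega) (by omega)).trans hmr) (norm_nonneg _) hh
    have b3 : 0 ≤ S ^ 2 * (r * m) := by positivity
    rw [add_mul]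
    linarith [norm_sub_le ((P.H (j - 1) : ℂ) * entryG₀ Z j + Complex.I * P.σ j * ν * entryG₀ Z j)
      (P.H (j - 1) * entryH₀ Z (j - 1)),
      norm_add_le ((P.H (j - 1) : ℂ) * entryG₀ Z j) (Complex.I * P.σ j * ν * entryG₀ Z j)]

end estimates

/-- A homogeneous Robin condition determines both boundary unknowns from one bracket. -/
lemma exists_robin_bound {β₁ β₂ σ : ℝ} (hβ : β₁ ≠ 0 ∨ β₂ ≠ 0) (hσ : 0 < σ) :
    ∃ K, 0 < K ∧ ∀ (ν g₀ g₁ : ℂ) (D m : ℝ), (β₂ : ℂ) * g₁ + β₁ * g₀ = 0 →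
      ‖(σ : ℂ) ^ 2 * g₁ - Complex.I * σ * ν * g₀‖ ≤ D → ‖g₀‖ ≤ m →
      ‖ν‖ * ‖g₀‖ ≤ K * (D + m) ∧ ‖g₁‖ ≤ K * (D + m) := by
  by_cases h2 : β₂ = 0
  · have h1 : (β₁ : ℂ) ≠ 0 := by
      rcases hβ with h | h
      · exact_mod_cast h
      · exact absurd h2 h
    refine ⟨(σ ^ 2)⁻¹, by positivity, fun ν g₀ g₁ D m hbc hD hm => ?_⟩
    have hg : g₀ = 0 := by
      rw [h2, Complex.ofReal_zero, zero_mul, zero_add] at hbc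
      exact (mul_eq_zero.1 hbc).resolve_left h1
    rw [hg, mul_zero, sub_zero, norm_mul, norm_pow, Complex.norm_real,
      Real.norm_of_nonneg hσ.le] at hD
    have hm0 : 0 ≤ m := (norm_nonneg _).trans hm
    have hD0 : 0 ≤ D := le_trans (by positivity) hD
    rw [hg, norm_zero, mul_zero]
    refine ⟨by positivity, ?_⟩
    rw [inv_mul_eq_div, le_div_iff₀ (by positivity), mul_comm]
    linarith
  · have h2' : (β₂ : ℂ) ≠ 0 := by exact_mod_cast h2
    set q := |β₁ / β₂| with hq
    have hq0 : 0 ≤ q := abs_nonneg _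
    refine ⟨q + σ⁻¹ + σ * q, by positivity, fun ν g₀ g₁ D m hbc hD hm => ?_⟩
    have hm0 : 0 ≤ m := (norm_nonneg _).trans hm
    have hD0 : 0 ≤ D := (norm_nonneg _).trans hD
    have hg : g₁ = -((β₁ / β₂ : ℝ) : ℂ) * g₀ := by
      push_cast
      field_simp
      linear_combination hbc
    have hg' : ‖g₁‖ ≤ q * m := by
      rw [hg, norm_mul, norm_neg, Complex.norm_real, Real.norm_eq_abs]
      exact mul_le_mul_of_nonneg_left hm hq0
    have b1 : σ * (‖ν‖ * ‖g₀‖) ≤ D + σ ^ 2 * (q * m) := by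
      have e : ‖Complex.I * σ * ν * g₀‖ = σ * (‖ν‖ * ‖g₀‖) := by
        rw [norm_mul, norm_mul, norm_mul, Complex.norm_I, one_mul, Complex.norm_real,
          Real.norm_of_nonneg hσ.le, mul_assoc]
      have e2 : ‖(σ : ℂ) ^ 2 * g₁‖ ≤ σ ^ 2 * (q * m) := by
        rw [norm_mul, norm_pow, Complex.norm_real, Real.norm_of_nonneg hσ.le]
        exact mul_le_mul_of_nonneg_left hg' (by positivity)
      have := norm_sub_norm_le (Complex.I * σ * ν * g₀) ((σ : ℂ) ^ 2 * g₁)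
      rw [norm_sub_rev] at this
      linarith
    constructor
    · have b2 : ‖ν‖ * ‖g₀‖ ≤ σ⁻¹ * (D + σ ^ 2 * (q * m)) := by
        rw [inv_mul_eq_div, le_div_iff₀ hσ]; linarith
      have e3 : σ⁻¹ * (D + σ ^ 2 * (q * m)) = σ⁻¹ * D + σ * q * m := by field_simp
      have : 0 ≤ (q + σ * q) * D + (q + σ⁻¹) * m := by positivity
      nlinarith
    · have : 0 ≤ (σ⁻¹ + σ * q) * (D + m) + q * D := by positivity
      nlinarith

/-- A bound for the solutions of `𝒜(ν) Z = W` for large `ν` in the sector `|ν| ≤ 2 Im ν`, which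
contains the closure of `D_R^+`. The two boundary rows of `W` vanish, and its other rows are
measured relative to the leading exponentials of the global relations. -/
def AprioriBound (P : Medium n) (R₀ C : ℝ) : Prop :=
  ∀ ν : ℂ, R₀ ≤ ‖ν‖ → ‖ν‖ ≤ 2 * ν.im → ∀ (Z : Idx n → ℂ) (B : ℝ), 0 ≤ B →
    P.β₂ * entryG₁ Z + P.β₁ * entryG₀ Z 1 = 0 →
    P.β₃ * entryH₀ Z (n + 1) + P.β₄ * entryH₁ Z = 0 →
    (∀ j, 1 ≤ j → j ≤ n + 1 →
      ‖relation P j ν Z‖ ≤ B * Real.exp (ν.im * (P.x j / P.σ j)) ∧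
      ‖relation P j (-ν) Z‖ ≤ B * Real.exp (-(ν.im * (P.x (j - 1) / P.σ j)))) →
    ∃ m, 0 ≤ m ∧ EntriesLe Z ‖ν‖ m ∧ ‖ν‖ * m ≤ C * B ∧
      ∀ j, 1 ≤ j → j ≤ n + 1 → ∀ μ : ℂ, ‖μ‖ = ‖ν‖ →
        ‖bracketM P j μ Z‖ ≤ C * B ∧ ‖bracketP P j μ Z‖ ≤ C * B

/-- The a priori estimate. In the upper sector the global relation at `ν`, divided by its larger
exponential, controls the bracket at the right end of a layer, the one at `-ν` controls the bracket
at the left end, up to an exponentially small multiple of the unknowns. For large `|ν|` each bracket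
is dominated by its own boundary unknown. -/
lemma exists_apriori_bound (P : Medium n) : ∃ R₀ C : ℝ, 0 < R₀ ∧ 0 ≤ C ∧ AprioriBound P R₀ C := by
  obtain ⟨S, h, ρ, L, hS, hh, hρ, hL, hbd⟩ := exists_parameter_bounds P
  obtain ⟨Kl, hKl, hleft⟩ := exists_robin_bound P.left_ne (P.σ_pos le_rfl (Nat.le_add_left 1 n))
  obtain ⟨Kr, hKr, hright⟩ := exists_robin_bound P.right_ne
    (P.σ_pos (Nat.le_add_left 1 n) le_rfl)
  set K₁ := 2 * h + S + S ^ 2 with hK₁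
  have hK₁0 : 0 < K₁ := by positivity
  set K := Kl + Kr + ρ * (1 + 2 * h) with hK
  have hK0 : 0 < K := by positivity
  have hR₀ : 0 < 1 + 4 * K + 8 * K * K₁ / L := by positivity
  -- this radius makes `K m` and `K η K₁ r m` at most `r m / 4` in the final estimate
  refine ⟨1 + 4 * K + 8 * K * K₁ / L, 2 * K * (1 + K₁), hR₀, by positivity,
    fun ν hν hν' Z B hB hl hr hrel => ?_⟩
  set r := ‖ν‖ with hrdef
  have hr0 : 0 < r := hR₀.trans_le hν
  have h8 : 0 < 8 * K * K₁ / L := by positivity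
  have hr1 : 1 ≤ r := by linarith
  have hrK : 4 * K ≤ r := by linarith
  obtain ⟨m, hm0, hZ, hmin⟩ := exists_least_entriesLe Z hr0
  -- `η` bounds the ratio of the two exponentials in a global relation, since `Im ν ≥ r / 2`
  set η := Real.exp (-(L / 2 * r)) with hη
  have hη0 : 0 < η := Real.exp_pos _
  set D := B + η * (K₁ * (r * m)) with hD
  have hD0 : 0 ≤ D := by positivity
  have hM : ∀ j, 1 ≤ j → j ≤ n + 1 → ∀ μ : ℂ, ‖μ‖ = r → ‖bracketM P j μ Z‖ ≤ K₁ * (r * m) :=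
    fun j h1 h2 μ hμ => norm_bracketM_le hS.le hh.le h1 h2 (hbd j h1 h2).1 (hbd j h1 h2).2.1
      hμ hr1 hm0 hZ
  have hP : ∀ j, 1 ≤ j → j ≤ n + 1 → ∀ μ : ℂ, ‖μ‖ = r → ‖bracketP P j μ Z‖ ≤ K₁ * (r * m) :=
    fun j h1 h2 μ hμ => norm_bracketP_le hS.le hh.le h1 h2 (hbd j h1 h2).1
      (fun hj => (hbd (j - 1) (by omega) (by omega)).2.1) hμ hr1 hm0 hZ
  have hexp : ∀ j, 1 ≤ j → j ≤ n + 1 →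
      Real.exp (ν.im * (P.x (j - 1) / P.σ j)) ≤ Real.exp (ν.im * (P.x j / P.σ j)) * η := by
    intro j h1 h2
    rw [hη, ← Real.exp_add, Real.exp_le_exp]
    have hLj := (hbd j h1 h2).2.2.2
    have hi : r / 2 ≤ ν.im := by linarith
    have : r / 2 * L ≤ ν.im * ((P.x j - P.x (j - 1)) / P.σ j) :=
      mul_le_mul hi hLj hL.le (by linarith)
    rw [sub_div, mul_sub] at this
    linarith
  have hbM : ∀ j, 1 ≤ j → j ≤ n + 1 → ‖bracketM P j ν Z‖ ≤ D := by
    intro j h1 h2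
    have hr := (hrel j h1 h2).1
    have hpos := Real.exp_pos (ν.im * (P.x j / P.σ j))
    have e1 := norm_sub_norm_le (E P j (P.x j) (-ν) * bracketM P j ν Z)
      (E P j (P.x (j - 1)) (-ν) * bracketP P j ν Z)
    rw [norm_mul, norm_mul, norm_E_neg, norm_E_neg] at e1
    have e2 := mul_le_mul (hexp j h1 h2) (hP j h1 h2 ν rfl) (norm_nonneg _) (by positivity)
    rw [relation] at hr
    refine le_of_mul_le_mul_left ?_ hpos
    rw [hD]
    linarith
  have hbP : ∀ j, 1 ≤ j → j ≤ n + 1 → ‖bracketP P j (-ν) Z‖ ≤ D := by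
    intro j h1 h2
    have hr := (hrel j h1 h2).2
    have hpos := Real.exp_pos (-(ν.im * (P.x (j - 1) / P.σ j)))
    have e1 := norm_sub_norm_le (E P j (P.x (j - 1)) (-(-ν)) * bracketP P j (-ν) Z)
      (E P j (P.x j) (-(-ν)) * bracketM P j (-ν) Z)
    rw [norm_sub_rev, norm_mul, norm_mul, norm_E_neg, norm_E_neg, Complex.neg_im, neg_mul,
      neg_mul] at e1
    have e0 : Real.exp (-(ν.im * (P.x j / P.σ j)))
        ≤ Real.exp (-(ν.im * (P.x (j - 1) / P.σ j))) * η := by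
      have := hexp j h1 h2
      rw [Real.exp_neg, Real.exp_neg, inv_mul_eq_div, le_div_iff₀ (Real.exp_pos _),
        inv_mul_eq_div, div_le_iff₀ (Real.exp_pos _)]
      linarith
    have e2 := mul_le_mul e0 (hM j h1 h2 (-ν) (norm_neg ν)) (norm_nonneg _) (by positivity)
    rw [relation] at hr
    refine le_of_mul_le_mul_left ?_ hpos
    rw [hD]
    linarith
  have hDm : 0 ≤ D + m := by positivity
  -- one interior unknown, from the bracket in which it dominates
  have interior : ∀ j, 1 ≤ j → j ≤ n + 1 → ∀ z w : ℂ, ‖z‖ = r * (P.σ j * ‖w‖) →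
      ‖z‖ ≤ D + 2 * h * m → r * ‖w‖ ≤ K * (D + m) := by
    intro j h1 h2 z w hz hle
    have hσ := P.σ_pos h1 h2
    have e1 : r * ‖w‖ ≤ (P.σ j)⁻¹ * (D + 2 * h * m) := by
      rw [inv_mul_eq_div, le_div_iff₀ hσ]; linarith
    have e2 : (P.σ j)⁻¹ * (D + 2 * h * m) ≤ ρ * (D + 2 * h * m) :=
      mul_le_mul_of_nonneg_right (hbd j h1 h2).2.2.1 (by positivity)
    have e3 : 0 ≤ (Kl + Kr) * (D + m) + ρ * (2 * h * D + m) := by positivity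
    rw [hK]
    nlinarith
  have hKlr : ∀ z, z ≤ Kl * (D + m) ∨ z ≤ Kr * (D + m) → z ≤ K * (D + m) := by
    intro z hz
    have e1 : 0 ≤ Kl * (D + m) := by positivity
    have e2 : 0 ≤ Kr * (D + m) := by positivity
    have e3 : 0 ≤ ρ * (1 + 2 * h) * (D + m) := by positivity
    rw [hK, add_mul, add_mul]
    rcases hz with hz | hz <;> linarith
  have hl' := hleft ν (entryG₀ Z 1) (entryG₁ Z) D m hl (by
    have := hbP 1 le_rfl (by omega)
    rw [bracketP, if_pos rfl] at this
    convert this using 2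
    ring) (hZ.G₀ 1 le_rfl (by omega))
  have hr' := hright (-ν) (entryH₀ Z (n + 1)) (entryH₁ Z) D m (by rw [add_comm]; exact hr) (by
    have := hbM (n + 1) (by omega) le_rfl
    rw [bracketM, if_pos rfl] at this
    convert this using 2
    ring) (hZ.H₀ (n + 1) (by omega) le_rfl)
  rw [norm_neg] at hr'
  -- `m` is the least weighted bound, so the bound `K (D + m) / r` is not smaller
  have hq : EntriesLe Z r (K * (D + m) / r) := by
    refine ⟨?_, ?_, fun j h1 h2 => ?_, fun j h1 h2 => ?_⟩
    · rw [mul_div_cancel₀ _ hr0.ne']; exact hKlr _ (Or.inl hl'.2)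
    · rw [mul_div_cancel₀ _ hr0.ne']; exact hKlr _ (Or.inr hr'.2)
    · rw [le_div_iff₀ hr0, mul_comm]
      rcases eq_or_ne j 1 with rfl | hj
      · exact hKlr _ (Or.inl hl'.1)
      · refine interior j h1 h2 (Complex.I * P.σ j * (-ν) * entryG₀ Z j) _ ?_ ?_
        · rw [norm_mul, norm_mul, norm_mul, Complex.norm_I, one_mul, Complex.norm_real, norm_neg,
            Real.norm_of_nonneg (P.σ_pos h1 h2).le, ← hrdef]
          ring
        · have hb := hbP j h1 h2
          rw [bracketP, if_neg hj] at hb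
          have hH : ‖(P.H (j - 1) : ℂ)‖ ≤ h := by
            rw [Complex.norm_real, Real.norm_eq_abs]
            exact (hbd (j - 1) (by omega) (by omega)).2.1
          have c1 : ‖(P.H (j - 1) : ℂ) * (entryG₀ Z j - entryH₀ Z (j - 1))‖ ≤ h * (m + m) := by
            rw [norm_mul]
            refine mul_le_mul hH ((norm_sub_le _ _).trans (add_le_add (hZ.G₀ j h1 h2)
              (hZ.H₀ (j - 1) (by omega) (by omega)))) (norm_nonneg _) hh.le
          have c2 := norm_sub_le ((P.H (j - 1) + Complex.I * P.σ j * -ν) * entryG₀ Z j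
            - P.H (j - 1) * entryH₀ Z (j - 1))
            ((P.H (j - 1) : ℂ) * (entryG₀ Z j - entryH₀ Z (j - 1)))
          rw [show (P.H (j - 1) + Complex.I * P.σ j * -ν) * entryG₀ Z j
            - P.H (j - 1) * entryH₀ Z (j - 1) - P.H (j - 1) * (entryG₀ Z j - entryH₀ Z (j - 1))
            = Complex.I * P.σ j * -ν * entryG₀ Z j by ring] at c2
          linarith
    · rw [le_div_iff₀ hr0, mul_comm]
      rcases eq_or_ne j (n + 1) with rfl | hj
      · exact hKlr _ (Or.inr hr'.1)
      · refine interior j h1 h2 (Complex.I * P.σ j * ν * entryH₀ Z j) _ ?_ ?_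
        · rw [norm_mul, norm_mul, norm_mul, Complex.norm_I, one_mul, Complex.norm_real,
            Real.norm_of_nonneg (P.σ_pos h1 h2).le, ← hrdef]
          ring
        · have hb := hbM j h1 h2
          rw [bracketM, if_neg hj] at hb
          have hH : ‖(P.H j : ℂ)‖ ≤ h := by
            rw [Complex.norm_real, Real.norm_eq_abs]
            exact (hbd j h1 h2).2.1
          have c1 : ‖(P.H j : ℂ) * (entryG₀ Z (j + 1) - entryH₀ Z j)‖ ≤ h * (m + m) := by
            rw [norm_mul]
            refine mul_le_mul hH ((norm_sub_le _ _).trans (add_le_add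
              (hZ.G₀ (j + 1) (by omega) (by omega)) (hZ.H₀ j h1 h2))) (norm_nonneg _) hh.le
          have c2 := norm_sub_le (P.H j * entryG₀ Z (j + 1)
            + (Complex.I * P.σ j * ν - P.H j) * entryH₀ Z j)
            ((P.H j : ℂ) * (entryG₀ Z (j + 1) - entryH₀ Z j))
          rw [show P.H j * entryG₀ Z (j + 1) + (Complex.I * P.σ j * ν - P.H j) * entryH₀ Z j
            - P.H j * (entryG₀ Z (j + 1) - entryH₀ Z j)
            = Complex.I * P.σ j * ν * entryH₀ Z j by ring] at c2
          linarith
  have hfin : r * m ≤ 2 * K * B := by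
    have h1 := hmin _ (by positivity) hq
    rw [le_div_iff₀ hr0, hD] at h1
    -- the exponentially small term is absorbed since `η ≤ 2 / (L r)`
    have h2 : η * (L / 2 * r) ≤ 1 := by
      rw [hη, Real.exp_neg, inv_mul_eq_div, div_le_one (Real.exp_pos _)]
      linarith [Real.add_one_le_exp (L / 2 * r)]
    have h3 : 8 * K * K₁ ≤ L * r := by
      have : 8 * K * K₁ / L ≤ r := by linarith
      rw [div_le_iff₀ hL] at this; linarith
    have h4 : K * (η * K₁) ≤ 1 / 4 := by nlinarith
    have h5 : K * (η * (K₁ * (r * m))) ≤ 1 / 4 * (r * m) := by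
      have := mul_le_mul_of_nonneg_right h4 (show 0 ≤ r * m by positivity)
      linarith
    have h6 : K * m ≤ 1 / 4 * (r * m) := by
      have := mul_le_mul_of_nonneg_right hrK hm0
      linarith
    linarith
  have hKB : 0 ≤ 2 * K * B := by positivity
  have hKKB : 0 ≤ 2 * K * B * K₁ := by positivity
  refine ⟨m, hm0, hZ, by linarith, fun j h1 h2 μ hμ => ?_⟩
  have hfin' : K₁ * (r * m) ≤ 2 * K * (1 + K₁) * B := by
    have := mul_le_mul_of_nonneg_left hfin hK₁0.le
    linarith
  exact ⟨(hM j h1 h2 μ hμ).trans hfin', (hP j h1 h2 μ hμ).trans hfin'⟩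

end AprioriEstimate

section FinalTime

variable {n : ℕ}

/-! ### Holomorphy of the solution of the linear system -/

lemma differentiableAt_det {ι : Type*} [Fintype ι] [DecidableEq ι] {M : ℂ → Matrix ι ι ℂ} {ν : ℂ}
    (h : ∀ i j, DifferentiableAt ℂ (fun z => M z i j) ν) :
    DifferentiableAt ℂ (fun z => (M z).det) ν := by
  simp only [Matrix.det_apply']
  exact DifferentiableAt.fun_sum fun p _ =>
    (DifferentiableAt.fun_finsetProd fun i _ => h (p i) i).const_mul _

/-- Cramer's rule shows that the solution of a linear system depends holomorphically on a
parameter. -/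
lemma differentiableAt_inv_mulVec {ι : Type*} [Fintype ι] [DecidableEq ι] {M : ℂ → Matrix ι ι ℂ}
    {w : ℂ → ι → ℂ} {ν : ℂ} (h : ∀ i j, DifferentiableAt ℂ (fun z => M z i j) ν)
    (hw : ∀ i, DifferentiableAt ℂ (fun z => w z i) ν) (hdet : (M ν).det ≠ 0) (i : ι) :
    DifferentiableAt ℂ (fun z => ((M z)⁻¹.mulVec (w z)) i) ν := by
  have e : ∀ z, ((M z)⁻¹.mulVec (w z)) i = ((M z).det)⁻¹ * ((M z).updateCol i (w z)).det := by
    intro z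
    rw [Matrix.inv_def, Matrix.smul_mulVec, ← Matrix.cramer_eq_adjugate_mulVec, Pi.smul_apply,
      Matrix.cramer_apply, Ring.inverse_eq_inv', smul_eq_mul]
  simp only [e]
  refine ((differentiableAt_det h).inv hdet).mul (differentiableAt_det fun k l => ?_)
  by_cases hl : l = i
  · simp only [Matrix.updateCol_apply, if_pos hl]; exact hw k
  · simp only [Matrix.updateCol_apply, if_neg hl]; exact h k l

lemma differentiable_A (P : Medium n) (i j : Idx n) : Differentiable ℂ fun ν => A P ν i j := by
  rcases i with i | i <;> rcases j with j | j
  · simp only [A, Matrix.fromBlocks_apply₁₁, A₁₁, Matrix.of_apply, E]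
    split_ifs <;> fun_prop
  · simp only [A, Matrix.fromBlocks_apply₁₂, A₁₂, Matrix.of_apply, E]
    split_ifs <;> fun_prop
  · simp only [A, Matrix.fromBlocks_apply₂₁, A₂₁, Matrix.of_apply, E]
    split_ifs <;> fun_prop
  · simp only [A, Matrix.fromBlocks_apply₂₂, A₂₂, Matrix.of_apply, E]
    split_ifs <;> fun_prop

lemma norm_exp_neg_I_mul (k : ℂ) (y : ℝ) :
    ‖Complex.exp (-(Complex.I * k * y))‖ = Real.exp (k.im * y) := by
  rw [Complex.norm_exp]
  congr 1
  simp [Complex.mul_re, Complex.mul_im]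

/-- The Fourier transform of a continuous function on a layer is entire. -/
lemma differentiable_spaceTransform (P : Medium n) (j : ℕ) {φ : ℝ → ℝ}
    (hφ : ContinuousOn φ (uIcc (P.x (j - 1)) (P.x j))) :
    Differentiable ℂ (spaceTransform P j φ) := by
  intro k₀
  obtain ⟨M, hM⟩ := (isCompact_uIcc.prod (isCompact_closedBall k₀ 1) :
    IsCompact (uIcc (P.x (j - 1)) (P.x j) ×ˢ Metric.closedBall k₀ 1)).exists_bound_of_continuousOn
    (f := fun p : ℝ × ℂ =>
      -(Complex.I * p.1) * Complex.exp (-(Complex.I * p.2 * p.1)) * (φ p.1 : ℂ)) (by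
      refine ContinuousOn.mul (Continuous.continuousOn (by fun_prop)) ?_
      exact Complex.continuous_ofReal.comp_continuousOn
        (hφ.comp continuousOn_fst fun p hp => hp.1))
  have hφC : ContinuousOn (fun y => (φ y : ℂ)) (uIcc (P.x (j - 1)) (P.x j)) :=
    Complex.continuous_ofReal.comp_continuousOn hφ
  have hc : ∀ k : ℂ, ContinuousOn (fun y : ℝ => Complex.exp (-(Complex.I * k * y)) * (φ y : ℂ))
      (uIcc (P.x (j - 1)) (P.x j)) := fun k =>
    ContinuousOn.mul (Continuous.continuousOn (by fun_prop)) hφC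
  refine (intervalIntegral.hasDerivAt_integral_of_dominated_loc_of_deriv_le
    (F := fun k (y : ℝ) => Complex.exp (-(Complex.I * k * y)) * (φ y : ℂ))
    (F' := fun k (y : ℝ) => -(Complex.I * y) * Complex.exp (-(Complex.I * k * y)) * (φ y : ℂ))
    (bound := fun _ => M) (s := Metric.closedBall k₀ 1)
    (Metric.closedBall_mem_nhds k₀ one_pos) (.of_forall fun k => ?_)
    (hc k₀).intervalIntegrable ?_ ?_ intervalIntegrable_const ?_).2.differentiableAt
  · exact ((hc k).mono uIoc_subset_uIcc).aestronglyMeasurable measurableSet_uIoc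
  · refine ContinuousOn.aestronglyMeasurable ?_ measurableSet_uIoc
    exact ContinuousOn.mul (Continuous.continuousOn (by fun_prop)) (hφC.mono uIoc_subset_uIcc)
  · exact .of_forall fun y hy k hk => hM (y, k) ⟨uIoc_subset_uIcc hy, hk⟩
  · refine .of_forall fun y _ k _ => ?_
    have h := (((hasDerivAt_id k).const_mul Complex.I).mul_const (y : ℂ)).neg.cexp.mul_const
      (φ y : ℂ)
    refine h.congr_deriv ?_
    simp only [Pi.neg_apply, id]
    ring

/-- Growth of the Fourier transform of a function on a layer. -/
lemma norm_spaceTransform_le (P : Medium n) {j : ℕ} (hj : P.x (j - 1) ≤ P.x j) {φ : ℝ → ℝ}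
    (hφ : ContinuousOn φ (uIcc (P.x (j - 1)) (P.x j))) {k : ℂ} {e : ℝ}
    (he : ∀ y ∈ Icc (P.x (j - 1)) (P.x j), k.im * y ≤ e) :
    ‖spaceTransform P j φ k‖ ≤ (∫ y in (P.x (j - 1))..(P.x j), |φ y|) * Real.exp e := by
  rw [spaceTransform, ← intervalIntegral.integral_mul_const]
  refine intervalIntegral.norm_integral_le_of_norm_le hj (.of_forall fun y hy => ?_)
    ((hφ.abs.intervalIntegrable).mul_const _)
  rw [norm_mul, norm_exp_neg_I_mul, Complex.norm_real, Real.norm_eq_abs, mul_comm]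
  exact mul_le_mul_of_nonneg_left (Real.exp_le_exp.2 (he y (Ioc_subset_Icc_self hy)))
    (abs_nonneg _)

/-! ### The final-time transforms contribute nothing -/

lemma entryG₀_sumElim (f g : ℕ → ℂ) {j : ℕ} (h2 : j ≤ n + 1) :
    entryG₀ (n := n) (Sum.elim (fun i => f i) fun i => g i) j = f j := by
  rw [entryG₀, Sum.elim_inl, Fin.val_ofNat, Nat.mod_eq_of_lt (by omega)]

lemma entryH₀_sumElim (f g : ℕ → ℂ) {j : ℕ} (h2 : j ≤ n + 1) :
    entryH₀ (n := n) (Sum.elim (fun i => f i) fun i => g i) j = g (j - 1) := by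
  rw [entryH₀, Sum.elim_inr, Fin.val_ofNat, Nat.mod_eq_of_lt (by omega)]

lemma entryG₀_Yfinal (P : Medium n) (u : ℕ → ℝ → ℝ → ℝ) (T : ℝ) (ν : ℂ) {j : ℕ} (h1 : 1 ≤ j)
    (h2 : j ≤ n + 1) : entryG₀ (Yfinal P u T ν) j
      = Complex.exp (ν ^ 2 * T) * spaceTransform P j (fun y => u j y T) (ν / P.σ j) := by
  rw [Yfinal, entryG₀_sumElim (fun i => if i = 0 then 0
      else Complex.exp (ν ^ 2 * T) * spaceTransform P i (fun y => u i y T) (ν / P.σ i))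
    (fun i => if i = n + 1 then 0 else Complex.exp (ν ^ 2 * T) *
        spaceTransform P (i + 1) (fun y => u (i + 1) y T) (-ν / P.σ (i + 1))) h2]
  rw [if_neg (by omega)]

lemma entryH₀_Yfinal (P : Medium n) (u : ℕ → ℝ → ℝ → ℝ) (T : ℝ) (ν : ℂ) {j : ℕ} (h1 : 1 ≤ j)
    (h2 : j ≤ n + 1) : entryH₀ (Yfinal P u T ν) j
      = Complex.exp (ν ^ 2 * T) * spaceTransform P j (fun y => u j y T) (-ν / P.σ j) := by
  rw [Yfinal, entryH₀_sumElim (fun i => if i = 0 then 0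
      else Complex.exp (ν ^ 2 * T) * spaceTransform P i (fun y => u i y T) (ν / P.σ i))
    (fun i => if i = n + 1 then 0 else Complex.exp (ν ^ 2 * T) *
        spaceTransform P (i + 1) (fun y => u (i + 1) y T) (-ν / P.σ (i + 1))) h2]
  rw [if_neg (by omega), Nat.sub_add_cancel h1]

lemma Yfinal_left (P : Medium n) (u : ℕ → ℝ → ℝ → ℝ) (T : ℝ) (ν : ℂ) :
    Yfinal P u T ν (Sum.inl 0) = 0 := by simp [Yfinal]

lemma Yfinal_right (P : Medium n) (u : ℕ → ℝ → ℝ → ℝ) (T : ℝ) (ν : ℂ) :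
    Yfinal P u T ν (Sum.inr (Fin.last (n + 1))) = 0 := by simp [Yfinal]

lemma minusIntegrand_eq (P : Medium n) {j : ℕ} (h1 : 1 ≤ j) (h2 : j ≤ n + 1) (y t : ℝ)
    (Z : ℂ → Idx n → ℂ) (ν : ℂ) : minusIntegrand P j y t Z ν =
      Complex.exp (Complex.I * ν * (y - P.x j) / P.σ j - ν ^ 2 * t) *
        ((P.σ j : ℂ)⁻¹ * bracketM P j ν (Z ν)) := by
  have hσ : (P.σ j : ℂ) ≠ 0 := by exact_mod_cast (P.σ_pos h1 h2).ne'
  rw [minusIntegrand, bracketM]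
  split_ifs
  · congr 1; field_simp
  · rfl

lemma plusIntegrand_eq (P : Medium n) {j : ℕ} (h1 : 1 ≤ j) (h2 : j ≤ n + 1) (y t : ℝ)
    (Z : ℂ → Idx n → ℂ) (ν : ℂ) : plusIntegrand P j y t Z ν =
      Complex.exp (Complex.I * ν * (y - P.x (j - 1)) / P.σ j - ν ^ 2 * t) *
        ((P.σ j : ℂ)⁻¹ * bracketP P j ν (Z ν)) := by
  have hσ : (P.σ j : ℂ) ≠ 0 := by exact_mod_cast (P.σ_pos h1 h2).ne'
  rw [plusIntegrand, bracketP]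
  split_ifs
  · congr 1; field_simp
  · rfl

lemma differentiableAt_minusIntegrand (P : Medium n) (j : ℕ) (y t : ℝ) {Z : ℂ → Idx n → ℂ} {ν : ℂ}
    (hZ : ∀ i, DifferentiableAt ℂ (fun z => Z z i) ν) :
    DifferentiableAt ℂ (minusIntegrand P j y t Z) ν := by
  have e1 := hZ (Sum.inr (Fin.last (n + 1)))
  have e2 := hZ (Sum.inr (Fin.ofNat (n + 2) (j - 1)))
  have e3 := hZ (Sum.inl (Fin.ofNat (n + 2) (j + 1)))
  unfold minusIntegrand
  refine DifferentiableAt.mul (by fun_prop) ?_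
  split_ifs
  · simp only [entryH₁, entryH₀]; fun_prop
  · simp only [entryG₀, entryH₀]; fun_prop

lemma differentiableAt_plusIntegrand (P : Medium n) (j : ℕ) (y t : ℝ) {Z : ℂ → Idx n → ℂ} {ν : ℂ}
    (hZ : ∀ i, DifferentiableAt ℂ (fun z => Z z i) ν) :
    DifferentiableAt ℂ (plusIntegrand P j y t Z) ν := by
  have e1 := hZ (Sum.inl 0)
  have e2 := hZ (Sum.inl (Fin.ofNat (n + 2) j))
  have e3 := hZ (Sum.inr (Fin.ofNat (n + 2) (j - 1 - 1)))
  unfold plusIntegrand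
  refine DifferentiableAt.mul (by fun_prop) ?_
  split_ifs
  · simp only [entryG₁, entryG₀]; fun_prop
  · simp only [entryG₀, entryH₀]; fun_prop

section

variable {P : Medium n} {R₀ C : ℝ}

/-- A vector in the kernel of `𝒜(ν)` satisfies the a priori bound with zero right-hand side. -/
lemma det_ne_zero_of_bound (hR₀ : 0 < R₀) (hb : AprioriBound P R₀ C) {ν : ℂ} (h1 : R₀ ≤ ‖ν‖)
    (h2 : ‖ν‖ ≤ 2 * |ν.im|) : (A P ν).det ≠ 0 := by
  intro hdet
  obtain ⟨Z, hZ, hA⟩ := Matrix.exists_mulVec_eq_zero_iff.2 hdet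
  rw [A_mulVec_eq_iff] at hA
  obtain ⟨hl, hr, hrel⟩ := hA
  -- the homogeneous system is invariant under `ν ↦ -ν`
  obtain ⟨μ, hμ1, hμ2, hμ3⟩ : ∃ μ : ℂ, ‖μ‖ = ‖ν‖ ∧ ‖μ‖ ≤ 2 * μ.im ∧
      ∀ j, 1 ≤ j → j ≤ n + 1 → relation P j μ Z = 0 ∧ relation P j (-μ) Z = 0 := by
    rcases abs_cases ν.im with ⟨h, -⟩ | ⟨h, -⟩
    · exact ⟨ν, rfl, h ▸ h2, hrel⟩
    · refine ⟨-ν, norm_neg ν, by rw [norm_neg, Complex.neg_im, ← h]; exact h2, fun j a b => ?_⟩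
      rw [neg_neg]
      exact (hrel j a b).symm
  obtain ⟨m, hm, hle, hmB, -⟩ := hb μ (hμ1 ▸ h1) hμ2 Z 0 le_rfl hl hr fun j a b => by
    rw [(hμ3 j a b).1, (hμ3 j a b).2]; simp
  have hm0 : m = 0 := by
    have hpos : 0 < ‖μ‖ := hμ1 ▸ hR₀.trans_le h1
    rw [mul_zero] at hmB
    exact le_antisymm (nonpos_of_mul_nonpos_right hmB hpos) hm
  rw [hm0, entriesLe_iff] at hle
  exact hZ (funext fun i => by simpa using hle i)

/-- The solution of the system with the final-time transforms on the right-hand side. -/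
def Zfinal (P : Medium n) (u : ℕ → ℝ → ℝ → ℝ) (T : ℝ) (ν : ℂ) : Idx n → ℂ :=
  (A P ν)⁻¹.mulVec (Yfinal P u T ν)

variable {u : ℕ → ℝ → ℝ → ℝ} {T : ℝ}

lemma A_mulVec_Zfinal {ν : ℂ} (hdet : (A P ν).det ≠ 0) :
    (A P ν).mulVec (Zfinal P u T ν) = Yfinal P u T ν := by
  rw [Zfinal, Matrix.mulVec_mulVec, Matrix.mul_nonsing_inv _ (isUnit_iff_ne_zero.2 hdet),
    Matrix.one_mulVec]

/-- `Zfinal` is even: the systems at `ν` and at `-ν` consist of the same equations. -/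
lemma Zfinal_neg {ν : ℂ} (hdet : (A P ν).det ≠ 0) (hdet' : (A P (-ν)).det ≠ 0) :
    Zfinal P u T (-ν) = Zfinal P u T ν := by
  have h := A_mulVec_Zfinal (u := u) (T := T) hdet
  rw [A_mulVec_eq_iff] at h
  have h' : (A P (-ν)).mulVec (Zfinal P u T ν) = Yfinal P u T (-ν) := by
    rw [A_mulVec_eq_iff]
    refine ⟨?_, ?_, fun j h1 h2 => ?_⟩
    · rw [h.1, Yfinal_left, Yfinal_left]
    · rw [h.2.1, Yfinal_right, Yfinal_right]
    · rw [neg_neg, (h.2.2 j h1 h2).1, (h.2.2 j h1 h2).2, entryG₀_Yfinal P u T _ h1 h2,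
        entryH₀_Yfinal P u T _ h1 h2, entryG₀_Yfinal P u T _ h1 h2, entryH₀_Yfinal P u T _ h1 h2]
      simp
  rw [Zfinal, ← h', Matrix.mulVec_mulVec, Matrix.nonsing_inv_mul _ (isUnit_iff_ne_zero.2 hdet'),
    Matrix.one_mulVec]

lemma differentiable_Yfinal (hu : ∀ j, 1 ≤ j → j ≤ n + 1 →
      ContinuousOn (fun y => u j y T) (uIcc (P.x (j - 1)) (P.x j))) (i : Idx n) :
    Differentiable ℂ fun ν => Yfinal P u T ν i := by
  have hs : ∀ j, 1 ≤ j → j ≤ n + 1 → ∀ c : ℂ, Differentiable ℂ fun ν : ℂ =>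
      Complex.exp (ν ^ 2 * T) * spaceTransform P j (fun y => u j y T) (c * ν) := fun j h1 h2 c =>
    Differentiable.mul (by fun_prop)
      ((differentiable_spaceTransform P j (hu j h1 h2)).comp (by fun_prop))
  rcases i with i | i
  · simp only [Yfinal, Sum.elim_inl]
    split_ifs with h
    · fun_prop
    · simpa only [inv_mul_eq_div] using hs i (by omega) (by omega) (P.σ i : ℂ)⁻¹
  · simp only [Yfinal, Sum.elim_inr]
    split_ifs with h
    · fun_prop
    · have := hs (i + 1) (by omega) (by omega) (-(P.σ (i + 1) : ℂ)⁻¹)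
      simpa only [neg_mul, inv_mul_eq_div, ← neg_div] using this

lemma differentiableAt_Zfinal (hu : ∀ j, 1 ≤ j → j ≤ n + 1 →
      ContinuousOn (fun y => u j y T) (uIcc (P.x (j - 1)) (P.x j))) {ν : ℂ}
    (hdet : (A P ν).det ≠ 0) (i : Idx n) : DifferentiableAt ℂ (fun z => Zfinal P u T z i) ν :=
  differentiableAt_inv_mulVec (fun i j => differentiable_A P i j ν)
    (fun i => differentiable_Yfinal hu i ν) hdet i

/-- The brackets of `Zfinal` grow at most like `|e^{ν²T}|`: the growth of the final-time
transforms in the sector is exactly that of the leading exponentials of the global relations. -/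
lemma exists_bracket_Zfinal_bound (hR₀ : 0 < R₀) (hC : 0 ≤ C) (hb : AprioriBound P R₀ C)
    (hu : ∀ j, 1 ≤ j → j ≤ n + 1 →
      ContinuousOn (fun y => u j y T) (uIcc (P.x (j - 1)) (P.x j))) :
    ∃ N, 0 ≤ N ∧ ∀ ν : ℂ, R₀ ≤ ‖ν‖ → ‖ν‖ ≤ 2 * ν.im → ∀ j, 1 ≤ j → j ≤ n + 1 →
      ∀ μ : ℂ, ‖μ‖ = ‖ν‖ →
        ‖bracketM P j μ (Zfinal P u T ν)‖ ≤ N * Real.exp (T * (ν ^ 2).re) ∧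
        ‖bracketP P j μ (Zfinal P u T ν)‖ ≤ N * Real.exp (T * (ν ^ 2).re) := by
  obtain ⟨M, hM, hM'⟩ := exists_upper_bound n
    fun j => ∫ y in (P.x (j - 1))..(P.x j), |u j y T|
  refine ⟨C * M, by positivity, fun ν h1 h2 j hj1 hj2 μ hμ => ?_⟩
  have him : 0 ≤ ν.im := by linarith [norm_nonneg ν]
  have hdet : (A P ν).det ≠ 0 := det_ne_zero_of_bound hR₀ hb h1 (by rwa [abs_of_nonneg him])
  have hA := A_mulVec_Zfinal (u := u) (T := T) hdet
  rw [A_mulVec_eq_iff, Yfinal_left, Yfinal_right] at hA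
  obtain ⟨hl, hr, hrel⟩ := hA
  have hexp : ‖Complex.exp (ν ^ 2 * T)‖ = Real.exp (T * (ν ^ 2).re) := by
    rw [Complex.norm_exp, Complex.re_mul_ofReal, mul_comm]
  obtain ⟨m, -, -, -, h⟩ := hb ν h1 h2 (Zfinal P u T ν) (Real.exp (T * (ν ^ 2).re) * M)
    (by positivity) hl hr fun i hi1 hi2 => by
      have hσ := P.σ_pos hi1 hi2
      have hx := (P.lt_layer hi1 hi2).le
      rw [(hrel i hi1 hi2).1, (hrel i hi1 hi2).2, entryG₀_Yfinal P u T _ hi1 hi2,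
        entryH₀_Yfinal P u T _ hi1 hi2, norm_mul, norm_mul, hexp, mul_assoc, mul_assoc]
      have s1 := norm_spaceTransform_le P hx (hu i hi1 hi2) (k := ν / P.σ i)
        (e := ν.im * (P.x i / P.σ i)) fun y hy => by
          rw [Complex.div_ofReal_im, div_mul_eq_mul_div, mul_div_assoc]
          exact mul_le_mul_of_nonneg_left (div_le_div_of_nonneg_right hy.2 hσ.le) him
      have s2 := norm_spaceTransform_le P hx (hu i hi1 hi2) (k := -ν / P.σ i)
        (e := -(ν.im * (P.x (i - 1) / P.σ i))) fun y hy => by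
          rw [Complex.div_ofReal_im, Complex.neg_im, div_mul_eq_mul_div, mul_div_assoc, neg_mul,
            neg_le_neg_iff]
          exact mul_le_mul_of_nonneg_left (div_le_div_of_nonneg_right hy.1 hσ.le) him
      exact ⟨mul_le_mul_of_nonneg_left (s1.trans (mul_le_mul_of_nonneg_right (hM' i hi1 hi2)
          (Real.exp_pos _).le)) (Real.exp_pos _).le,
        mul_le_mul_of_nonneg_left (s2.trans (mul_le_mul_of_nonneg_right (hM' i hi1 hi2)
          (Real.exp_pos _).le)) (Real.exp_pos _).le⟩
  have e : C * (Real.exp (T * (ν ^ 2).re) * M) = C * M * Real.exp (T * (ν ^ 2).re) := by ring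
  rw [← e]
  exact h j hj1 hj2 μ hμ

/-- A contour integral over `∂D_R^+` of `e^{iνd - ν²t}` times a holomorphic function that grows at
most like `|e^{ν²T}|` in the sector converges absolutely and vanishes, if `t ≤ T`. -/
lemma intPlus_eq_zero_of_bound {R d t N : ℝ} (hR : 0 < R) (hd : 0 < d) (htT : t ≤ T) (hN : 0 ≤ N)
    {F G : ℂ → ℂ} (hF : ∀ ν, F ν = heatExp d t ν * G ν)
    (hdiff : ∀ r, R ≤ r → ∀ θ ∈ uIcc (3 * Real.pi / 4) (Real.pi / 4),
      DifferentiableAt ℂ F (polar r θ))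
    (hG : ∀ r, R ≤ r → ∀ θ ∈ uIcc (3 * Real.pi / 4) (Real.pi / 4),
      ‖G (polar r θ)‖ ≤ N * Real.exp (T * ((polar r θ) ^ 2).re)) :
    IntegrablePlus R F ∧ intPlus R F = 0 := by
  have hbound : ∀ r, R ≤ r → ∀ θ ∈ uIcc (3 * Real.pi / 4) (Real.pi / 4),
      ‖F (polar r θ)‖ ≤ N * Real.exp (-(d / 2) * r) := by
    intro r hr θ hθ
    have h1 := norm_heatExp_le_of_nonpos hd (sub_nonpos.2 htT) (hR.le.trans hr) hθ
    rw [norm_heatExp] at h1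
    rw [hF, norm_mul, norm_heatExp]
    calc _ ≤ Real.exp (-(d * (polar r θ).im) - t * ((polar r θ) ^ 2).re)
          * (N * Real.exp (T * ((polar r θ) ^ 2).re)) :=
          mul_le_mul_of_nonneg_left (hG r hr θ hθ) (Real.exp_pos _).le
      _ = N * Real.exp (-(d * (polar r θ).im) - (t - T) * ((polar r θ) ^ 2).re) := by
          rw [mul_left_comm, ← Real.exp_add]
          congr 2
          ring
      _ ≤ _ := mul_le_mul_of_nonneg_left h1 hN
  exact ⟨contourIntegrable_of_bound (half_pos hd) (fun r hr θ hθ => (hdiff r hr θ hθ).continuousAt)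
    hbound, contourIntegral_eq_zero hR (half_pos hd) hdiff hbound⟩

lemma polar_mem_sector {R r θ : ℝ} (hR : 0 < R) (hr : R ≤ r)
    (hθ : θ ∈ uIcc (3 * Real.pi / 4) (Real.pi / 4)) :
    R ≤ ‖polar r θ‖ ∧ ‖polar r θ‖ ≤ 2 * (polar r θ).im := by
  have hr0 : 0 ≤ r := hR.le.trans hr
  rw [norm_polar hr0, polar_im]
  refine ⟨hr, ?_⟩
  have := mul_le_mul_of_nonneg_left (half_le_sin hθ) hr0
  linarith

/-- The bound on the brackets leaves `e^{iνd - ν²(t - T)}` with `t ≤ T`, which decays in the whole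
sector. -/
lemma contributesZero_Zfinal (hR₀ : 0 < R₀) (hC : 0 ≤ C) (hb : AprioriBound P R₀ C)
    (hu : ∀ j, 1 ≤ j → j ≤ n + 1 →
      ContinuousOn (fun y => u j y T) (uIcc (P.x (j - 1)) (P.x j)))
    {R t y : ℝ} {j : ℕ} (hR : R₀ ≤ R) (htT : t ≤ T) (h1 : 1 ≤ j) (h2 : j ≤ n + 1)
    (hy : y ∈ P.openLayer j) : ContributesZero P R j y t (Zfinal P u T) := by
  obtain ⟨N, hN, hbr⟩ := exists_bracket_Zfinal_bound hR₀ hC hb hu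
  have hσ := P.σ_pos h1 h2
  have hRpos : 0 < R := hR₀.trans_le hR
  have hσN : 0 ≤ (P.σ j)⁻¹ * N := by positivity
  have sec : ∀ r, R ≤ r → ∀ θ ∈ uIcc (3 * Real.pi / 4) (Real.pi / 4),
      R₀ ≤ ‖polar r θ‖ ∧ ‖polar r θ‖ ≤ 2 * (polar r θ).im := fun r hr θ hθ =>
    ⟨hR.trans (polar_mem_sector hRpos hr hθ).1, (polar_mem_sector hRpos hr hθ).2⟩
  have hdet : ∀ r, R ≤ r → ∀ θ ∈ uIcc (3 * Real.pi / 4) (Real.pi / 4),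
      (A P (polar r θ)).det ≠ 0 ∧ (A P (-polar r θ)).det ≠ 0 := by
    intro r hr θ hθ
    obtain ⟨s1, s2⟩ := sec r hr θ hθ
    have s3 : ‖polar r θ‖ ≤ 2 * |(polar r θ).im| := by linarith [le_abs_self (polar r θ).im]
    refine ⟨det_ne_zero_of_bound hR₀ hb s1 s3, det_ne_zero_of_bound hR₀ hb ?_ ?_⟩
    · rwa [norm_neg]
    · rwa [norm_neg, Complex.neg_im, abs_neg]
  have hnorm : ∀ z : ℂ, ‖(P.σ j : ℂ)⁻¹ * z‖ = (P.σ j)⁻¹ * ‖z‖ := fun z => by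
    rw [norm_mul, norm_inv, Complex.norm_real, Real.norm_of_nonneg hσ.le]
  obtain ⟨p1, p2⟩ := intPlus_eq_zero_of_bound (T := T) (t := t) hRpos
    (div_pos (sub_pos.2 hy.1) hσ) htT hσN
    (F := plusIntegrand P j y t (Zfinal P u T))
    (G := fun ν => (P.σ j : ℂ)⁻¹ * bracketP P j ν (Zfinal P u T ν))
    (fun ν => by
      rw [plusIntegrand_eq P h1 h2, heatExp]
      congr 3
      push_cast; ring)
    (fun r hr θ hθ => differentiableAt_plusIntegrand P j y t
      fun i => differentiableAt_Zfinal hu (hdet r hr θ hθ).1 i)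
    (fun r hr θ hθ => by
      rw [hnorm, mul_assoc]
      exact mul_le_mul_of_nonneg_left
        (hbr _ (sec r hr θ hθ).1 (sec r hr θ hθ).2 j h1 h2 _ rfl).2 (by positivity))
  obtain ⟨m1, m2⟩ := intPlus_eq_zero_of_bound (T := T) (t := t) hRpos
    (div_pos (sub_pos.2 hy.2) hσ) htT hσN
    (F := fun ν => minusIntegrand P j y t (Zfinal P u T) (-ν))
    (G := fun ν => (P.σ j : ℂ)⁻¹ * bracketM P j (-ν) (Zfinal P u T (-ν)))
    (fun ν => by
      rw [minusIntegrand_eq P h1 h2, heatExp]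
      congr 2
      push_cast; ring)
    (fun r hr θ hθ => by
      have := differentiableAt_minusIntegrand P j y t
        fun i => differentiableAt_Zfinal hu (hdet r hr θ hθ).2 i
      exact this.comp (f := fun ν : ℂ => -ν) (polar r θ) differentiableAt_id.neg)
    (fun r hr θ hθ => by
      rw [hnorm, mul_assoc, Zfinal_neg (hdet r hr θ hθ).1 (hdet r hr θ hθ).2]
      exact mul_le_mul_of_nonneg_left
        (hbr _ (sec r hr θ hθ).1 (sec r hr θ hθ).2 j h1 h2 _ (norm_neg _)).1 (by positivity))
  exact ⟨(integrableMinus_iff _ _).2 m1, p1, by rw [intMinus_eq, m2, neg_zero], p2⟩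

end

end FinalTime

section Composite

variable {n : ℕ} {P : Medium n} {u₀ : ℕ → ℝ → ℝ} {f₁ f₂ : ℝ → ℝ} {u : ℕ → ℝ → ℝ → ℝ}

/-! ### The layers of a composite solution -/

lemma IsSolution.layerSolution (hs : IsSolution P u₀ f₁ f₂ u) {j : ℕ} (h1 : 1 ≤ j)
    (h2 : j ≤ n + 1) :
    LayerSolution (P.x (j - 1)) (P.x j) (P.σ j ^ 2) (u j) (P.ux u j)
      (fun y t => deriv (fun s => u j y s) t) (u₀ j) := by
  have hκ := P.κ_pos j h1 h2
  rw [P.σ_sq h1 h2]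
  exact
  { lt := P.lt_layer h1 h2
    κ_pos := hκ
    cont := hs.continuousOn j h1 h2
    cont_vx := hs.continuousOn_ux j h1 h2
    cont_vt := hs.continuousOn_ut j h1 h2
    deriv_x := fun y hy s h => ((hs.differentiableOn j h1 h2 s h y
      (Ioo_subset_Icc_self hy)).hasDerivWithinAt).hasDerivAt (Icc_mem_nhds hy.1 hy.2)
    deriv_xx := fun y hy s h => by
      have := (hs.differentiableAt_ux j h1 h2 y hy s h).hasDerivAt
      refine this.congr_deriv ?_
      rw [hs.heat j h1 h2 y hy s h, mul_div_cancel_left₀ _ hκ.ne']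
    deriv_t := fun y hy s h => (hs.differentiableAt_time j h1 h2 y hy s h).hasDerivAt
    int_initial := hs.integrable_initial j h1 h2
    initial := hs.initial j h1 h2
    int_left := hs.integrable_left j h1 h2
    int_right := hs.integrable_right j h1 h2
    int_vx_left := hs.integrable_ux_left j h1 h2
    int_vx_right := hs.integrable_ux_right j h1 h2 }

lemma IsSolution.continuousOn_slice (hs : IsSolution P u₀ f₁ f₂ u) {T : ℝ} (hT : 0 < T) {j : ℕ}
    (h1 : 1 ≤ j) (h2 : j ≤ n + 1) :
    ContinuousOn (fun y => u j y T) (uIcc (P.x (j - 1)) (P.x j)) := by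
  rw [uIcc_of_le (P.lt_layer h1 h2).le]
  exact (hs.continuousOn j h1 h2).comp (f := fun y => (y, T)) (by fun_prop) fun _ hy => ⟨hy, hT⟩

/-- Time transforms respect linear relations between integrable traces. -/
lemma timeTransform_linear {f g h : ℝ → ℝ} {T : ℝ} (hT : 0 < T) (hf : IntegrableOn f (Ioc 0 T))
    (hg : IntegrableOn g (Ioc 0 T)) (a b : ℝ) (hfg : ∀ t, 0 < t → a * f t + b * g t = h t) (ω : ℂ) :
    a * timeTransform f ω T + b * timeTransform g ω T = timeTransform h ω T := by
  have i0 : ∀ f : ℝ → ℝ, IntegrableOn f (Ioc 0 T) → IntervalIntegrable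
      (fun s : ℝ => Complex.exp (ω * s) * (f s : ℂ)) volume 0 T := by
    intro f hf
    have h1 : IntervalIntegrable (fun s => (f s : ℂ)) volume 0 T :=
      (intervalIntegrable_iff_integrableOn_Ioc_of_le hT.le).2 hf.ofReal
    exact h1.continuousOn_mul (Continuous.continuousOn (by fun_prop))
  simp only [timeTransform]
  rw [← intervalIntegral.integral_const_mul, ← intervalIntegral.integral_const_mul,
    ← intervalIntegral.integral_add ((i0 f hf).const_mul _) ((i0 g hg).const_mul _)]
  refine intervalIntegral.integral_congr_ae (.of_forall fun s hs => ?_)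
  rw [uIoc_of_le hT.le] at hs
  rw [← hfg s hs.1]
  push_cast
  ring

lemma entryG₁_X (P : Medium n) (u : ℕ → ℝ → ℝ → ℝ) (T : ℝ) (ν : ℂ) :
    entryG₁ (X P u T ν) = g₁ P u 1 (ν ^ 2) T := by simp [X, entryG₁]

lemma entryH₁_X (P : Medium n) (u : ℕ → ℝ → ℝ → ℝ) (T : ℝ) (ν : ℂ) :
    entryH₁ (X P u T ν) = h₁ P u (n + 1) (ν ^ 2) T := by simp [X, entryH₁]

lemma entryG₀_X (P : Medium n) (u : ℕ → ℝ → ℝ → ℝ) (T : ℝ) (ν : ℂ) {j : ℕ} (h1 : 1 ≤ j)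
    (h2 : j ≤ n + 1) : entryG₀ (X P u T ν) j = g₀ P u j (ν ^ 2) T := by
  rw [X, entryG₀_sumElim (fun i => if i = 0 then g₁ P u 1 (ν ^ 2) T else g₀ P u i (ν ^ 2) T)
    (fun i => if i = n + 1 then h₁ P u (n + 1) (ν ^ 2) T else h₀ P u (i + 1) (ν ^ 2) T) h2,
    if_neg (by omega)]

lemma entryH₀_X (P : Medium n) (u : ℕ → ℝ → ℝ → ℝ) (T : ℝ) (ν : ℂ) {j : ℕ} (h1 : 1 ≤ j)
    (h2 : j ≤ n + 1) : entryH₀ (X P u T ν) j = h₀ P u j (ν ^ 2) T := by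
  rw [X, entryH₀_sumElim (fun i => if i = 0 then g₁ P u 1 (ν ^ 2) T else g₀ P u i (ν ^ 2) T)
    (fun i => if i = n + 1 then h₁ P u (n + 1) (ν ^ 2) T else h₀ P u (i + 1) (ν ^ 2) T) h2,
    if_neg (by omega), Nat.sub_add_cancel h1]

lemma entryG₀_Y (P : Medium n) (u₀ : ℕ → ℝ → ℝ) (f₁ f₂ : ℝ → ℝ) (T : ℝ) (ν : ℂ) {j : ℕ}
    (h1 : 1 ≤ j) (h2 : j ≤ n + 1) :
    entryG₀ (Y P u₀ f₁ f₂ T ν) j = -spaceTransform P j (u₀ j) (ν / P.σ j) := by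
  rw [Y, entryG₀_sumElim (fun i => if i = 0 then timeTransform f₁ (ν ^ 2) T
      else -spaceTransform P i (u₀ i) (ν / P.σ i))
    (fun i => if i = n + 1 then timeTransform f₂ (ν ^ 2) T
      else -spaceTransform P (i + 1) (u₀ (i + 1)) (-ν / P.σ (i + 1))) h2, if_neg (by omega)]

lemma entryH₀_Y (P : Medium n) (u₀ : ℕ → ℝ → ℝ) (f₁ f₂ : ℝ → ℝ) (T : ℝ) (ν : ℂ) {j : ℕ}
    (h1 : 1 ≤ j) (h2 : j ≤ n + 1) :
    entryH₀ (Y P u₀ f₁ f₂ T ν) j = -spaceTransform P j (u₀ j) (-ν / P.σ j) := by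
  rw [Y, entryH₀_sumElim (fun i => if i = 0 then timeTransform f₁ (ν ^ 2) T
      else -spaceTransform P i (u₀ i) (ν / P.σ i))
    (fun i => if i = n + 1 then timeTransform f₂ (ν ^ 2) T
      else -spaceTransform P (i + 1) (u₀ (i + 1)) (-ν / P.σ (i + 1))) h2, if_neg (by omega),
    Nat.sub_add_cancel h1]

/-- The contact condition turns the bracket at the right end of a layer into the boundary transforms
of that layer alone. -/
lemma bracketM_X (hs : IsSolution P u₀ f₁ f₂ u) {T : ℝ} (hT : 0 < T) {j : ℕ} (h1 : 1 ≤ j)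
    (h2 : j ≤ n + 1) (μ ν : ℂ) :
    bracketM P j μ (X P u T ν) = (P.σ j : ℂ) ^ 2 * timeTransform (P.ux u j (P.x j)) (ν ^ 2) T
      + Complex.I * P.σ j * μ * timeTransform (u j (P.x j)) (ν ^ 2) T := by
  rw [bracketM]
  split_ifs with hj
  · subst hj
    rw [entryH₁_X, entryH₀_X P u T ν h1 h2, h₁, h₀]
  · rw [entryG₀_X P u T ν (show 1 ≤ j + 1 by omega) (by omega), entryH₀_X P u T ν h1 h2, g₀, h₀,
      Nat.add_sub_cancel]
    have hl := timeTransform_linear hT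
      (f := fun s => u (j + 1) (P.x j) s) (g := fun s => u j (P.x j) s)
      (h := fun s => P.κ j * P.ux u j (P.x j) s)
      (hs.integrable_left (j + 1) (by omega) (by omega) T hT) (hs.integrable_right j h1 h2 T hT)
      (P.H j) (-P.H j) (fun t ht => by
        rw [hs.interface_left j h1 (by omega) t ht]; ring) (ν ^ 2)
    have hk : timeTransform (fun s => P.κ j * P.ux u j (P.x j) s) (ν ^ 2) T
        = (P.σ j : ℂ) ^ 2 * timeTransform (P.ux u j (P.x j)) (ν ^ 2) T := by
      rw [← Complex.ofReal_pow, P.σ_sq h1 h2, timeTransform, timeTransform,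
        ← intervalIntegral.integral_const_mul]
      refine intervalIntegral.integral_congr fun s _ => ?_
      push_cast; ring
    rw [hk] at hl
    rw [← hl]
    push_cast
    ring

/-- The analogue of `bracketM_X` at the left end of a layer. -/
lemma bracketP_X (hs : IsSolution P u₀ f₁ f₂ u) {T : ℝ} (hT : 0 < T) {j : ℕ} (h1 : 1 ≤ j)
    (h2 : j ≤ n + 1) (μ ν : ℂ) :
    bracketP P j μ (X P u T ν)
      = (P.σ j : ℂ) ^ 2 * timeTransform (P.ux u j (P.x (j - 1))) (ν ^ 2) T
        + Complex.I * P.σ j * μ * timeTransform (u j (P.x (j - 1))) (ν ^ 2) T := by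
  rw [bracketP]
  split_ifs with hj
  · subst hj
    rw [entryG₁_X, entryG₀_X P u T ν h1 h2, g₁, g₀]
  · rw [entryG₀_X P u T ν h1 h2, entryH₀_X P u T ν (show 1 ≤ j - 1 by omega) (by omega), g₀, h₀]
    have hl := timeTransform_linear hT
      (f := fun s => u j (P.x (j - 1)) s) (g := fun s => u (j - 1) (P.x (j - 1)) s)
      (h := fun s => P.κ j * P.ux u j (P.x (j - 1)) s)
      (hs.integrable_left j h1 h2 T hT)
      (hs.integrable_right (j - 1) (by omega) (by omega) T hT)
      (P.H (j - 1)) (-P.H (j - 1)) (fun t ht => by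
        have := hs.interface_right (j - 1) (by omega) (by omega) t ht
        rw [Nat.sub_add_cancel h1] at this
        rw [this]; ring) (ν ^ 2)
    have hk : timeTransform (fun s => P.κ j * P.ux u j (P.x (j - 1)) s) (ν ^ 2) T
        = (P.σ j : ℂ) ^ 2 * timeTransform (P.ux u j (P.x (j - 1))) (ν ^ 2) T := by
      rw [← Complex.ofReal_pow, P.σ_sq h1 h2, timeTransform, timeTransform,
        ← intervalIntegral.integral_const_mul]
      refine intervalIntegral.integral_congr fun s _ => ?_
      push_cast; ring
    rw [hk] at hl
    rw [← hl]
    push_cast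
    ring

/-- The global relation of the `j`-th layer at `±ν`, for the true boundary transforms. -/
lemma relation_X (hs : IsSolution P u₀ f₁ f₂ u) {T : ℝ} (hT : 0 < T) {j : ℕ} (h1 : 1 ≤ j)
    (h2 : j ≤ n + 1) {μ ν : ℂ} (hμ : μ ^ 2 = ν ^ 2) :
    relation P j μ (X P u T ν)
      = Complex.exp (ν ^ 2 * T) * spaceTransform P j (fun y => u j y T) (μ / P.σ j)
        - spaceTransform P j (u₀ j) (μ / P.σ j) := by
  have hσ : (P.σ j : ℂ) ≠ 0 := by exact_mod_cast (P.σ_pos h1 h2).ne'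
  have h := global_relation (hs.layerSolution h1 h2) hT (μ / P.σ j)
  have e : ((P.σ j ^ 2 : ℝ) : ℂ) * (μ / P.σ j) ^ 2 = ν ^ 2 := by
    rw [← hμ]; push_cast; field_simp
  have eE : ∀ y : ℝ, E P j y (-μ) = Complex.exp (-(Complex.I * (μ / P.σ j) * y)) := by
    intro y; rw [E]; congr 1; ring
  rw [e] at h
  rw [relation, bracketM_X hs hT h1 h2, bracketP_X hs hT h1 h2, eE, eE, spaceTransform,
    spaceTransform, h]
  push_cast
  field_simp

lemma A_mulVec_X (hs : IsSolution P u₀ f₁ f₂ u) {T : ℝ} (hT : 0 < T) (ν : ℂ) :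
    (A P ν).mulVec (X P u T ν) = Yfinal P u T ν + Y P u₀ f₁ f₂ T ν := by
  rw [A_mulVec_eq_iff]
  refine ⟨?_, ?_, fun j h1 h2 => ⟨?_, ?_⟩⟩
  · rw [Pi.add_apply, Yfinal_left, zero_add, entryG₁_X, entryG₀_X P u T ν le_rfl (by omega), g₁, g₀,
      timeTransform_linear hT (hs.integrable_ux_left 1 le_rfl (by omega) T hT)
        (hs.integrable_left 1 le_rfl (by omega) T hT) P.β₂ P.β₁ (h := f₁)
        (fun t ht => by rw [add_comm]; exact hs.left_bc t ht)]
    simp [Y]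
  · rw [Pi.add_apply, Yfinal_right, zero_add, entryH₁_X, entryH₀_X P u T ν (by omega) le_rfl,
      h₁, h₀, timeTransform_linear hT (hs.integrable_right (n + 1) (by omega) le_rfl T hT)
        (hs.integrable_ux_right (n + 1) (by omega) le_rfl T hT) P.β₃ P.β₄ (h := f₂) hs.right_bc]
    simp [Y]
  · rw [relation_X hs hT h1 h2 rfl]
    have e := entryG₀_Yfinal P u T ν h1 h2
    have e' := entryG₀_Y P u₀ f₁ f₂ T ν h1 h2
    rw [entryG₀] at e e' ⊢
    rw [Pi.add_apply, e, e', sub_eq_add_neg]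
  · rw [relation_X hs hT h1 h2 (neg_sq ν)]
    have e := entryH₀_Yfinal P u T ν h1 h2
    have e' := entryH₀_Y P u₀ f₁ f₂ T ν h1 h2
    rw [entryH₀] at e e' ⊢
    rw [Pi.add_apply, e, e', sub_eq_add_neg]

/-- The solution formula holds with the true transforms, for every radius of the contours. -/
lemma formulaHolds_X (hs : IsSolution P u₀ f₁ f₂ u) {T t R y : ℝ} (ht : 0 < t) (htT : t ≤ T)
    (hR : 0 < R) {j : ℕ} (h1 : 1 ≤ j) (h2 : j ≤ n + 1) (hy : y ∈ P.openLayer j) :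
    FormulaHolds P u₀ u R j y t (X P u T) := by
  have hT : 0 < T := ht.trans_le htT
  have hσ := P.σ_pos h1 h2
  have hσ' : (P.σ j : ℂ) ≠ 0 := by exact_mod_cast hσ.ne'
  have hl := hs.layerSolution h1 h2
  obtain ⟨m, p, h⟩ := layer_formula hσ hl hy ht htT hR
  have eM : minusIntegrand P j y t (X P u T) = fun ν : ℂ =>
      Complex.exp (Complex.I * ν * (y - P.x j) / P.σ j - ν ^ 2 * t) *
        (P.σ j * timeTransform (P.ux u j (P.x j)) (ν ^ 2) T
          + Complex.I * ν * timeTransform (u j (P.x j)) (ν ^ 2) T) := by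
    funext ν
    rw [minusIntegrand_eq P h1 h2, bracketM_X hs hT h1 h2]
    congr 1
    field_simp
  have eP : plusIntegrand P j y t (X P u T) = fun ν : ℂ =>
      Complex.exp (Complex.I * ν * (y - P.x (j - 1)) / P.σ j - ν ^ 2 * t) *
        (P.σ j * timeTransform (P.ux u j (P.x (j - 1))) (ν ^ 2) T
          + Complex.I * ν * timeTransform (u j (P.x (j - 1))) (ν ^ 2) T) := by
    funext ν
    rw [plusIntegrand_eq P h1 h2, bracketP_X hs hT h1 h2]
    congr 1
    field_simp
  refine ⟨(integral_initial hσ hl.lt.le ht hl.int_initial).1, ?_, ?_, ?_⟩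
  · rw [eM]; exact m
  · rw [eP]; exact p
  · rw [solutionFormula, eM, eP]; exact h

/-! ### Replacing the transforms by the solution of the linear system -/

lemma minusIntegrand_add_mul (P : Medium n) (j : ℕ) (y t : ℝ) (Z W : ℂ → Idx n → ℂ) (z ν : ℂ) :
    minusIntegrand P j y t (fun ν => Z ν + z • W ν) ν
      = minusIntegrand P j y t Z ν + z * minusIntegrand P j y t W ν := by
  simp only [minusIntegrand, entryH₁, entryH₀, entryG₀, Pi.add_apply, Pi.smul_apply, smul_eq_mul]
  split_ifs <;> ring

lemma plusIntegrand_add_mul (P : Medium n) (j : ℕ) (y t : ℝ) (Z W : ℂ → Idx n → ℂ) (z ν : ℂ) :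
    plusIntegrand P j y t (fun ν => Z ν + z • W ν) ν
      = plusIntegrand P j y t Z ν + z * plusIntegrand P j y t W ν := by
  simp only [plusIntegrand, entryG₁, entryH₀, entryG₀, Pi.add_apply, Pi.smul_apply, smul_eq_mul]
  split_ifs <;> ring

/-- Unknowns whose contour integrals vanish may be subtracted in the solution formula; only values
on the contours matter. -/
lemma FormulaHolds.sub {R y t : ℝ} {j : ℕ} {Z W V : ℂ → Idx n → ℂ}
    (hZ : FormulaHolds P u₀ u R j y t Z) (hW : ContributesZero P R j y t W)
    (hplus : ∀ r, R ≤ r → ∀ θ ∈ uIcc (3 * Real.pi / 4) (Real.pi / 4),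
      V (polar r θ) = Z (polar r θ) - W (polar r θ))
    (hminus : ∀ r, R ≤ r → ∀ θ ∈ uIcc (-(Real.pi / 4)) (-(3 * Real.pi / 4)),
      V (polar r θ) = Z (polar r θ) - W (polar r θ)) :
    FormulaHolds P u₀ u R j y t V := by
  have em : ∀ r, R ≤ r → ∀ θ ∈ uIcc (-(Real.pi / 4)) (-(3 * Real.pi / 4)),
      minusIntegrand P j y t Z (polar r θ) + (-1) * minusIntegrand P j y t W (polar r θ)
        = minusIntegrand P j y t V (polar r θ) := by
    intro r hr θ hθ
    rw [← minusIntegrand_add_mul]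
    simp only [minusIntegrand, hminus r hr θ hθ, neg_smul, one_smul, sub_eq_add_neg]
  have ep : ∀ r, R ≤ r → ∀ θ ∈ uIcc (3 * Real.pi / 4) (Real.pi / 4),
      plusIntegrand P j y t Z (polar r θ) + (-1) * plusIntegrand P j y t W (polar r θ)
        = plusIntegrand P j y t V (polar r θ) := by
    intro r hr θ hθ
    rw [← plusIntegrand_add_mul]
    simp only [plusIntegrand, hplus r hr θ hθ, neg_smul, one_smul, sub_eq_add_neg]
  obtain ⟨z0, z1, z2, z3⟩ := hZ
  obtain ⟨w1, w2, w3, w4⟩ := hW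
  have hm := ContourIntegrable.integral_add z1 (ContourIntegrable.const_mul w1 (-1))
  have hp := ContourIntegrable.integral_add z2 (ContourIntegrable.const_mul w2 (-1))
  rw [contourIntegral_const_mul, contourIntegral_congr em] at hm
  rw [contourIntegral_const_mul, contourIntegral_congr ep] at hp
  rw [intMinus] at w3
  rw [intPlus] at w4
  rw [w3, mul_zero, add_zero] at hm
  rw [w4, mul_zero, add_zero] at hp
  refine ⟨z0, (ContourIntegrable.add z1 (ContourIntegrable.const_mul w1 (-1))).congr em,
    (ContourIntegrable.add z2 (ContourIntegrable.const_mul w2 (-1))).congr ep, ?_⟩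
  rw [z3, solutionFormula, solutionFormula, intMinus, intPlus, intMinus, intPlus, hm, hp]

lemma norm_le_two_mul_abs_im {ν : ℂ} (h : (ν ^ 2).re ≤ 0) : ‖ν‖ ≤ 2 * |ν.im| := by
  rw [sq, Complex.mul_re] at h
  have hn := Complex.sq_norm ν
  rw [Complex.normSq_apply] at hn
  refine le_of_sq_le_sq ?_ (by positivity)
  rw [hn, mul_pow, sq_abs]
  nlinarith [sq_nonneg ν.im]

lemma mem_closure_D {R : ℝ} {ν : ℂ} (h : ν ∈ closure (Dplus R) ∪ closure (Dminus R)) :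
    R ≤ ‖ν‖ ∧ (ν ^ 2).re ≤ 0 := by
  have hc : IsClosed {ν : ℂ | R ≤ ‖ν‖ ∧ (ν ^ 2).re ≤ 0} := by
    refine IsClosed.inter (isClosed_le continuous_const continuous_norm) ?_
    exact isClosed_le (Complex.continuous_re.comp (continuous_pow 2)) continuous_const
  have h1 : Dplus R ⊆ {ν : ℂ | R ≤ ‖ν‖ ∧ (ν ^ 2).re ≤ 0} := fun z hz => ⟨hz.2.2.le, hz.2.1.le⟩
  have h2 : Dminus R ⊆ {ν : ℂ | R ≤ ‖ν‖ ∧ (ν ^ 2).re ≤ 0} := fun z hz => ⟨hz.2.2.le, hz.2.1.le⟩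
  exact h.elim (fun h => closure_minimal h1 hc h) fun h => closure_minimal h2 hc h

lemma polar_sector_lower {r θ : ℝ}
    (hθ : θ ∈ uIcc (-(Real.pi / 4)) (-(3 * Real.pi / 4))) :
    ‖polar r θ‖ ≤ 2 * |(polar r θ).im| := by
  refine norm_le_two_mul_abs_im ?_
  have hπ := Real.pi_pos
  rw [uIcc_of_ge (by linarith)] at hθ
  rw [polar_sq_re, ← Real.cos_neg]
  refine mul_nonpos_of_nonneg_of_nonpos (sq_nonneg r) ?_
  exact Real.cos_nonpos_of_pi_div_two_le_of_le (by linarith [hθ.2]) (by linarith [hθ.1])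

/-- The solution of the system with known data is the vector of true transforms minus the
contribution of the final-time transforms. -/
lemma inv_mulVec_Y (hs : IsSolution P u₀ f₁ f₂ u) {T : ℝ} (hT : 0 < T) {ν : ℂ}
    (hdet : (A P ν).det ≠ 0) :
    (A P ν)⁻¹.mulVec (Y P u₀ f₁ f₂ T ν) = X P u T ν - Zfinal P u T ν := by
  have h : Y P u₀ f₁ f₂ T ν = (A P ν).mulVec (X P u T ν - Zfinal P u T ν) := by
    rw [Matrix.mulVec_sub, A_mulVec_X hs hT, A_mulVec_Zfinal hdet, add_sub_cancel_left]
  rw [h, Matrix.mulVec_mulVec, Matrix.nonsing_inv_mul _ (isUnit_iff_ne_zero.2 hdet),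
    Matrix.one_mulVec]

end Composite

end MultilayerHeat

end

open MultilayerHeat in
theorem mainTheorem1 (n : ℕ) (P : MultilayerHeat.Medium n) :
    ∃ R₀ : ℝ, 0 < R₀ ∧
      (∀ R : ℝ, R₀ ≤ R →
        ∀ ν ∈ closure (MultilayerHeat.Dplus R) ∪ closure (MultilayerHeat.Dminus R),
          (MultilayerHeat.A P ν).det ≠ 0) ∧
      ∀ (u₀ : ℕ → ℝ → ℝ) (f₁ f₂ : ℝ → ℝ) (u : ℕ → ℝ → ℝ → ℝ),
        MultilayerHeat.IsSolution P u₀ f₁ f₂ u →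
        ∀ T : ℝ, 0 < T →
          (∀ ν : ℂ, (MultilayerHeat.A P ν).mulVec (MultilayerHeat.X P u T ν)
            = MultilayerHeat.Yfinal P u T ν + MultilayerHeat.Y P u₀ f₁ f₂ T ν) ∧
          ∀ t : ℝ, 0 < t → t ≤ T → ∀ j : ℕ, 1 ≤ j → j ≤ n + 1 → ∀ y ∈ P.openLayer j,
            (∀ R : ℝ, 0 < R →
              MultilayerHeat.FormulaHolds P u₀ u R j y t (MultilayerHeat.X P u T)) ∧
            (∀ R : ℝ, R₀ ≤ R →
              MultilayerHeat.FormulaHolds P u₀ u R j y t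
                  (fun ν => (MultilayerHeat.A P ν)⁻¹.mulVec (MultilayerHeat.Y P u₀ f₁ f₂ T ν)) ∧
              MultilayerHeat.ContributesZero P R j y t
                  (fun ν => (MultilayerHeat.A P ν)⁻¹.mulVec (MultilayerHeat.Yfinal P u T ν))) := by
  obtain ⟨R₀, C, hR₀, hC, hb⟩ := exists_apriori_bound P
  refine ⟨R₀, hR₀, fun R hR ν hν => ?_, fun u₀ f₁ f₂ u hs T hT => ⟨A_mulVec_X hs hT,
    fun t ht htT j h1 h2 y hy => ⟨fun R hR => formulaHolds_X hs ht htT hR h1 h2 hy,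
      fun R hR => ?_⟩⟩⟩
  · obtain ⟨h1, h2⟩ := mem_closure_D hν
    exact det_ne_zero_of_bound hR₀ hb (hR.trans h1) (norm_le_two_mul_abs_im h2)
  · have hRpos : 0 < R := hR₀.trans_le hR
    have hz : ContributesZero P R j y t (Zfinal P u T) :=
      contributesZero_Zfinal hR₀ hC hb (fun i a b => hs.continuousOn_slice hT a b) hR htT h1 h2 hy
    refine ⟨(formulaHolds_X hs ht htT hRpos h1 h2 hy).sub hz (fun r hr θ hθ => ?_)
      (fun r hr θ hθ => ?_), hz⟩
    · obtain ⟨s1, s2⟩ := polar_mem_sector hRpos hr hθ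
      exact inv_mulVec_Y hs hT (det_ne_zero_of_bound hR₀ hb (hR.trans s1)
        (s2.trans (mul_le_mul_of_nonneg_left (le_abs_self _) zero_le_two)))
    · have hr0 : 0 ≤ r := hRpos.le.trans hr
      refine inv_mulVec_Y hs hT (det_ne_zero_of_bound hR₀ hb ?_ (polar_sector_lower hθ))
      rw [norm_polar hr0]
      exact hR.trans hr
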